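/- Let $\mathbf{R}$ be a field of characteristic $0$. **Complete gr-dg modules.** A *filtered gr-dg $\mathbf{R}$-module* is a $\mathbb{Z}$-graded $\mathbf{R}$-module $V$ with a decreasing filtration $V=F_0V\supseteq F_1V\supseteq\cdots$ by graded submodules and a degree $-1$ map $d:V\to V$ such that $d(F_pV)\subseteq F_pV$ and $d^2(F_pV)\subseteq F_{p+1}V$ for all $p\in\mathbb{N}$. Morphisms are the degree $0$ linear maps that preserve the filtrations and commute with $d$. $V$ is *complete* if $V\to\lim_p V/F_pV$ is an isomorphism in each degree. A morphism $f:V\to W$ is a *graded quasi-isomorphism* if it induces quasi-isomorphisms of chain complexes $F_pV/F_{p+1}V\to F_pW/F_{p+1}W$ for all $p$, and a *strict surjection* if it is surjective in each degree and $f(F_pV)=f(V)\cap F_pW$ for all $p$. The tensor product $V\hat\otimes W$ is the degreewise completion of $V\otimes W$ with respect to $F_p(V\otimes W)=\sum_{a+b\ge p}\mathrm{im}(F_aV\otimes F_bW)$, with $d(v\otimes w)=dv\otimes w+(-1)^{|v|}v\otimes dw$; the unit is $\mathbf{R}$ in degree $0$ with $F_1=0$, and the symmetry is $v\otimes w\mapsto(-1)^{|v||w|}w\otimes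 v$. **Generators.** For $n\in\mathbb{Z}$, $q\in\mathbb{N}$ let $\hat{\mathcal{Z}}^{0,\infty}_{q,n}$ (resp. $\hat{\mathcal{Z}}^{1,\infty}_{q,n}$) be the complete gr-dg module with one copy of $\mathbf{R}$ in each degree $n-k$, $k\in\mathbb{N}$, concentrated in weight $q+\lfloor k/2\rfloor$ (resp. $q+\lceil k/2\rceil$) (that is, $F_p$ of this copy is everything for $p$ at most the weight and $0$ otherwise), with $d$ the identity $\mathbf{R}\to\mathbf{R}$ from degree $n-k$ to degree $n-k-1$. Put $\hat{\mathcal{B}}^{1,\infty}_{q,n}=\hat{\mathcal{Z}}^{0,\infty}_{q,n+1}\amalg\hat{\mathcal{Z}}^{0,\infty}_{q+1,n}$, let $\varphi^\infty_{q,n}:\hat{\mathcal{Z}}^{1,\infty}_{q,n}\to\hat{\mathcal{B}}^{1,\infty}_{q,n}$ be given by $r\mapsto(r,r)$ in each degree $\le n$, and set $$I_0^\infty=\{\varphi^\infty_{q,n}\}_{n\in\mathbb{Z},\,q\in\mathbb{N}},\qquad J_0^\infty=\{0\to\hat{\mathcal{Z}}^{0,\infty}_{q,n}\}_{n\in\mathbb{Z},\,q\in\mathbb{N}}.$$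 **Theorem.** The category of complete gr-dg $\mathbf{R}$-modules is complete and cocomplete, and it has a model structure (with functorial factorizations) in which the weak equivalences are the graded quasi-isomorphisms and the fibrations are the strict surjections. This model structure has the following properties. 1. It is cofibrantly generated with $I_0^\infty$ as set of generating cofibrations and $J_0^\infty$ as set of generating trivial cofibrations: the domains of the maps in $I_0^\infty$ (resp. $J_0^\infty$) are small relative to relative $I_0^\infty$-cell (resp. $J_0^\infty$-cell) complexes, the fibrations are the maps with the right lifting property with respect to $J_0^\infty$, and the trivial fibrations are the maps with the right lifting property with respect to $I_0^\infty$. 2. It is left and right proper. 3. It is combinatorial: cofibrantly generated, and the underlying category is locally presentable. 4. With $\hat\otimes$, it is a symmetric monoidal model category: the pushout-product of two cofibrations is a cofibration, which is trivial if one of the two is; and for every cofibrant replacement $\pi:Q\to\mathbb{1}$ of the unit (a trivial fibration with $Q$ cofibrant) and every cofibrant $X$, the maps $\pi\hat\otimes\mathrm{id}_X$ and $\mathrm{id}_X\hat\otimes\pi$ are weak equivalences. -/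

import Mathlib

open CategoryTheory Limits HomotopicalAlgebra MonoidalCategory
open scoped TensorProduct

universe u

noncomputable section

namespace GrDG

section FilteredModules

variable {R : Type u} [CommRing R]
  {M : Type u} [AddCommGroup M] [Module R M] {F : ℕ → Submodule R M}
  {N : Type u} [AddCommGroup N] [Module R N] {G : ℕ → Submodule R N}

/-- The completion `lim_p M / F_p M` of a module with a decreasing filtration. -/
def Compl (hF : Antitone F) : Submodule R (∀ p, M ⧸ F p) where
  carrier := {x | ∀ p q (h : p ≤ q), Submodule.factor (hF h) (x q) = x p}
  add_mem' hx hy p q h := by simp [hx p q h, hy p q h]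
  zero_mem' p q h := by simp
  smul_mem' c x hx p q h := by simp [hx p q h]

/-- The canonical map `M → lim_p M / F_p M`. -/
def toCompl (hF : Antitone F) : M →ₗ[R] Compl hF where
  toFun x := ⟨fun p => (F p).mkQ x, fun p q h => by simp⟩
  map_add' x y := by ext; simp
  map_smul' c x := by ext; simp

/-- The filtration of the completion: the kernels of the projections to `M / F_p M`. -/
def complF (hF : Antitone F) (p : ℕ) : Submodule R (Compl hF) where
  carrier := {x | x.1 p = 0}
  add_mem' hx hy := by
    simp only [Set.mem_ofPred_eq] at hx hy ⊢
    simp [hx, hy]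
  zero_mem' := by simp
  smul_mem' c x hx := by
    simp only [Set.mem_ofPred_eq] at hx ⊢
    simp [hx]

theorem mem_complF {hF : Antitone F} {p : ℕ} {x : Compl hF} :
    x ∈ complF hF p ↔ x.1 p = 0 := Iff.rfl

theorem complF_antitone (hF : Antitone F) : Antitone (complF hF) := by
  intro p q h x hx
  rw [mem_complF] at hx ⊢
  rw [← x.2 p q h, hx, map_zero]

/-- A filtered module is complete if the canonical map `M → lim_p M / F_p M` is bijective. -/
def IsCompleteFilt (hF : Antitone F) : Prop := Function.Bijective (toCompl hF)

theorem toCompl_mem {hF : Antitone F} {p : ℕ} {x : M} :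
    toCompl hF x ∈ complF hF p ↔ x ∈ F p := by
  rw [mem_complF]
  exact (Submodule.Quotient.mk_eq_zero (F p))

theorem IsCompleteFilt.eq_zero {hF : Antitone F} (h : IsCompleteFilt hF) {x : M}
    (hx : ∀ p, x ∈ F p) : x = 0 := by
  apply h.1
  rw [map_zero]
  ext p
  exact (Submodule.Quotient.mk_eq_zero (F p)).2 (hx p)

theorem exists_sub_mem (hF : Antitone F) (x : Compl hF) (p : ℕ) :
    ∃ m, x - toCompl hF m ∈ complF hF p := by
  obtain ⟨m, hm⟩ := (F p).mkQ_surjective (x.1 p)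
  refine ⟨m, ?_⟩
  rw [mem_complF]
  change x.1 p - (F p).mkQ m = 0
  rw [hm, sub_self]

theorem compl_isComplete (hF : Antitone F) : IsCompleteFilt (complF_antitone hF) := by
  constructor
  · rw [injective_iff_map_eq_zero]
    intro x hx
    ext p
    have : toCompl (complF_antitone hF) x ∈ complF (complF_antitone hF) p := by
      rw [hx]; exact zero_mem _
    rw [toCompl_mem] at this
    exact this
  · intro y
    choose z hz using fun p => (complF hF p).mkQ_surjective (y.1 p)
    have key : ∀ p q, p ≤ q → (z q).1 p = (z p).1 p := by
      intro p q h
      have h1 := y.2 p q h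
      rw [← hz p, ← hz q, Submodule.factor_mk, ← sub_eq_zero, ← map_sub] at h1
      have h2 := (Submodule.Quotient.mk_eq_zero _).1 h1
      rw [mem_complF] at h2
      exact sub_eq_zero.1 h2
    refine ⟨⟨fun p => (z p).1 p, fun p q h => ?_⟩, ?_⟩
    · rw [(z q).2 p q h, key p q h]
    · ext p
      rw [← hz p]
      refine (Submodule.Quotient.eq _).2 ?_
      rw [mem_complF]
      exact sub_self _

/-- The map induced on completions by a filtration preserving map. -/
def mapCompl (hF : Antitone F) (hG : Antitone G) (f : M →ₗ[R] N)
    (hf : ∀ p, F p ≤ (G p).comap f) : Compl hF →ₗ[R] Compl hG where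
  toFun x := ⟨fun p => (F p).mapQ (G p) f (hf p) (x.1 p), fun p q h => by
    beta_reduce
    rw [← x.2 p q h]
    obtain ⟨m, hm⟩ := (F q).mkQ_surjective (x.1 q)
    rw [← hm]
    simp⟩
  map_add' x y := by ext; simp
  map_smul' c x := by ext; simp

theorem mapCompl_toCompl (hF : Antitone F) (hG : Antitone G) (f : M →ₗ[R] N)
    (hf : ∀ p, F p ≤ (G p).comap f) (x : M) :
    mapCompl hF hG f hf (toCompl hF x) = toCompl hG (f x) := by
  ext p
  rfl

theorem mapCompl_mem (hF : Antitone F) (hG : Antitone G) (f : M →ₗ[R] N)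
    (hf : ∀ p, F p ≤ (G p).comap f) {x : Compl hF} {p : ℕ} (hx : x ∈ complF hF p) :
    mapCompl hF hG f hf x ∈ complF hG p := by
  rw [mem_complF] at hx ⊢
  change (F p).mapQ (G p) f (hf p) (x.1 p) = 0
  rw [hx, map_zero]

/-- Two filtration preserving maps out of a completion into a complete module agree as soon as
they agree on the image of the uncompleted module. -/
theorem compl_ext {hF : Antitone F} {hG : Antitone G} (hc : IsCompleteFilt hG)
    {f g : Compl hF →ₗ[R] N} (hf : ∀ p x, x ∈ complF hF p → f x ∈ G p)
    (hg : ∀ p x, x ∈ complF hF p → g x ∈ G p)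
    (h : ∀ m, f (toCompl hF m) = g (toCompl hF m)) : f = g := by
  ext x
  rw [← sub_eq_zero]
  refine hc.eq_zero fun p => ?_
  obtain ⟨m, hm⟩ := exists_sub_mem hF x p
  have h1 := sub_mem (hf p _ hm) (hg p _ hm)
  simpa [map_sub, h] using h1

/-- Extension to the completion of a filtration preserving map into a complete module. -/
def complDesc (hF : Antitone F) {hG : Antitone G} (hc : IsCompleteFilt hG) (f : M →ₗ[R] N)
    (hf : ∀ p, F p ≤ (G p).comap f) : Compl hF →ₗ[R] N :=
  (LinearEquiv.ofBijective (toCompl hG) hc).symm.toLinearMap ∘ₗ mapCompl hF hG f hf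

theorem complDesc_toCompl (hF : Antitone F) {hG : Antitone G} (hc : IsCompleteFilt hG)
    (f : M →ₗ[R] N) (hf : ∀ p, F p ≤ (G p).comap f) (x : M) :
    complDesc hF hc f hf (toCompl hF x) = f x := by
  change (LinearEquiv.ofBijective (toCompl hG) hc).symm (mapCompl hF hG f hf (toCompl hF x)) = _
  rw [mapCompl_toCompl, LinearEquiv.symm_apply_eq]
  rfl

theorem complDesc_mem (hF : Antitone F) {hG : Antitone G} (hc : IsCompleteFilt hG)
    (f : M →ₗ[R] N) (hf : ∀ p, F p ≤ (G p).comap f) {x : Compl hF} {p : ℕ}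
    (hx : x ∈ complF hF p) : complDesc hF hc f hf x ∈ G p := by
  rw [← toCompl_mem (hF := hG)]
  have : toCompl hG (complDesc hF hc f hf x) = mapCompl hF hG f hf x :=
    (LinearEquiv.ofBijective (toCompl hG) hc).apply_symm_apply _
  rw [this]
  exact mapCompl_mem hF hG f hf hx

theorem isCompleteFilt_of_eq_bot {hF : Antitone F} (q : ℕ) (h : F q = ⊥) : IsCompleteFilt hF := by
  constructor
  · rw [injective_iff_map_eq_zero]
    intro x hx
    have : toCompl hF x ∈ complF hF q := by rw [hx]; exact zero_mem _
    rwa [toCompl_mem, h, Submodule.mem_bot] at this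
  · intro y
    obtain ⟨m, hm⟩ := exists_sub_mem hF y q
    refine ⟨m, ?_⟩
    rw [eq_comm, ← sub_eq_zero]
    generalize y - toCompl hF m = z at hm
    rw [mem_complF] at hm
    ext p
    rcases le_total p q with hpq | hpq
    · rw [← z.2 p q hpq, hm, map_zero]
      rfl
    · have h1 := z.2 q p hpq
      obtain ⟨x, hx⟩ := (F p).mkQ_surjective (z.1 p)
      rw [hm, ← hx, Submodule.factor_mk] at h1
      have h2 : x ∈ F q := (Submodule.Quotient.mk_eq_zero _).1 h1
      rw [h, Submodule.mem_bot] at h2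
      rw [← hx, h2, map_zero]
      rfl

theorem prod_antitone (hF : Antitone F) (hG : Antitone G) :
    Antitone (fun p => (F p).prod (G p)) := fun _ _ h => Submodule.prod_mono (hF h) (hG h)

theorem isCompleteFilt_prod {hF : Antitone F} {hG : Antitone G} (h₁ : IsCompleteFilt hF)
    (h₂ : IsCompleteFilt hG) : IsCompleteFilt (prod_antitone hF hG) := by
  constructor
  · rw [injective_iff_map_eq_zero]
    intro x hx
    have key : ∀ p, x ∈ (F p).prod (G p) := fun p => by
      rw [← toCompl_mem (hF := prod_antitone hF hG) (p := p), hx]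
      exact zero_mem _
    exact Prod.ext (h₁.eq_zero fun p => (key p).1) (h₂.eq_zero fun p => (key p).2)
  · intro y
    obtain ⟨m₁, hm₁⟩ := h₁.2 (mapCompl (prod_antitone hF hG) hF (LinearMap.fst R M N)
      (fun p x hx => hx.1) y)
    obtain ⟨m₂, hm₂⟩ := h₂.2 (mapCompl (prod_antitone hF hG) hG (LinearMap.snd R M N)
      (fun p x hx => hx.2) y)
    refine ⟨(m₁, m₂), ?_⟩
    ext p
    obtain ⟨⟨a, b⟩, hab⟩ := Submodule.mkQ_surjective _ (y.1 p)
    have e₁ : (F p).mkQ m₁ = ((F p).prod (G p)).mapQ (F p) (LinearMap.fst R M N)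
      (fun x hx => hx.1) (y.1 p) := congrFun (congrArg Subtype.val hm₁) p
    have e₂ : (G p).mkQ m₂ = ((F p).prod (G p)).mapQ (G p) (LinearMap.snd R M N)
      (fun x hx => hx.2) (y.1 p) := congrFun (congrArg Subtype.val hm₂) p
    rw [← hab] at e₁ e₂ ⊢
    exact (Submodule.Quotient.eq _).2
      ⟨(Submodule.Quotient.eq _).1 e₁, (Submodule.Quotient.eq _).1 e₂⟩

end FilteredModules

/-- A filtered gr-dg `R`-module: a `ℤ`-graded module with a decreasing `ℕ`-indexed filtration
starting at the whole module, and a filtration preserving predifferential of degree `-1`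
(`d i j` is the component from degree `i` to degree `j`, which vanishes unless `j + 1 = i`),
whose square raises the filtration by one. -/
structure FiltGrDGMod (R : Type u) [CommRing R] where
  X : ℤ → Type u
  [grp : ∀ i, AddCommGroup (X i)]
  [mod : ∀ i, Module R (X i)]
  F : ∀ i, ℕ → Submodule R (X i)
  F_zero : ∀ i, F i 0 = ⊤
  F_anti : ∀ i, Antitone (F i)
  d : ∀ i j, X i →ₗ[R] X j
  d_shape : ∀ i j, j + 1 ≠ i → d i j = 0
  d_F : ∀ i j p x, x ∈ F i p → d i j x ∈ F j p
  d_d : ∀ i j k p x, x ∈ F i p → d j k (d i j x) ∈ F k (p + 1)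

attribute [instance] FiltGrDGMod.grp FiltGrDGMod.mod

namespace FiltGrDGMod

variable {R : Type u} [CommRing R]

/-- Morphisms preserve the degree and the filtration and commute with the predifferentials. -/
@[ext]
structure Hom (V W : FiltGrDGMod R) where
  f : ∀ i, V.X i →ₗ[R] W.X i
  f_F : ∀ i p x, x ∈ V.F i p → f i x ∈ W.F i p
  f_d : ∀ i j x, f j (V.d i j x) = W.d i j (f i x)

instance : Category (FiltGrDGMod R) where
  Hom := Hom
  id V := ⟨fun _ => LinearMap.id, fun _ _ _ h => h, fun _ _ _ => rfl⟩
  comp f g := ⟨fun i => g.f i ∘ₗ f.f i, fun i p x h => g.f_F i p _ (f.f_F i p x h),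
    fun i j x => by simp [f.f_d, g.f_d]⟩

@[simp] theorem id_f (V : FiltGrDGMod R) (i : ℤ) (x : V.X i) : Hom.f (𝟙 V) i x = x := rfl

@[simp] theorem comp_f {V W U : FiltGrDGMod R} (f : V ⟶ W) (g : W ⟶ U) (i : ℤ) (x : V.X i) :
    Hom.f (f ≫ g) i x = Hom.f g i (Hom.f f i x) := rfl

/-- The weight `p` part of the associated graded complex: `F_p V / F_{p+1} V` with the
differential induced by the predifferential. -/
def grObj (p : ℕ) (V : FiltGrDGMod R) : ChainComplex (ModuleCat.{u} R) ℤ where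
  X i := ModuleCat.of R (V.F i p ⧸ (V.F i (p + 1)).submoduleOf (V.F i p))
  d i j := ModuleCat.ofHom (Submodule.mapQ _ _ ((V.d i j).restrict (V.d_F i j p))
    (fun x hx => V.d_F i j (p + 1) _ hx))
  shape i j h := by
    ext x
    refine (Submodule.Quotient.mk_eq_zero _).2 ?_
    change V.d i j x.1 ∈ V.F j (p + 1)
    rw [V.d_shape i j h]
    exact zero_mem _
  d_comp_d' i j k _ _ := by
    ext x
    exact (Submodule.Quotient.mk_eq_zero _).2 (V.d_d i j k p x.1 x.2)

/-- The functor sending a filtered gr-dg module to the weight `p` part of its associated graded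
complex. -/
def gr (p : ℕ) : FiltGrDGMod R ⥤ ChainComplex (ModuleCat.{u} R) ℤ where
  obj V := grObj p V
  map {V W} f :=
    { f := fun i => ModuleCat.ofHom (Submodule.mapQ _ _
        (LinearMap.restrict (Hom.f f i) (Hom.f_F f i p)) (fun x hx => Hom.f_F f i (p + 1) _ hx))
      comm' := fun i j _ => by
        ext x
        obtain ⟨x, rfl⟩ := Submodule.mkQ_surjective _ x
        refine congrArg (Submodule.mkQ _) (Subtype.ext ?_)
        exact (Hom.f_d f i j x.1).symm }
  map_id V := by
    ext i x
    obtain ⟨x, rfl⟩ := Submodule.mkQ_surjective _ x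
    rfl
  map_comp f g := by
    ext i x
    obtain ⟨x, rfl⟩ := Submodule.mkQ_surjective _ x
    rfl

/-- A filtered gr-dg module `V` is complete if `V → lim_p V / F_p V` is an isomorphism, which is
a degreewise condition. -/
def IsComplete : ObjectProperty (FiltGrDGMod R) := fun V => ∀ i, IsCompleteFilt (V.F_anti i)

/-- Degreewise completion of a filtered gr-dg module. -/
def completion (V : FiltGrDGMod R) : FiltGrDGMod R where
  X i := Compl (V.F_anti i)
  F i := complF (V.F_anti i)
  F_zero i := by
    refine Submodule.eq_top_iff'.2 fun x => ?_
    rw [mem_complF]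
    obtain ⟨m, hm⟩ := Submodule.mkQ_surjective _ (x.1 0)
    rw [← hm]
    refine (Submodule.Quotient.mk_eq_zero _).2 ?_
    rw [V.F_zero]
    trivial
  F_anti i := complF_antitone _
  d i j := mapCompl (V.F_anti i) (V.F_anti j) (V.d i j) (fun p x hx => V.d_F i j p x hx)
  d_shape i j h := by
    refine LinearMap.ext fun x => Subtype.ext (funext fun p => ?_)
    obtain ⟨m, hm⟩ := Submodule.mkQ_surjective _ (x.1 p)
    change (V.F i p).mapQ (V.F j p) (V.d i j) _ (x.1 p) = 0
    rw [← hm]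
    refine (Submodule.Quotient.mk_eq_zero _).2 ?_
    rw [V.d_shape i j h]
    exact zero_mem _
  d_F i j p x hx := mapCompl_mem _ _ _ _ hx
  d_d i j k p x hx := by
    obtain ⟨m, hm⟩ := exists_sub_mem (V.F_anti i) x (p + 1)
    have hmp : m ∈ V.F i p := by
      rw [← toCompl_mem (hF := V.F_anti i)]
      have := sub_mem hx (complF_antitone (V.F_anti i) (Nat.le_succ p) hm)
      simpa using this
    have h1 := mapCompl_mem (V.F_anti j) (V.F_anti k) (V.d j k) (fun p x hx => V.d_F j k p x hx)
      (mapCompl_mem (V.F_anti i) (V.F_anti j) (V.d i j) (fun p x hx => V.d_F i j p x hx) hm)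
    have h2 := V.d_d i j k p m hmp
    rw [← toCompl_mem (hF := V.F_anti k)] at h2
    rw [map_sub, map_sub, mapCompl_toCompl, mapCompl_toCompl] at h1
    have := add_mem h1 h2
    simpa using this

theorem completion_isComplete (V : FiltGrDGMod R) : IsComplete V.completion :=
  fun i => compl_isComplete (V.F_anti i)

end FiltGrDGMod

/-- The category of complete gr-dg `R`-modules: the full subcategory of complete objects. -/
abbrev CompleteGrDGMod (R : Type u) [CommRing R] : Type (u + 1) :=
  (FiltGrDGMod.IsComplete (R := R)).FullSubcategory

namespace FiltGrDGMod

variable {R : Type u} [CommRing R]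

/-- The sign `(-1)^i` as an element of `R`. -/
def sgn (R : Type u) [CommRing R] (i : ℤ) : R := ((i.negOnePow : ℤ) : R)

theorem sgn_add (i j : ℤ) : sgn R (i + j) = sgn R i * sgn R j := by
  simp [sgn, Int.negOnePow_add]

theorem sgn_succ (i : ℤ) : sgn R (i + 1) = -sgn R i := by
  simp [sgn, Int.negOnePow_succ]

theorem sgn_zero : sgn R 0 = 1 := by simp [sgn]

theorem sgn_mul_self (i : ℤ) : sgn R i * sgn R i = 1 := by
  rw [← sgn_add, sgn, Int.negOnePow_even _ (Even.add_self i)]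
  simp

variable (V W : FiltGrDGMod R)

/-- The degree `n` part of the tensor product of graded modules. -/
abbrev TensorDeg (n : ℤ) : Type u :=
  DirectSum {p : ℤ × ℤ // p.1 + p.2 = n} (fun p => V.X p.1.1 ⊗[R] W.X p.1.2)

/-- The pure tensors `v ⊗ w`. -/
def tmul₀ (i j n : ℤ) (h : i + j = n) : V.X i →ₗ[R] W.X j →ₗ[R] TensorDeg V W n :=
  (TensorProduct.mk R (V.X i) (W.X j)).compr₂
    (DirectSum.lof R {p : ℤ × ℤ // p.1 + p.2 = n} (fun p => V.X p.1.1 ⊗[R] W.X p.1.2) ⟨(i, j), h⟩)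

variable {V W}

/-- The linear map out of the tensor product given by a family of bilinear maps. -/
def lift₀ {n : ℤ} {N : Type u} [AddCommGroup N] [Module R N]
    (b : ∀ i j, i + j = n → V.X i →ₗ[R] W.X j →ₗ[R] N) : TensorDeg V W n →ₗ[R] N :=
  DirectSum.toModule R _ _ (fun p => TensorProduct.lift (b p.1.1 p.1.2 p.2))

theorem lift₀_tmul₀ {n : ℤ} {N : Type u} [AddCommGroup N] [Module R N]
    (b : ∀ i j, i + j = n → V.X i →ₗ[R] W.X j →ₗ[R] N) (i j : ℤ) (h : i + j = n)
    (v : V.X i) (w : W.X j) : lift₀ b (tmul₀ V W i j n h v w) = b i j h v w := by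
  simp [lift₀, tmul₀]

theorem ext₀ {n : ℤ} {N : Type u} [AddCommGroup N] [Module R N] {f g : TensorDeg V W n →ₗ[R] N}
    (h : ∀ i j h v w, f (tmul₀ V W i j n h v w) = g (tmul₀ V W i j n h v w)) : f = g := by
  refine DirectSum.linearMap_ext R fun p => TensorProduct.ext' fun v w => ?_
  exact h p.1.1 p.1.2 p.2 v w

variable (V W)

/-- The filtration of the tensor product: `F_p` is the sum of the images of `F_a V ⊗ F_b W` for
`a + b ≥ p`. -/
def tensorF (n : ℤ) (p : ℕ) : Submodule R (TensorDeg V W n) :=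
  Submodule.span R {x | ∃ (i j : ℤ) (h : i + j = n) (a b : ℕ) (v : V.X i) (w : W.X j),
    p ≤ a + b ∧ v ∈ V.F i a ∧ w ∈ W.F j b ∧ x = tmul₀ V W i j n h v w}

/-- The predifferential of the tensor product, `d (v ⊗ w) = d v ⊗ w + (-1)^|v| v ⊗ d w`. -/
def tensorD (n m : ℤ) : TensorDeg V W n →ₗ[R] TensorDeg V W m :=
  if hm : m + 1 = n then
    lift₀ (fun i j h =>
      (tmul₀ V W (i - 1) j m (by omega)).comp (V.d i (i - 1)) +
      sgn R i • (tmul₀ V W i (j - 1) m (by omega)).compl₂ (W.d j (j - 1)))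
  else 0

variable {V W}

theorem tmul₀_mem {i j n : ℤ} (h : i + j = n) {a b p : ℕ} {v : V.X i} {w : W.X j}
    (hp : p ≤ a + b) (hv : v ∈ V.F i a) (hw : w ∈ W.F j b) :
    tmul₀ V W i j n h v w ∈ tensorF V W n p :=
  Submodule.subset_span ⟨i, j, h, a, b, v, w, hp, hv, hw, rfl⟩

theorem mem_F_zero (V : FiltGrDGMod R) {i : ℤ} (v : V.X i) : v ∈ V.F i 0 := by
  rw [V.F_zero]; trivial

theorem tensorD_tmul₀ {i j n i' j' m : ℤ} (h : i + j = n) (hi : i' + 1 = i) (hj : j' + 1 = j)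
    (hm : m + 1 = n) (v : V.X i) (w : W.X j) :
    tensorD V W n m (tmul₀ V W i j n h v w) =
      tmul₀ V W i' j m (by omega) (V.d i i' v) w +
        sgn R i • tmul₀ V W i j' m (by omega) v (W.d j j' w) := by
  obtain rfl : i' = i - 1 := by omega
  obtain rfl : j' = j - 1 := by omega
  rw [tensorD, dif_pos hm, lift₀_tmul₀]
  rfl

theorem tensorF_le {n : ℤ} {p : ℕ} {N : Type u} [AddCommGroup N] [Module R N]
    {f : TensorDeg V W n →ₗ[R] N} {S : Submodule R N}
    (h : ∀ i j h (a b : ℕ) v w, p ≤ a + b → v ∈ V.F i a → w ∈ W.F j b →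
      f (tmul₀ V W i j n h v w) ∈ S) : tensorF V W n p ≤ S.comap f := by
  refine Submodule.span_le.2 ?_
  rintro _ ⟨i, j, h', a, b, v, w, hp, hv, hw, rfl⟩
  exact h i j h' a b v w hp hv hw

variable (V W)

/-- The tensor product of filtered gr-dg modules. -/
def tensor : FiltGrDGMod R where
  X n := TensorDeg V W n
  F n p := tensorF V W n p
  F_zero n := by
    refine Submodule.eq_top_iff'.2 fun x => ?_
    rw [← Submodule.Quotient.mk_eq_zero]
    have : (tensorF V W n 0).mkQ = 0 := ext₀ fun i j h v w =>
      (Submodule.Quotient.mk_eq_zero _).2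
        (tmul₀_mem h (Nat.zero_le (0 + 0)) (V.mem_F_zero v) (W.mem_F_zero w))
    exact LinearMap.congr_fun this x
  F_anti n p q hpq := by
    refine Submodule.span_mono ?_
    rintro _ ⟨i, j, h', a, b, v, w, hp, hv, hw, rfl⟩
    exact ⟨i, j, h', a, b, v, w, hpq.trans hp, hv, hw, rfl⟩
  d n m := tensorD V W n m
  d_shape n m h := by rw [tensorD, dif_neg h]
  d_F n m p x hx := by
    by_cases hm : m + 1 = n
    · refine (tensorF_le (S := tensorF V W m p) fun i j h a b v w hp hv hw => ?_) hx
      rw [tensorD_tmul₀ h (sub_add_cancel i 1) (sub_add_cancel j 1) hm]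
      exact add_mem (tmul₀_mem _ hp (V.d_F _ _ _ _ hv) hw)
        (Submodule.smul_mem _ _ (tmul₀_mem _ hp hv (W.d_F _ _ _ _ hw)))
    · rw [tensorD, dif_neg hm]
      exact zero_mem _
  d_d n m k p x hx := by
    by_cases hm : m + 1 = n
    · by_cases hk : k + 1 = m
      · refine (tensorF_le (f := tensorD V W m k ∘ₗ tensorD V W n m)
          (S := tensorF V W k (p + 1)) fun i j h a b v w hp hv hw => ?_) hx
        obtain ⟨i', rfl⟩ : ∃ i', i' + 1 + 1 = i := ⟨i - 2, by ring⟩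
        obtain ⟨j', rfl⟩ : ∃ j', j' + 1 + 1 = j := ⟨j - 2, by ring⟩
        rw [LinearMap.comp_apply, tensorD_tmul₀ h rfl rfl hm, map_add, map_smul,
          tensorD_tmul₀ _ rfl rfl hk, tensorD_tmul₀ _ rfl rfl hk, sgn_succ (i' + 1)]
        have h1 := tmul₀_mem (V := V) (W := W) (p := p + 1) (n := k) (i := i') (j := j' + 1 + 1)
          (by omega) (by omega) (V.d_d _ (i' + 1) i' _ _ hv) hw
        have h2 := tmul₀_mem (V := V) (W := W) (p := p + 1) (n := k) (i := i' + 1 + 1) (j := j')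
          (by omega) (by omega) hv (W.d_d _ (j' + 1) j' _ _ hw)
        have h3 := add_mem h1 (Submodule.smul_mem _ (sgn R (i' + 1) * sgn R (i' + 1)) h2)
        convert h3 using 1
        module
      · rw [tensorD, dif_neg hk]
        exact zero_mem _
    · rw [tensorD, tensorD, dif_neg hm]
      simp

/-- The completed tensor product of filtered gr-dg modules. -/
def ctensor : FiltGrDGMod R := (tensor V W).completion

/-- The canonical map from the tensor product to its completion. -/
def eta (n : ℤ) : TensorDeg V W n →ₗ[R] (ctensor V W).X n := toCompl ((tensor V W).F_anti n)

/-- The pure tensors in the completed tensor product. -/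
def tmul (i j n : ℤ) (h : i + j = n) : V.X i →ₗ[R] W.X j →ₗ[R] (ctensor V W).X n :=
  (tmul₀ V W i j n h).compr₂ (eta V W n)

variable {V W}

theorem tmul_mem {i j n : ℤ} (h : i + j = n) {a b p : ℕ} {v : V.X i} {w : W.X j}
    (hp : p ≤ a + b) (hv : v ∈ V.F i a) (hw : w ∈ W.F j b) :
    tmul V W i j n h v w ∈ (ctensor V W).F n p :=
  (toCompl_mem (hF := (tensor V W).F_anti n)).2 (tmul₀_mem h hp hv hw)

theorem d_tmul {i j n i' j' m : ℤ} (h : i + j = n) (hi : i' + 1 = i) (hj : j' + 1 = j)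
    (hm : m + 1 = n) (v : V.X i) (w : W.X j) :
    (ctensor V W).d n m (tmul V W i j n h v w) =
      tmul V W i' j m (by omega) (V.d i i' v) w +
        sgn R i • tmul V W i j' m (by omega) v (W.d j j' w) := by
  have h1 := mapCompl_toCompl ((tensor V W).F_anti n) ((tensor V W).F_anti m)
    ((tensor V W).d n m) (fun p x hx => (tensor V W).d_F n m p x hx) (tmul₀ V W i j n h v w)
  have h2 : (tensor V W).d n m (tmul₀ V W i j n h v w) = _ := tensorD_tmul₀ h hi hj hm v w
  rw [h2] at h1
  refine h1.trans ?_
  have h3 := (toCompl ((tensor V W).F_anti m)).map_add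
    (tmul₀ V W i' j m (by omega) (V.d i i' v) w)
    (sgn R i • tmul₀ V W i j' m (by omega) v (W.d j j' w))
  refine h3.trans ?_
  exact congrArg _ ((toCompl ((tensor V W).F_anti m)).map_smul _ _)

section

variable {n : ℤ} {N : Type u} [AddCommGroup N] [Module R N] {G : ℕ → Submodule R N}
  {hG : Antitone G}

theorem ctensor_ext (hc : IsCompleteFilt hG) {f g : (ctensor V W).X n →ₗ[R] N}
    (hf : ∀ p x, x ∈ (ctensor V W).F n p → f x ∈ G p)
    (hg : ∀ p x, x ∈ (ctensor V W).F n p → g x ∈ G p)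
    (h : ∀ i j h v w, f (tmul V W i j n h v w) = g (tmul V W i j n h v w)) : f = g := by
  refine compl_ext (hF := (tensor V W).F_anti n) hc hf hg fun m => ?_
  have : f.comp (toCompl ((tensor V W).F_anti n)) = g.comp (toCompl ((tensor V W).F_anti n)) :=
    ext₀ h
  exact LinearMap.congr_fun this m

/-- Linear maps out of the completed tensor product, from filtered families of bilinear maps into
a complete filtered module. -/
def ctensorLift (hc : IsCompleteFilt hG) (b : ∀ i j, i + j = n → V.X i →ₗ[R] W.X j →ₗ[R] N)
    (hb : ∀ i j h (p q : ℕ) v w, v ∈ V.F i p → w ∈ W.F j q → b i j h v w ∈ G (p + q)) :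
    (ctensor V W).X n →ₗ[R] N :=
  complDesc ((tensor V W).F_anti n) hc (lift₀ b) (fun p => tensorF_le
    (fun i j h a c v w hp hv hw => by
      rw [lift₀_tmul₀]; exact hG hp (hb i j h a c v w hv hw)))

theorem ctensorLift_tmul (hc : IsCompleteFilt hG)
    (b : ∀ i j, i + j = n → V.X i →ₗ[R] W.X j →ₗ[R] N)
    (hb : ∀ i j h (p q : ℕ) v w, v ∈ V.F i p → w ∈ W.F j q → b i j h v w ∈ G (p + q))
    (i j : ℤ) (h : i + j = n) (v : V.X i) (w : W.X j) :
    ctensorLift hc b hb (tmul V W i j n h v w) = b i j h v w :=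
  (complDesc_toCompl _ _ _ _ _).trans (lift₀_tmul₀ b i j h v w)

theorem ctensorLift_mem (hc : IsCompleteFilt hG)
    (b : ∀ i j, i + j = n → V.X i →ₗ[R] W.X j →ₗ[R] N)
    (hb : ∀ i j h (p q : ℕ) v w, v ∈ V.F i p → w ∈ W.F j q → b i j h v w ∈ G (p + q))
    {p : ℕ} {x : (ctensor V W).X n} (hx : x ∈ (ctensor V W).F n p) :
    ctensorLift hc b hb x ∈ G p :=
  complDesc_mem _ _ _ _ hx

theorem ctensor_shift {f : (ctensor V W).X n →ₗ[R] N} {c : ℕ} (hG : Antitone G)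
    (hf : ∀ p x, x ∈ (ctensor V W).F n p → f x ∈ G p)
    (h : ∀ i j h (p q : ℕ) v w, v ∈ V.F i p → w ∈ W.F j q →
      f (tmul V W i j n h v w) ∈ G (p + q + c))
    {p : ℕ} {x : (ctensor V W).X n} (hx : x ∈ (ctensor V W).F n p) : f x ∈ G (p + c) := by
  obtain ⟨m, hm⟩ : ∃ m, x - eta V W n m ∈ (ctensor V W).F n (p + c) :=
    exists_sub_mem ((tensor V W).F_anti n) x (p + c)
  have hmp : m ∈ tensorF V W n p := by
    refine (toCompl_mem (hF := (tensor V W).F_anti n)).1 ?_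
    have h0 := sub_mem hx ((ctensor V W).F_anti n (Nat.le_add_right p c) hm)
    rw [sub_sub_cancel] at h0
    exact h0
  have h1 : f (eta V W n m) ∈ G (p + c) := by
    refine (tensorF_le (f := f ∘ₗ eta V W n) (S := G (p + c)) ?_) hmp
    intro i j h' a b v w hp hv hw
    exact hG (by omega) (h i j h' a b v w hv hw)
  have h2 := add_mem (hf _ _ hm) h1
  rw [← map_add, sub_add_cancel] at h2
  exact h2

end

end FiltGrDGMod

open FiltGrDGMod

namespace CompleteGrDGMod

variable {R : Type u} [CommRing R]

/-- The underlying linear maps of a morphism. -/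
abbrev hf {V W : CompleteGrDGMod R} (f : V ⟶ W) (i : ℤ) : V.obj.X i →ₗ[R] W.obj.X i := f.hom.f i

theorem hom_ext' {V W : CompleteGrDGMod R} {f g : V ⟶ W} (h : ∀ i x, hf f i x = hf g i x) :
    f = g :=
  ObjectProperty.hom_ext _ (Hom.ext (funext fun i => LinearMap.ext (h i)))

@[simp] theorem hf_id (V : CompleteGrDGMod R) (i : ℤ) (x : V.obj.X i) : hf (𝟙 V) i x = x := rfl

@[simp] theorem hf_comp {V W U : CompleteGrDGMod R} (f : V ⟶ W) (g : W ⟶ U) (i : ℤ)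
    (x : V.obj.X i) : hf (f ≫ g) i x = hf g i (hf f i x) := rfl

/-- The completed tensor product of complete gr-dg modules. -/
def tensorObj' (V W : CompleteGrDGMod R) : CompleteGrDGMod R :=
  ⟨ctensor V.obj W.obj, completion_isComplete _⟩

/-- The pure tensors `v ⊗ w` in the completed tensor product. -/
def tm (V W : CompleteGrDGMod R) (i j n : ℤ) (h : i + j = n) :
    V.obj.X i →ₗ[R] W.obj.X j →ₗ[R] (tensorObj' V W).obj.X n :=
  tmul V.obj W.obj i j n h

variable {V W T U : CompleteGrDGMod R}

theorem tm_mem {i j n : ℤ} (h : i + j = n) {a b p : ℕ} {v : V.obj.X i} {w : W.obj.X j}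
    (hp : p ≤ a + b) (hv : v ∈ V.obj.F i a) (hw : w ∈ W.obj.F j b) :
    tm V W i j n h v w ∈ (tensorObj' V W).obj.F n p := tmul_mem h hp hv hw

theorem d_tm {i j n i' j' m : ℤ} (h : i + j = n) (hi : i' + 1 = i) (hj : j' + 1 = j)
    (hm : m + 1 = n) (v : V.obj.X i) (w : W.obj.X j) :
    (tensorObj' V W).obj.d n m (tm V W i j n h v w) =
      tm V W i' j m (by omega) (V.obj.d i i' v) w +
        sgn R i • tm V W i j' m (by omega) v (W.obj.d j j' w) := d_tmul h hi hj hm v w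

theorem lin_ext {n k : ℤ} {f g : (tensorObj' V W).obj.X n →ₗ[R] T.obj.X k}
    (hf : ∀ p x, x ∈ (tensorObj' V W).obj.F n p → f x ∈ T.obj.F k p)
    (hg : ∀ p x, x ∈ (tensorObj' V W).obj.F n p → g x ∈ T.obj.F k p)
    (h : ∀ i j h v w, f (tm V W i j n h v w) = g (tm V W i j n h v w)) : f = g :=
  ctensor_ext (T.property k) hf hg h

theorem tensor_ext {f g : tensorObj' V W ⟶ T}
    (h : ∀ i j n h v w, hf f n (tm V W i j n h v w) = hf g n (tm V W i j n h v w)) : f = g :=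
  hom_ext' fun n => LinearMap.congr_fun (lin_ext (f.hom.f_F n) (g.hom.f_F n)
    fun i j h' v w => h i j n h' v w)

/-- Linear maps out of the completed tensor product, from filtered families of bilinear maps. -/
def linDesc {n k : ℤ} (b : ∀ i j, i + j = n → V.obj.X i →ₗ[R] W.obj.X j →ₗ[R] T.obj.X k)
    (hb : ∀ i j h (p q : ℕ) v w, v ∈ V.obj.F i p → w ∈ W.obj.F j q →
      b i j h v w ∈ T.obj.F k (p + q)) : (tensorObj' V W).obj.X n →ₗ[R] T.obj.X k :=
  ctensorLift (T.property k) b hb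

theorem linDesc_tm {n k : ℤ} (b : ∀ i j, i + j = n → V.obj.X i →ₗ[R] W.obj.X j →ₗ[R] T.obj.X k)
    (hb : ∀ i j h (p q : ℕ) v w, v ∈ V.obj.F i p → w ∈ W.obj.F j q →
      b i j h v w ∈ T.obj.F k (p + q)) (i j : ℤ) (h : i + j = n) (v : V.obj.X i) (w : W.obj.X j) :
    linDesc b hb (tm V W i j n h v w) = b i j h v w :=
  ctensorLift_tmul (T.property k) b hb i j h v w

theorem linDesc_mem {n k : ℤ} (b : ∀ i j, i + j = n → V.obj.X i →ₗ[R] W.obj.X j →ₗ[R] T.obj.X k)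
    (hb : ∀ i j h (p q : ℕ) v w, v ∈ V.obj.F i p → w ∈ W.obj.F j q →
      b i j h v w ∈ T.obj.F k (p + q)) (p : ℕ) (x : (tensorObj' V W).obj.X n)
    (hx : x ∈ (tensorObj' V W).obj.F n p) : linDesc b hb x ∈ T.obj.F k p :=
  ctensorLift_mem (T.property k) b hb hx

/-- A filtered bilinear family compatible with the predifferentials. -/
structure Bilin (V W T : CompleteGrDGMod R) where
  b : ∀ i j n, i + j = n → V.obj.X i →ₗ[R] W.obj.X j →ₗ[R] T.obj.X n
  b_F : ∀ i j n h (p q : ℕ) v w, v ∈ V.obj.F i p → w ∈ W.obj.F j q →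
    b i j n h v w ∈ T.obj.F n (p + q)
  b_d : ∀ i j n i' j' m (h : i + j = n) (_ : i' + 1 = i) (_ : j' + 1 = j) (_ : m + 1 = n) v w,
    T.obj.d n m (b i j n h v w) = b i' j m (by omega) (V.obj.d i i' v) w +
      sgn R i • b i j' m (by omega) v (W.obj.d j j' w)

/-- The morphism out of the completed tensor product induced by a compatible bilinear family. -/
def desc (B : Bilin V W T) : tensorObj' V W ⟶ T := ObjectProperty.homMk
  { f := fun n => linDesc (fun i j h => B.b i j n h) (fun i j h => B.b_F i j n h)
    f_F := fun n => linDesc_mem _ _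
    f_d := fun n m x => by
      by_cases hm : m + 1 = n
      · refine LinearMap.congr_fun (lin_ext (V := V) (W := W) (T := T)
          (f := (linDesc (fun i j h => B.b i j m h) (fun i j h => B.b_F i j m h)) ∘ₗ
            (tensorObj' V W).obj.d n m)
          (g := T.obj.d n m ∘ₗ (linDesc (fun i j h => B.b i j n h)
            (fun i j h => B.b_F i j n h))) ?_ ?_ ?_) x
        · exact fun p x hx => linDesc_mem _ (fun i j h => B.b_F i j m h) _ _
            ((tensorObj' V W).obj.d_F _ _ _ _ hx)
        · exact fun p x hx => T.obj.d_F _ _ _ _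
            (linDesc_mem _ (fun i j h => B.b_F i j n h) _ _ hx)
        · intro i j h v w
          rw [LinearMap.comp_apply, LinearMap.comp_apply,
            d_tm h (sub_add_cancel i 1) (sub_add_cancel j 1) hm, map_add, map_smul,
            linDesc_tm, linDesc_tm, linDesc_tm]
          exact (B.b_d _ _ _ _ _ _ _ (sub_add_cancel i 1) (sub_add_cancel j 1) hm v w).symm
      · rw [FiltGrDGMod.d_shape _ _ _ hm, FiltGrDGMod.d_shape _ _ _ hm, LinearMap.zero_apply,
          LinearMap.zero_apply, map_zero] }

@[simp] theorem desc_tm (B : Bilin V W T) (i j n : ℤ) (h : i + j = n) (v : V.obj.X i)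
    (w : W.obj.X j) : hf (desc B) n (tm V W i j n h v w) = B.b i j n h v w :=
  linDesc_tm (fun i j h => B.b i j n h) (fun i j h => B.b_F i j n h) i j h v w

theorem lin_ext3 {n k : ℤ} {f g : (tensorObj' (tensorObj' V W) U).obj.X n →ₗ[R] T.obj.X k}
    (hf : ∀ p x, x ∈ (tensorObj' (tensorObj' V W) U).obj.F n p → f x ∈ T.obj.F k p)
    (hg : ∀ p x, x ∈ (tensorObj' (tensorObj' V W) U).obj.F n p → g x ∈ T.obj.F k p)
    (h : ∀ a i j l (h : a + l = n) (h' : i + j = a) v w u,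
      f (tm (tensorObj' V W) U a l n h (tm V W i j a h' v w) u) =
        g (tm (tensorObj' V W) U a l n h (tm V W i j a h' v w) u)) : f = g := by
  refine lin_ext hf hg fun a l hal x u => ?_
  have key : f ∘ₗ (tm (tensorObj' V W) U a l n hal).flip u =
      g ∘ₗ (tm (tensorObj' V W) U a l n hal).flip u := by
    refine lin_ext (fun p x hx => hf p _ ?_) (fun p x hx => hg p _ ?_)
      (fun i j h' v w => h a i j l hal h' v w u)
    · exact tm_mem hal (Nat.le_add_right p 0) hx (mem_F_zero _ u)
    · exact tm_mem hal (Nat.le_add_right p 0) hx (mem_F_zero _ u)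
  exact LinearMap.congr_fun key x

theorem tensor_ext3 {f g : tensorObj' (tensorObj' V W) U ⟶ T}
    (h : ∀ a i j l n (h : a + l = n) (h' : i + j = a) v w u,
      hf f n (tm (tensorObj' V W) U a l n h (tm V W i j a h' v w) u) =
        hf g n (tm (tensorObj' V W) U a l n h (tm V W i j a h' v w) u)) : f = g :=
  hom_ext' fun n => LinearMap.congr_fun (lin_ext3 (f.hom.f_F n) (g.hom.f_F n)
    fun a i j l h1 h2 v w u => h a i j l n h1 h2 v w u)

theorem tensor_ext3' {f g : tensorObj' V (tensorObj' W U) ⟶ T}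
    (h : ∀ i a j l n (h : i + a = n) (h' : j + l = a) v w u,
      hf f n (tm V (tensorObj' W U) i a n h v (tm W U j l a h' w u)) =
        hf g n (tm V (tensorObj' W U) i a n h v (tm W U j l a h' w u))) : f = g := by
  refine tensor_ext fun i a n hia v x => ?_
  have key : hf f n ∘ₗ tm V (tensorObj' W U) i a n hia v =
      hf g n ∘ₗ tm V (tensorObj' W U) i a n hia v := by
    refine lin_ext (fun p x hx => f.hom.f_F n p _ ?_) (fun p x hx => g.hom.f_F n p _ ?_)
      (fun j l h' w u => h i a j l n hia h' v w u)
    · exact tm_mem hia (Nat.le_add_left p 0) (mem_F_zero _ v) hx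
    · exact tm_mem hia (Nat.le_add_left p 0) (mem_F_zero _ v) hx
  exact LinearMap.congr_fun key x

theorem tensor_ext4 {Z : CompleteGrDGMod R}
    {f g : tensorObj' (tensorObj' (tensorObj' V W) U) Z ⟶ T}
    (h : ∀ b a i j l m n (h : b + m = n) (h' : a + l = b) (h'' : i + j = a) v w u z,
      hf f n (tm _ Z b m n h (tm (tensorObj' V W) U a l b h' (tm V W i j a h'' v w) u) z) =
        hf g n (tm _ Z b m n h (tm (tensorObj' V W) U a l b h' (tm V W i j a h'' v w) u) z)) :
    f = g := by
  refine tensor_ext fun b m n hbm x z => ?_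
  have key : hf f n ∘ₗ (tm (tensorObj' (tensorObj' V W) U) Z b m n hbm).flip z =
      hf g n ∘ₗ (tm (tensorObj' (tensorObj' V W) U) Z b m n hbm).flip z := by
    refine lin_ext3 (fun p x hx => f.hom.f_F n p _ ?_) (fun p x hx => g.hom.f_F n p _ ?_)
      (fun a i j l h' h'' v w u => h b a i j l m n hbm h' h'' v w u z)
    · exact tm_mem hbm (Nat.le_add_right p 0) hx (mem_F_zero _ z)
    · exact tm_mem hbm (Nat.le_add_right p 0) hx (mem_F_zero _ z)
  exact LinearMap.congr_fun key x

/-- The tensor product of morphisms, `v ⊗ w ↦ f v ⊗ g w`. -/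
def tensorMap {V V' W W' : CompleteGrDGMod R} (f : V ⟶ V') (g : W ⟶ W') :
    tensorObj' V W ⟶ tensorObj' V' W' :=
  desc
    { b := fun i j n h => (tm V' W' i j n h).compl₁₂ (hf f i) (hf g j)
      b_F := fun i j n h p q v w hv hw => tm_mem h le_rfl (f.hom.f_F _ _ _ hv) (g.hom.f_F _ _ _ hw)
      b_d := fun i j n i' j' m h hi hj hm v w => by
        simp only [LinearMap.compl₁₂_apply]
        rw [d_tm h hi hj hm, f.hom.f_d, g.hom.f_d] }

@[simp] theorem tensorMap_tm {V V' W W' : CompleteGrDGMod R} (f : V ⟶ V') (g : W ⟶ W')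
    (i j n : ℤ) (h : i + j = n) (v : V.obj.X i) (w : W.obj.X j) :
    hf (tensorMap f g) n (tm V W i j n h v w) = tm V' W' i j n h (hf f i v) (hf g j w) :=
  desc_tm _ _ _ _ _ _ _

variable (V W U)

/-- The braiding, `v ⊗ w ↦ (-1)^{|v||w|} w ⊗ v`. -/
def braidHom : tensorObj' V W ⟶ tensorObj' W V :=
  desc
    { b := fun i j n h => sgn R (i * j) • (tm W V j i n (by omega)).flip
      b_F := fun i j n h p q v w hv hw =>
        Submodule.smul_mem _ _ (tm_mem _ (Nat.add_comm p q).le hw hv)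
      b_d := fun i j n i' j' m h hi hj hm v w => by
        simp only [LinearMap.smul_apply, LinearMap.flip_apply]
        rw [map_smul, d_tm (by omega) hj hi hm, smul_add, smul_smul, smul_smul, add_comm]
        have h1 : sgn R (i * j) * sgn R j = sgn R (i' * j) := by
          subst hi
          rw [add_mul, one_mul, sgn_add, mul_assoc, sgn_mul_self, mul_one]
        have h2 : sgn R i * sgn R (i * j') = sgn R (i * j) := by
          subst hj
          rw [mul_add, mul_one, sgn_add, mul_comm]
        rw [h1, h2] }

@[simp] theorem braidHom_tm (i j n : ℤ) (h : i + j = n) (v : V.obj.X i) (w : W.obj.X j) :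
    hf (braidHom V W) n (tm V W i j n h v w) =
      sgn R (i * j) • tm W V j i n (by omega) w v :=
  desc_tm _ _ _ _ _ _ _

theorem braidHom_braidHom : braidHom V W ≫ braidHom W V = 𝟙 _ := by
  refine tensor_ext fun i j n h v w => ?_
  simp only [hf_comp, hf_id, braidHom_tm, map_smul]
  rw [smul_smul, mul_comm j i, sgn_mul_self, one_smul]

/-- The map `x ↦ (v ⊗ w ↦ v ⊗ (w ⊗ u))` for a fixed homogeneous element `u`. -/
def assocLin (n k m : ℤ) (h : n + k = m) (u : U.obj.X k) :
    (tensorObj' V W).obj.X n →ₗ[R] (tensorObj' V (tensorObj' W U)).obj.X m :=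
  linDesc
    (fun i j _ => (tm V (tensorObj' W U) i (j + k) m (by omega)).compl₂
      ((tm W U j k (j + k) rfl).flip u))
    (fun i j _ p q v w hv hw =>
      tm_mem _ le_rfl hv (tm_mem rfl (Nat.le_add_right q 0) hw (mem_F_zero _ u)))

variable {V W U}

theorem assocLin_tm {n k m i j l : ℤ} (h : n + k = m) (u : U.obj.X k) (hij : i + j = n)
    (hl : j + k = l) (v : V.obj.X i) (w : W.obj.X j) :
    assocLin V W U n k m h u (tm V W i j n hij v w) =
      tm V (tensorObj' W U) i l m (by omega) v (tm W U j k l hl w u) := by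
  subst hl
  exact linDesc_tm _ _ _ _ _ _ _

theorem assocLin_mem {n k m : ℤ} (h : n + k = m) (u : U.obj.X k) (p : ℕ)
    (x : (tensorObj' V W).obj.X n) (hx : x ∈ (tensorObj' V W).obj.F n p) :
    assocLin V W U n k m h u x ∈ (tensorObj' V (tensorObj' W U)).obj.F m p :=
  linDesc_mem _ _ _ _ hx

variable (V W U)

/-- The maps `(x, u) ↦ (v ⊗ w, u ↦ v ⊗ (w ⊗ u))`. -/
def assocBil (n k m : ℤ) (h : n + k = m) :
    (tensorObj' V W).obj.X n →ₗ[R] U.obj.X k →ₗ[R] (tensorObj' V (tensorObj' W U)).obj.X m :=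
  LinearMap.flip
    { toFun := assocLin V W U n k m h
      map_add' := fun u u' => by
        refine lin_ext (assocLin_mem h _) (fun p x hx => add_mem (assocLin_mem h u p x hx)
          (assocLin_mem h u' p x hx)) fun i j hij v w => ?_
        rw [LinearMap.add_apply, assocLin_tm h _ hij rfl, assocLin_tm h _ hij rfl,
          assocLin_tm h _ hij rfl, map_add, map_add]
      map_smul' := fun c u => by
        refine lin_ext (assocLin_mem h _) (fun p x hx => Submodule.smul_mem _ c
          (assocLin_mem h u p x hx)) fun i j hij v w => ?_
        rw [RingHom.id_apply, LinearMap.smul_apply, assocLin_tm h _ hij rfl,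
          assocLin_tm h _ hij rfl, map_smul, map_smul] }

theorem assocBil_apply (n k m : ℤ) (h : n + k = m) (x : (tensorObj' V W).obj.X n) (u : U.obj.X k) :
    assocBil V W U n k m h x u = assocLin V W U n k m h u x := rfl

/-- The associator, `(v ⊗ w) ⊗ u ↦ v ⊗ (w ⊗ u)`. -/
def assocHom : tensorObj' (tensorObj' V W) U ⟶ tensorObj' V (tensorObj' W U) :=
  desc
    { b := assocBil V W U
      b_F := fun n k m h p q x u hx hu => by
        refine ctensor_shift (f := assocLin V W U n k m h u)
          ((tensorObj' V (tensorObj' W U)).obj.F_anti m) (assocLin_mem h u) ?_ hx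
        intro i j hij a c v w hv hw
        have := assocLin_tm h u hij rfl v w
        refine (congrArg (· ∈ (tensorObj' V (tensorObj' W U)).obj.F m (a + c + q)) this).mpr ?_
        exact tm_mem _ (Nat.add_assoc a c q).le hv (tm_mem rfl le_rfl hw hu)
      b_d := fun n k m n' k' m' h hn hk hm x u => by
        simp only [assocBil_apply]
        have key : (tensorObj' V (tensorObj' W U)).obj.d m m' ∘ₗ assocLin V W U n k m h u =
            assocLin V W U n' k m' (by omega) u ∘ₗ (tensorObj' V W).obj.d n n' +
              sgn R n • assocLin V W U n k' m' (by omega) (U.obj.d k k' u) := by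
          refine lin_ext (fun p x hx => FiltGrDGMod.d_F _ _ _ _ _ (assocLin_mem h u p x hx))
            (fun p x hx => add_mem
              (assocLin_mem (by omega) u p _ (FiltGrDGMod.d_F _ _ _ _ _ hx))
              (Submodule.smul_mem _ _ (assocLin_mem (by omega) _ p _ hx))) fun i j hij v w => ?_
          obtain ⟨i', rfl⟩ : ∃ i', i' + 1 = i := ⟨i - 1, by ring⟩
          obtain ⟨j', rfl⟩ : ∃ j', j' + 1 = j := ⟨j - 1, by ring⟩
          rw [LinearMap.add_apply, LinearMap.smul_apply, LinearMap.comp_apply,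
            LinearMap.comp_apply, assocLin_tm h u hij (l := j' + k + 1) (by ring),
            d_tm hij rfl rfl hn, map_add, map_smul,
            assocLin_tm _ u _ (l := j' + k + 1) (by ring),
            assocLin_tm _ u _ (l := j' + k) (by ring),
            assocLin_tm _ _ _ (l := j' + k) (by omega),
            d_tm _ rfl rfl hm, d_tm _ rfl hk rfl, map_add, map_smul, smul_add, smul_smul,
            ← sgn_add, hij]
          exact (add_assoc _ _ _).symm
        exact LinearMap.congr_fun key x }

variable {V W U}

theorem assocHom_tm {n k m i j l : ℤ} (h : n + k = m) (hij : i + j = n)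
    (hl : j + k = l) (v : V.obj.X i) (w : W.obj.X j) (u : U.obj.X k) :
    hf (assocHom V W U) m (tm (tensorObj' V W) U n k m h (tm V W i j n hij v w) u) =
      tm V (tensorObj' W U) i l m (by omega) v (tm W U j k l hl w u) :=
  (desc_tm _ _ _ _ _ _ _).trans (assocLin_tm h u hij hl v w)

variable (V W U)

/-- The inverse of the associator, obtained from the associator and the braiding. -/
def assocInv : tensorObj' V (tensorObj' W U) ⟶ tensorObj' (tensorObj' V W) U :=
  braidHom V (tensorObj' W U) ≫ tensorMap (braidHom W U) (𝟙 V) ≫ assocHom U W V ≫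
    braidHom U (tensorObj' W V) ≫ tensorMap (braidHom W V) (𝟙 U)

variable {V W U}

theorem assocInv_tm {n k m i j l : ℤ} (h : n + k = m) (hij : i + j = n)
    (hl : j + k = l) (v : V.obj.X i) (w : W.obj.X j) (u : U.obj.X k) :
    hf (assocInv V W U) m (tm V (tensorObj' W U) i l m (by omega) v (tm W U j k l hl w u)) =
      tm (tensorObj' V W) U n k m h (tm V W i j n hij v w) u := by
  simp only [assocInv, hf_comp, braidHom_tm, map_smul, tensorMap_tm, hf_id,
    LinearMap.smul_apply]
  rw [assocHom_tm (l := n) _ _ (by omega), braidHom_tm, map_smul, tensorMap_tm, braidHom_tm]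
  simp only [map_smul, LinearMap.smul_apply, smul_smul, hf_id]
  have : sgn R (i * l) * sgn R (j * k) * sgn R (k * n) * sgn R (j * i) = 1 := by
    subst hij hl
    rw [← sgn_add, ← sgn_add, ← sgn_add,
      show i * (j + k) + j * k + k * (i + j) + j * i = (i * j + j * k + i * k) +
        (i * j + j * k + i * k) by ring, sgn_add, sgn_mul_self]
  rw [← mul_assoc, ← mul_assoc, this, one_smul]
/-- The unit: `R` in degree `0` and pure weight `0`. Its degree `n` part is realized as the
submodule of `R` which is everything for `n = 0` and zero otherwise. -/
def unit (R : Type u) [CommRing R] : CompleteGrDGMod R where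
  obj :=
    { X := fun n =>
        ({ carrier := {r | n ≠ 0 → r = 0}
           add_mem' := fun ha hb h => by rw [ha h, hb h, add_zero]
           zero_mem' := fun _ => rfl
           smul_mem' := fun c a ha h => by rw [ha h, smul_zero] } : Submodule R R)
      F := fun n p =>
        { carrier := {r | p ≠ 0 → r = 0}
          add_mem' := fun ha hb h => (congrArg₂ (· + ·) (ha h) (hb h)).trans (add_zero 0)
          zero_mem' := fun _ => rfl
          smul_mem' := fun c a ha h => by rw [ha h, smul_zero] }
      F_zero := fun n => Submodule.eq_top_iff'.2 fun x h => absurd rfl h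
      F_anti := fun n p q hpq x hx hp => hx (by omega)
      d := fun i j => 0
      d_shape := fun i j h => rfl
      d_F := fun i j p x hx => zero_mem _
      d_d := fun i j k p x hx => zero_mem _ }
  property n := isCompleteFilt_of_eq_bot 1 ((Submodule.eq_bot_iff _).2 fun x hx => hx one_ne_zero)

/-- The coefficient in `R` of an element of the unit. -/
def unitCoe (i : ℤ) : (unit R).obj.X i →ₗ[R] R := Submodule.subtype _

theorem unitCoe_injective (i : ℤ) : Function.Injective (unitCoe (R := R) i) :=
  Subtype.val_injective

theorem unitCoe_eq_zero {i : ℤ} (h : i ≠ 0) (r : (unit R).obj.X i) : unitCoe i r = 0 := r.2 h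

theorem unitCoe_F {i : ℤ} {p : ℕ} {r : (unit R).obj.X i} (hr : r ∈ (unit R).obj.F i p)
    (hp : p ≠ 0) : unitCoe i r = 0 := congrArg Subtype.val (hr hp)

/-- The unit element `1`. -/
def unitOne (R : Type u) [CommRing R] : (unit R).obj.X 0 := ⟨1, fun h => absurd rfl h⟩

theorem unitCoe_one : unitCoe 0 (unitOne R) = 1 := rfl

theorem unit_d (i j : ℤ) (r : (unit R).obj.X i) : (unit R).obj.d i j r = 0 := rfl

theorem smul_unitOne (r : (unit R).obj.X 0) : unitCoe 0 r • unitOne R = r :=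
  Subtype.ext (mul_one _)

/-- The identification of the components of degrees `j` and `n` for `j = n`. -/
def castX (V : CompleteGrDGMod R) (j n : ℤ) : V.obj.X j →ₗ[R] V.obj.X n :=
  if h : j = n then h ▸ LinearMap.id else 0

theorem castX_self (V : CompleteGrDGMod R) (n : ℤ) (v : V.obj.X n) : castX V n n v = v := by
  simp [castX]

variable (V)

/-- The left unitor, `r ⊗ v ↦ r v`. -/
def lUnitHom : tensorObj' (unit R) V ⟶ V :=
  desc
    { b := fun i j n _ => (LinearMap.lsmul R (V.obj.X j →ₗ[R] V.obj.X n)).flip (castX V j n) ∘ₗ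
        unitCoe i
      b_F := fun i j n h p q r v hr hv => by
        simp only [LinearMap.comp_apply, LinearMap.flip_apply, LinearMap.lsmul_apply,
          LinearMap.smul_apply]
        by_cases hi : i = 0
        · subst hi
          obtain rfl : j = n := by omega
          rw [castX_self]
          by_cases hp : p = 0
          · subst hp
            rw [zero_add]
            exact Submodule.smul_mem _ _ hv
          · rw [unitCoe_F hr hp, zero_smul]
            exact zero_mem _
        · rw [unitCoe_eq_zero hi, zero_smul]
          exact zero_mem _
      b_d := fun i j n i' j' m h hi hj hm r v => by
        simp only [LinearMap.comp_apply, LinearMap.flip_apply, LinearMap.lsmul_apply,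
          LinearMap.smul_apply]
        rw [unit_d, map_zero, zero_smul, zero_add]
        by_cases hi0 : i = 0
        · subst hi0
          obtain rfl : j = n := by omega
          obtain rfl : j' = m := by omega
          rw [castX_self, castX_self, map_smul, sgn_zero, one_smul]
        · rw [unitCoe_eq_zero hi0, zero_smul, zero_smul, smul_zero, map_zero] }

theorem lUnitHom_tm (j n : ℤ) (h : 0 + j = n) (r : (unit R).obj.X 0) (v : V.obj.X j) :
    hf (lUnitHom V) n (tm (unit R) V 0 j n h r v) = unitCoe 0 r • castX V j n v :=
  desc_tm _ _ _ _ _ _ _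

/-- The inverse of the left unitor, `v ↦ 1 ⊗ v`. -/
def lUnitInv : V ⟶ tensorObj' (unit R) V := ObjectProperty.homMk
  { f := fun n => tm (unit R) V 0 n n (zero_add n) (unitOne R)
    f_F := fun n p x hx => tm_mem _ (Nat.le_add_left p 0) (mem_F_zero _ _) hx
    f_d := fun n m x => by
      by_cases hm : m + 1 = n
      · rw [d_tm (zero_add n) (sub_add_cancel 0 1) hm hm, unit_d, map_zero,
          LinearMap.zero_apply, zero_add, sgn_zero, one_smul]
      · rw [FiltGrDGMod.d_shape _ _ _ hm, FiltGrDGMod.d_shape _ _ _ hm, LinearMap.zero_apply,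
          LinearMap.zero_apply, map_zero] }

theorem lUnitInv_apply (n : ℤ) (x : V.obj.X n) :
    hf (lUnitInv V) n x = tm (unit R) V 0 n n (zero_add n) (unitOne R) x := rfl

variable {V}

theorem unit_tm_eq_zero {i j n : ℤ} (h : i + j = n) (hi : i ≠ 0) (r : (unit R).obj.X i)
    (v : V.obj.X j) : tm (unit R) V i j n h r v = 0 := by
  obtain rfl : r = 0 := unitCoe_injective i (by rw [unitCoe_eq_zero hi, map_zero])
  rw [map_zero, LinearMap.zero_apply]

theorem tm_unit_eq_zero {i j n : ℤ} (h : i + j = n) (hj : j ≠ 0) (v : V.obj.X i)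
    (r : (unit R).obj.X j) : tm V (unit R) i j n h v r = 0 := by
  obtain rfl : r = 0 := unitCoe_injective j (by rw [unitCoe_eq_zero hj, map_zero])
  rw [map_zero]

variable (V)

/-- The left unitor. -/
def lUnitor : tensorObj' (unit R) V ≅ V where
  hom := lUnitHom V
  inv := lUnitInv V
  hom_inv_id := by
    refine tensor_ext fun i j n h r v => ?_
    by_cases hi : i = 0
    · subst hi
      obtain rfl : j = n := by omega
      rw [hf_comp, hf_id, lUnitHom_tm, castX_self, map_smul, lUnitInv_apply,
        ← LinearMap.smul_apply, ← map_smul, smul_unitOne]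
    · rw [unit_tm_eq_zero h hi, map_zero, map_zero]
  inv_hom_id := hom_ext' fun n x => by
    rw [hf_comp, hf_id, lUnitInv_apply, lUnitHom_tm, castX_self, unitCoe_one, one_smul]

variable (W)

/-- The braiding isomorphism. -/
def braid : tensorObj' V W ≅ tensorObj' W V where
  hom := braidHom V W
  inv := braidHom W V
  hom_inv_id := braidHom_braidHom V W
  inv_hom_id := braidHom_braidHom W V

/-- The right unitor, `v ⊗ r ↦ r v`. -/
def rUnitor : tensorObj' V (unit R) ≅ V := braid V (unit R) ≪≫ lUnitor V

variable {V W}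

theorem rUnitor_tm (j n : ℤ) (h : j + 0 = n) (r : (unit R).obj.X 0) (v : V.obj.X j) :
    hf (rUnitor V).hom n (tm V (unit R) j 0 n h v r) = unitCoe 0 r • castX V j n v := by
  change hf (lUnitHom V) n (hf (braidHom V (unit R)) n _) = _
  rw [braidHom_tm, map_smul, lUnitHom_tm, mul_zero, sgn_zero, one_smul]

variable (V W U)

/-- The associator isomorphism. -/
def assoc : tensorObj' (tensorObj' V W) U ≅ tensorObj' V (tensorObj' W U) where
  hom := assocHom V W U
  inv := assocInv V W U
  hom_inv_id := tensor_ext3 fun a i j l n h h' v w u => by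
    rw [hf_comp, hf_id, assocHom_tm h h' rfl, assocInv_tm h h' rfl]
  inv_hom_id := tensor_ext3' fun i a j l n h h' v w u => by
    rw [hf_comp, hf_id, assocInv_tm (n := i + j) (by omega) rfl h', assocHom_tm _ rfl h']

variable {V W U}

instance : MonoidalCategoryStruct (CompleteGrDGMod R) where
  tensorObj := tensorObj'
  tensorHom f g := tensorMap f g
  whiskerLeft V _ _ f := tensorMap (𝟙 V) f
  whiskerRight f W := tensorMap f (𝟙 W)
  tensorUnit := unit R
  associator := assoc
  leftUnitor := lUnitor
  rightUnitor := rUnitor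

theorem tensorMap_id (V W : CompleteGrDGMod R) : tensorMap (𝟙 V) (𝟙 W) = 𝟙 (tensorObj' V W) :=
  tensor_ext fun i j n h v w => by simp

theorem tensorMap_comp {V₁ W₁ U₁ V₂ W₂ U₂ : CompleteGrDGMod R} (f₁ : V₁ ⟶ W₁) (f₂ : V₂ ⟶ W₂)
    (g₁ : W₁ ⟶ U₁) (g₂ : W₂ ⟶ U₂) :
    tensorMap f₁ f₂ ≫ tensorMap g₁ g₂ = tensorMap (f₁ ≫ g₁) (f₂ ≫ g₂) :=
  tensor_ext fun i j n h v w => by simp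

theorem assoc_naturality {V₁ V₂ V₃ W₁ W₂ W₃ : CompleteGrDGMod R} (f₁ : V₁ ⟶ W₁) (f₂ : V₂ ⟶ W₂)
    (f₃ : V₃ ⟶ W₃) : tensorMap (tensorMap f₁ f₂) f₃ ≫ assocHom W₁ W₂ W₃ =
      assocHom V₁ V₂ V₃ ≫ tensorMap f₁ (tensorMap f₂ f₃) :=
  tensor_ext3 fun a i j l n h h' v w u => by
    rw [hf_comp, hf_comp, tensorMap_tm, tensorMap_tm, assocHom_tm h h' rfl, assocHom_tm h h' rfl,
      tensorMap_tm, tensorMap_tm]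

theorem lUnit_naturality {V W : CompleteGrDGMod R} (f : V ⟶ W) :
    tensorMap (𝟙 (unit R)) f ≫ lUnitHom W = lUnitHom V ≫ f := by
  refine tensor_ext fun i j n h r v => ?_
  by_cases hi : i = 0
  · subst hi
    obtain rfl : j = n := by omega
    rw [hf_comp, hf_comp, tensorMap_tm, lUnitHom_tm, lUnitHom_tm, castX_self, castX_self,
      map_smul, hf_id]
  · rw [unit_tm_eq_zero h hi, map_zero, map_zero]

theorem rUnit_naturality {V W : CompleteGrDGMod R} (f : V ⟶ W) :
    tensorMap f (𝟙 (unit R)) ≫ (rUnitor W).hom = (rUnitor V).hom ≫ f := by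
  refine tensor_ext fun i j n h v r => ?_
  by_cases hj : j = 0
  · subst hj
    obtain rfl : i = n := by omega
    rw [hf_comp, hf_comp, tensorMap_tm, rUnitor_tm, rUnitor_tm, castX_self, castX_self,
      map_smul, hf_id]
  · rw [tm_unit_eq_zero h hj, map_zero, map_zero]

theorem pentagon' (V W U Z : CompleteGrDGMod R) :
    tensorMap (assocHom V W U) (𝟙 Z) ≫ assocHom V (tensorObj' W U) Z ≫
      tensorMap (𝟙 V) (assocHom W U Z) =
    assocHom (tensorObj' V W) U Z ≫ assocHom V W (tensorObj' U Z) :=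
  tensor_ext4 fun b a i j l m n h h' h'' v w u z => by
    rw [hf_comp, hf_comp, hf_comp, tensorMap_tm, assocHom_tm h' h'' (l := j + l) rfl,
      assocHom_tm _ _ (l := j + l + m) rfl, tensorMap_tm,
      assocHom_tm _ _ (l := l + m) rfl,
      assocHom_tm h h' (l := l + m) rfl, assocHom_tm _ h'' (l := j + l + m) (by omega), hf_id, hf_id]

theorem triangle' (V W : CompleteGrDGMod R) :
    assocHom V (unit R) W ≫ tensorMap (𝟙 V) (lUnitHom W) =
      tensorMap (rUnitor V).hom (𝟙 W) :=
  tensor_ext3 fun a i j l n h h' v r w => by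
    by_cases hj : j = 0
    · subst hj
      obtain rfl : i = a := by omega
      rw [hf_comp, assocHom_tm h h' (l := l) (by omega), tensorMap_tm, tensorMap_tm, lUnitHom_tm,
        rUnitor_tm, castX_self, castX_self, hf_id, hf_id, map_smul, map_smul,
        LinearMap.smul_apply]
    · rw [tm_unit_eq_zero h' hj, map_zero, LinearMap.zero_apply, map_zero, map_zero]

/-- The monoidal structure given by the completed tensor product. -/
instance : MonoidalCategory (CompleteGrDGMod R) :=
  MonoidalCategory.ofTensorHom
    (id_tensorHom_id := tensorMap_id)
    (id_tensorHom := fun _ _ _ _ => rfl)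
    (tensorHom_id := fun _ _ => rfl)
    (tensorHom_comp_tensorHom := tensorMap_comp)
    (associator_naturality := assoc_naturality)
    (leftUnitor_naturality := lUnit_naturality)
    (rightUnitor_naturality := rUnit_naturality)
    (pentagon := pentagon')
    (triangle := triangle')

theorem braid_naturality {V₁ V₂ W₁ W₂ : CompleteGrDGMod R} (f : V₁ ⟶ W₁) (g : V₂ ⟶ W₂) :
    tensorMap f g ≫ braidHom W₁ W₂ = braidHom V₁ V₂ ≫ tensorMap g f :=
  tensor_ext fun i j n h v w => by
    simp only [hf_comp, tensorMap_tm, braidHom_tm, map_smul]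

theorem hexagon' (V W U : CompleteGrDGMod R) :
    assocHom V W U ≫ braidHom V (tensorObj' W U) ≫ assocHom W U V =
      tensorMap (braidHom V W) (𝟙 U) ≫ assocHom W V U ≫ tensorMap (𝟙 W) (braidHom V U) :=
  tensor_ext3 fun a i j l n h h' v w u => by
    simp only [hf_comp, tensorMap_tm, braidHom_tm, map_smul, LinearMap.smul_apply, hf_id]
    rw [assocHom_tm h h' rfl, braidHom_tm, map_smul, assocHom_tm _ _ (l := l + i) rfl,
      assocHom_tm _ _ (l := l + i) (by omega), tensorMap_tm, braidHom_tm, map_smul, smul_smul,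
      mul_add, sgn_add, hf_id]

theorem hexagon_rev' (V W U : CompleteGrDGMod R) :
    assocInv V W U ≫ braidHom (tensorObj' V W) U ≫ assocInv U V W =
      tensorMap (𝟙 V) (braidHom W U) ≫ assocInv V U W ≫ tensorMap (braidHom V U) (𝟙 W) :=
  tensor_ext3' fun i a j l n h h' v w u => by
    simp only [hf_comp, tensorMap_tm, braidHom_tm, map_smul, hf_id]
    rw [assocInv_tm (n := i + j) (by omega) rfl h', braidHom_tm, map_smul,
      assocInv_tm (n := l + i) (by omega) rfl rfl, assocInv_tm (n := l + i) (by omega) (by omega),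
      tensorMap_tm, braidHom_tm, map_smul, LinearMap.smul_apply, smul_smul,
      add_mul, sgn_add, hf_id, mul_comm (sgn R (i * l))]

/-- The symmetric structure, with the Koszul sign rule. -/
instance : SymmetricCategory (CompleteGrDGMod R) where
  braiding := braid
  braiding_naturality_right V _ _ f := braid_naturality (𝟙 V) f
  braiding_naturality_left f W := braid_naturality f (𝟙 W)
  hexagon_forward := hexagon'
  hexagon_reverse := hexagon_rev'
  symmetry := braidHom_braidHom

variable (R)

/-- The class of graded quasi-isomorphisms: the maps inducing a quasi-isomorphism on the
associated graded complexes. -/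
def gradedQuasiIso : MorphismProperty (CompleteGrDGMod R) :=
  fun _ _ f => ∀ p : ℕ, QuasiIso ((gr p).map f.hom)

/-- The class of strict surjections: degreewise surjective maps `f : V → W` with
`f (F_q V) = f (V) ∩ F_q W` for all `q`. -/
def strictSurjection : MorphismProperty (CompleteGrDGMod R) :=
  fun V W f => ∀ i, Function.Surjective (hf f i) ∧
    ∀ q, (V.obj.F i q).map (hf f i) = LinearMap.range (hf f i) ⊓ W.obj.F i q

/-- The complete gr-dg module `R → R → R → ⋯` with identity maps as predifferentials, where the
`k`-th copy of `R` is in degree `n - k` and of pure weight `w k`. Each graded piece is realized as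
a submodule of `R` which is everything in degrees `≤ n` and zero otherwise. -/
def tower (n : ℤ) (w : ℕ → ℕ) (h₁ : ∀ k, w k ≤ w (k + 1)) (h₂ : ∀ k, w k + 1 ≤ w (k + 2)) :
    CompleteGrDGMod R where
  obj :=
    { X := fun m =>
        ({ carrier := {r | n < m → r = 0}
           add_mem' := fun ha hb h => by rw [ha h, hb h, add_zero]
           zero_mem' := fun _ => rfl
           smul_mem' := fun c a ha h => by rw [ha h, smul_zero] } : Submodule R R)
      F := fun m p =>
        { carrier := {r | w (n - m).toNat < p → r = 0}
          add_mem' := fun ha hb h => (congrArg₂ (· + ·) (ha h) (hb h)).trans (add_zero 0)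
          zero_mem' := fun _ => rfl
          smul_mem' := fun c a ha h => by rw [ha h, smul_zero] }
      F_zero := fun m => Submodule.eq_top_iff'.2 fun x h => absurd h (Nat.not_lt_zero _)
      F_anti := fun m p q hpq x hx hp => hx (by omega)
      d := fun i j => if h : j + 1 = i then
          Submodule.inclusion (fun r (hr : n < i → r = 0) (h' : n < j) => hr (by omega))
        else 0
      d_shape := fun i j h => dif_neg h
      d_F := fun i j p x hx => by
        split_ifs with h
        · intro hp
          refine Subtype.ext ?_
          change x.1 = 0
          by_cases hi : n < i
          · exact x.2 hi
          · refine congrArg Subtype.val (hx ?_)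
            have := h₁ (n - i).toNat
            rw [show (n - j).toNat = (n - i).toNat + 1 by omega] at hp
            omega
        · exact zero_mem _
      d_d := fun i j k p x hx => by
        split_ifs with h h' h'
        · intro hp
          refine Subtype.ext ?_
          change x.1 = 0
          by_cases hi : n < i
          · exact x.2 hi
          · refine congrArg Subtype.val (hx ?_)
            have := h₂ (n - i).toNat
            rw [show (n - k).toNat = (n - i).toNat + 2 by omega] at hp
            omega
        · rw [LinearMap.zero_apply, map_zero]
          exact zero_mem _
        · exact zero_mem _
        · exact zero_mem _ }
  property m := isCompleteFilt_of_eq_bot (w (n - m).toNat + 1)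
    ((Submodule.eq_bot_iff _).2 fun x hx => hx (Nat.lt_succ_self _))

/-- `𝒵^{0,∞}_{q,n}`: the `k`-th copy of `R` has weight `q + ⌊k/2⌋`. -/
def Z0 (q : ℕ) (n : ℤ) : CompleteGrDGMod R :=
  tower R n (fun k => q + k / 2) (fun k => by omega) (fun k => by omega)

/-- `𝒵^{1,∞}_{q,n}`: the `k`-th copy of `R` has weight `q + ⌈k/2⌉`. -/
def Z1 (q : ℕ) (n : ℤ) : CompleteGrDGMod R :=
  tower R n (fun k => q + (k + 1) / 2) (fun k => by omega) (fun k => by omega)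

variable {R}

/-- The direct sum of two complete gr-dg modules, which is their coproduct. -/
def directSum (V W : CompleteGrDGMod R) : CompleteGrDGMod R where
  obj :=
    { X := fun i => V.obj.X i × W.obj.X i
      F := fun i p => (V.obj.F i p).prod (W.obj.F i p)
      F_zero := fun i => by rw [V.obj.F_zero, W.obj.F_zero, Submodule.prod_top]
      F_anti := fun i => prod_antitone (V.obj.F_anti i) (W.obj.F_anti i)
      d := fun i j => (V.obj.d i j).prodMap (W.obj.d i j)
      d_shape := fun i j h => by
        rw [V.obj.d_shape i j h, W.obj.d_shape i j h, LinearMap.prodMap_zero]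
      d_F := fun i j p x hx => ⟨V.obj.d_F i j p _ hx.1, W.obj.d_F i j p _ hx.2⟩
      d_d := fun i j k p x hx => ⟨V.obj.d_d i j k p _ hx.1, W.obj.d_d i j k p _ hx.2⟩ }
  property i := isCompleteFilt_prod (V.property i) (W.property i)

variable (R)

/-- `ℬ^{1,∞}_{q,n} = 𝒵^{0,∞}_{q,n+1} ⨿ 𝒵^{0,∞}_{q+1,n}`. -/
def B1 (q : ℕ) (n : ℤ) : CompleteGrDGMod R := directSum (Z0 R q (n + 1)) (Z0 R (q + 1) n)

/-- The morphism `φ_{q,n} : 𝒵^{1,∞}_{q,n} → ℬ^{1,∞}_{q,n}`, given in each degree `≤ n` by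
`r ↦ (r, r)`. -/
def phi (q : ℕ) (n : ℤ) : Z1 R q n ⟶ B1 R q n := ObjectProperty.homMk
  { f := fun m => LinearMap.prod
      (Submodule.inclusion (fun r (hr : n < m → r = 0) (h' : n + 1 < m) => hr (by omega)))
      (Submodule.inclusion (fun r (hr : n < m → r = 0) (h' : n < m) => hr h'))
    f_F := fun m p x hx => by
      by_cases hm : n < m
      · exact ⟨fun _ => Subtype.ext (x.2 hm), fun _ => Subtype.ext (x.2 hm)⟩
      · refine ⟨fun hp => Subtype.ext (show x.1 = 0 from congrArg Subtype.val (hx ?_)),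
          fun hp => Subtype.ext (show x.1 = 0 from congrArg Subtype.val (hx ?_))⟩
        · rw [show (n + 1 - m).toNat = (n - m).toNat + 1 by omega] at hp
          exact hp
        · beta_reduce at hp ⊢
          omega
    f_d := fun i j x => by
      by_cases h : j + 1 = i
      · refine Prod.ext (Subtype.ext ?_) (Subtype.ext ?_)
        · simp only [B1, directSum, Z1, Z0, tower, h, dite_true]
          rfl
        · simp only [B1, directSum, Z1, Z0, tower, h, dite_true]
          rfl
      · rw [FiltGrDGMod.d_shape _ _ _ h, FiltGrDGMod.d_shape _ _ _ h, LinearMap.zero_apply,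
          LinearMap.zero_apply]
        rfl }

/-- The zero object. -/
def zeroObj : CompleteGrDGMod R where
  obj :=
    { X := fun _ => PUnit
      F := fun _ _ => ⊤
      F_zero := fun _ => rfl
      F_anti := fun _ _ _ _ => le_rfl
      d := fun _ _ => 0
      d_shape := fun _ _ _ => rfl
      d_F := fun _ _ _ _ _ => trivial
      d_d := fun _ _ _ _ _ _ => trivial }
  property _ := isCompleteFilt_of_eq_bot 0 (Subsingleton.elim _ _)

variable {R}

/-- The morphism `0 → V`. -/
def fromZero (V : CompleteGrDGMod R) : zeroObj R ⟶ V := ObjectProperty.homMk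
  { f := fun _ => 0
    f_F := fun _ _ _ _ => zero_mem _
    f_d := fun i j x => by
      rw [LinearMap.zero_apply, LinearMap.zero_apply, map_zero] }

variable (R)

/-- The set `I_0^∞ = {φ_{q,n} : 𝒵^{1,∞}_{q,n} → ℬ^{1,∞}_{q,n}}` for `q ∈ ℕ`, `n ∈ ℤ`. -/
def genCof : MorphismProperty (CompleteGrDGMod R) :=
  MorphismProperty.ofHoms (fun x : ℕ × ℤ => phi R x.1 x.2)

/-- The set `J_0^∞ = {0 → 𝒵^{0,∞}_{q,n}}` for `q ∈ ℕ`, `n ∈ ℤ`. -/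
def genTrivCof : MorphismProperty (CompleteGrDGMod R) :=
  MorphismProperty.ofHoms (fun x : ℕ × ℤ => fromZero (Z0 R x.1 x.2))

end CompleteGrDGMod

section ModelCategories

universe w w'

variable {C : Type w'} [Category.{w} C]

/-- `A` is small relative to `N`: there is a cardinal `κ` such that `Hom(A, -)` commutes with the
colimits of the `λ`-sequences with successor maps in `N`, for all `κ`-filtered limit ordinals
`λ` (represented by well-ordered types `J`). -/
def IsSmallRelativeTo (A : C) (N : MorphismProperty C) : Prop :=
  ∃ (κ : Cardinal.{w}) (_ : Fact κ.IsRegular), ∀ (J : Type w) [LinearOrder J] [SuccOrder J]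
    [OrderBot J] [WellFoundedLT J] [NoMaxOrder J] [IsCardinalFiltered J κ] (F : J ⥤ C)
    [F.IsWellOrderContinuous], (∀ j, N (F.map (homOfLE (Order.le_succ j)))) →
      PreservesColimit F (coyoneda.obj (Opposite.op A))

/-- The relative `I`-cell complexes: transfinite compositions of pushouts of elements of `I`. -/
def relCell (I : MorphismProperty C) : MorphismProperty C :=
  MorphismProperty.transfiniteCompositions.{w} I.pushouts

variable (C)

/-- A model category is cofibrantly generated by a set `I` of generating cofibrations and a set
`J` of generating trivial cofibrations. -/
structure IsCofibrantlyGeneratedBy [ModelCategory C] (I J : MorphismProperty C) : Prop where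
  isSmall_I : MorphismProperty.IsSmall.{w} I
  isSmall_J : MorphismProperty.IsSmall.{w} J
  small_dom_I : ∀ {A B : C} (f : A ⟶ B), I f → IsSmallRelativeTo A (relCell I)
  small_dom_J : ∀ {A B : C} (f : A ⟶ B), J f → IsSmallRelativeTo A (relCell J)
  fibrations_eq : fibrations C = J.rlp
  trivialFibrations_eq : trivialFibrations C = I.rlp

/-- A model category is proper if weak equivalences are stable under pushout along cofibrations
and under pullback along fibrations. -/
structure IsProper [ModelCategory C] : Prop where
  left : ∀ {A B X Y : C} (i : A ⟶ B) (g : A ⟶ X) (g' : B ⟶ Y) (i' : X ⟶ Y),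
    IsPushout i g g' i' → cofibrations C i → weakEquivalences C g → weakEquivalences C g'
  right : ∀ {P X Y Z : C} (g' : P ⟶ X) (p' : P ⟶ Y) (p : X ⟶ Z) (g : Y ⟶ Z),
    IsPullback g' p' p g → fibrations C p → weakEquivalences C g → weakEquivalences C g'

/-- Both factorizations of a model category can be chosen functorially. -/
structure HasFunctorialFactorizations [ModelCategory C] : Prop where
  left : MorphismProperty.HasFunctorialFactorization (cofibrations C) (trivialFibrations C)
  right : MorphismProperty.HasFunctorialFactorization (trivialCofibrations C) (fibrations C)

/-- A model category is combinatorial if it is locally presentable and cofibrantly generated. -/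
structure IsCombinatorial [ModelCategory C] : Prop where
  locallyPresentable : IsLocallyPresentable.{w} C
  cofibrantlyGenerated : ∃ I J : MorphismProperty C, IsCofibrantlyGeneratedBy C I J

/-- A symmetric monoidal model category: the pushout-product axiom and the unit axiom (for every
cofibrant replacement of the unit). -/
structure IsSymmetricMonoidalModelCategory [MonoidalCategory C] [SymmetricCategory C]
    [ModelCategory C] : Prop where
  pushoutProduct_cofibration : ∀ {A₁ X₁ A₂ X₂ : C} (i₁ : A₁ ⟶ X₁) (i₂ : A₂ ⟶ X₂)
    (sq : (curriedTensor C).PushoutObjObj i₁ i₂),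
    cofibrations C i₁ → cofibrations C i₂ → cofibrations C sq.ι
  pushoutProduct_trivialCofibration : ∀ {A₁ X₁ A₂ X₂ : C} (i₁ : A₁ ⟶ X₁) (i₂ : A₂ ⟶ X₂)
    (sq : (curriedTensor C).PushoutObjObj i₁ i₂),
    cofibrations C i₁ → cofibrations C i₂ → (weakEquivalences C i₁ ∨ weakEquivalences C i₂) →
      trivialCofibrations C sq.ι
  unit_left : ∀ {Q : C} (π : Q ⟶ 𝟙_ C), IsCofibrant Q → trivialFibrations C π →
    ∀ X : C, IsCofibrant X → weakEquivalences C (π ▷ X)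
  unit_right : ∀ {Q : C} (π : Q ⟶ 𝟙_ C), IsCofibrant Q → trivialFibrations C π →
    ∀ X : C, IsCofibrant X → weakEquivalences C (X ◁ π)

end ModelCategories

end GrDG

end

noncomputable section

namespace GrDG

/-! ### Complete filtered modules and Cauchy sequences -/

section FilteredLinearAlgebra

variable {R : Type u} [CommRing R]
  {M : Type u} [AddCommGroup M] [Module R M] {F : ℕ → Submodule R M}
  {N : Type u} [AddCommGroup N] [Module R N] {G : ℕ → Submodule R N}

/-! The generators corepresent simple data. Since `d²` raises the weight, a map out of `Z0 R q n` is
an element of `F_q V` of degree `n`, and a map out of `Z1 R q n` is such an element whose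
differential lies in `F_{q+1} V`. Hence lifting against `genTrivCof` means that every `F_q V → F_q
W` is onto, which is strict surjectivity. Lifting against `genCof` means that an equation `f z = d a
+ b`, with `b` of weight `q + 1`, lifts to `z = d a' + b'`. This concerns cycles and boundaries of
the graded pieces, and `rlp_genCof` identifies it with strict surjectivity plus graded
quasi-isomorphism, by way of the acyclicity of the kernel.

The only other fact needed about the generators is that a map with the left lifting property against
strict surjections is a weak equivalence. `exists_deformation_retract` makes it a strong deformation
retract by lifting against a based path object. The small object argument and the retract argument
then give the model structure. Limits are formed degreewise. Colimits come from the adjoint functor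
theorem, with cofree objects as cogenerators. Completeness only involves countable sequences, so
`ℵ₁`-filtered colimits are formed degreewise, and the category is locally `ℵ₁`-presentable.

Cofree objects (`cofreeObj`) are right adjoint to forgetting `d`, and their maps to zero are trivial
fibrations. So a cofibration has a filtered linear retraction in each degree, and the universal
property of a pushout extends to filtered linear maps that ignore `d`. Over a field, strict
surjections have filtered sections, and kernels of trivial fibrations contract up to weight one
(`IsAcyclic.exists_contraction`). With such splittings the kernel of a pushout of a trivial
fibration along a cofibration is explicit, which gives left properness.

For the monoidal part, the completed tensor product has an internal hom, so the pushout-product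
axiom becomes a statement about pullback-homs. There, explicit formulas built from a retraction, a
deformation retraction or a fiber contraction give the surjectivity and the acyclicity. The unit
axiom holds for every object, because a filtered section and contraction of `Q → 𝟙` survive
tensoring. -/

theorem IsCompleteFilt.exists_limit {hF : Antitone F} (h : IsCompleteFilt hF) (s : ℕ → M)
    (hs : ∀ p, s (p + 1) - s p ∈ F p) : ∃ x, ∀ p, x - s p ∈ F p := by
  have key : ∀ p k, s (p + k) - s p ∈ F p := by
    intro p k
    induction k with
    | zero => simp
    | succ k ih =>
      have := add_mem (hF (Nat.le_add_right p k) (hs (p + k))) ih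
      rwa [sub_add_sub_cancel] at this
  obtain ⟨x, hx⟩ := h.2 ⟨fun p => (F p).mkQ (s p), fun p q hpq => by
    obtain ⟨k, rfl⟩ := Nat.exists_eq_add_of_le hpq
    exact (Submodule.Quotient.eq _).2 (key p k)⟩
  exact ⟨x, fun p => (Submodule.Quotient.eq _).1 (congrFun (congrArg Subtype.val hx) p)⟩

/-- An element of the limit is a compatible sequence of classes, and any choice of representatives
is Cauchy. With `IsCompleteFilt.exists_limit` this replaces quotients by sequences in all later
completeness proofs. -/
theorem isCompleteFilt_of {hF : Antitone F} (h₁ : ∀ x, (∀ p, x ∈ F p) → x = 0)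
    (h₂ : ∀ s : ℕ → M, (∀ p, s (p + 1) - s p ∈ F p) → ∃ x, ∀ p, x - s p ∈ F p) :
    IsCompleteFilt hF := by
  constructor
  · rw [injective_iff_map_eq_zero]
    intro x hx
    refine h₁ x fun p => ?_
    rw [← toCompl_mem (hF := hF), hx]
    exact zero_mem _
  · intro y
    choose s hs using fun p => (F p).mkQ_surjective (y.1 p)
    obtain ⟨x, hx⟩ := h₂ s fun p => by
      have h := y.2 p (p + 1) p.le_succ
      rw [← hs p, ← hs (p + 1), Submodule.factor_mk] at h
      exact (Submodule.Quotient.eq _).1 h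
    refine ⟨x, Subtype.ext (funext fun p => ?_)⟩
    rw [← hs p]
    exact (Submodule.Quotient.eq _).2 (hx p)

theorem IsCompleteFilt.eq_of_sub_mem {hF : Antitone F} (h : IsCompleteFilt hF) {x y : M}
    (hxy : ∀ p, x - y ∈ F p) : x = y := sub_eq_zero.1 (h.eq_zero hxy)

/-- The limit of a Cauchy sequence of linear maps into a complete module. -/
theorem IsCompleteFilt.exists_linearMap_limit {hG : Antitone G} (h : IsCompleteFilt hG) (c : ℕ)
    (t : ℕ → M →ₗ[R] N) (ht : ∀ p x, t (p + 1) x - t p x ∈ G (p + c)) :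
    ∃ l : M →ₗ[R] N, ∀ p x, l x - t p x ∈ G (p + c) := by
  have h' : ∀ x, ∃ y, ∀ p, y - t p x ∈ G (p + c) := fun x => by
    obtain ⟨y, hy⟩ := h.exists_limit (fun p => t p x) fun p => hG (Nat.le_add_right p c) (ht p x)
    refine ⟨y, fun p => ?_⟩
    have key : ∀ k, t (p + k) x - t p x ∈ G (p + c) := by
      intro k
      induction k with
      | zero => simp
      | succ k ih =>
        have := add_mem (hG (show p + c ≤ p + k + c by omega) (ht (p + k) x)) ih
        rwa [sub_add_sub_cancel] at this
    -- A bare limit only gives precision `p` at stage `p`. The missing `c` is recovered by passing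
    -- through stage `p + c`, which differs from stage `p` by weight `p + c`.
    have := add_mem (hy (p + c)) (key c)
    rwa [sub_add_sub_cancel] at this
  choose l hl using h'
  have hcl : ∀ p, G (p + c) ≤ G p := fun p => hG (Nat.le_add_right p c)
  refine ⟨{ toFun := l, map_add' := fun x y => ?_, map_smul' := fun a x => ?_ }, fun p x => hl x p⟩
  · refine h.eq_of_sub_mem fun p => hcl p ?_
    have := sub_mem (hl (x + y) p) (add_mem (hl x p) (hl y p))
    convert this using 1
    rw [map_add]
    abel
  · refine h.eq_of_sub_mem fun p => hcl p ?_
    have := sub_mem (hl (a • x) p) (Submodule.smul_mem _ a (hl x p))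
    convert this using 1
    rw [map_smul, smul_sub, RingHom.id_apply]
    abel

end FilteredLinearAlgebra

/-! ### Splittings of filtrations over a field -/

section FieldLinearAlgebra

variable {R : Type u} [Field R]
  {M : Type u} [AddCommGroup M] [Module R M] {F : ℕ → Submodule R M}
  {N : Type u} [AddCommGroup N] [Module R N] {G : ℕ → Submodule R N}

theorem exists_projection (S : Submodule R M) :
    ∃ r : M →ₗ[R] M, (∀ x, r x ∈ S) ∧ ∀ x ∈ S, r x = x := by
  obtain ⟨g, hg⟩ := S.subtype.exists_leftInverse_of_injective S.ker_subtype
  exact ⟨S.subtype ∘ₗ g, fun x => (g x).2, fun x hx =>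
    congrArg Subtype.val (LinearMap.congr_fun hg ⟨x, hx⟩)⟩

/-- A filtration of a vector space splits. -/
theorem exists_splitting (hF : Antitone F) (h0 : F 0 = ⊤) :
    ∃ e : ℕ → M →ₗ[R] M, (∀ p x, e p x ∈ F p) ∧ (∀ p x, x ∈ F (p + 1) → e p x = 0) ∧
      ∀ p x, x - ∑ q ∈ Finset.range p, e q x ∈ F p := by
  -- The component `e p` is the difference of projections onto `F p` and `F (p + 1)`. Its partial
  -- sums telescope to `1 - r p`, because `r 0` is the identity.
  choose r hr hr' using fun p => exists_projection (F p)
  have hr0 : ∀ x, r 0 x = x := fun x => hr' 0 x (by rw [h0]; trivial)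
  have hsum : ∀ p x, ∑ q ∈ Finset.range p, (r q - r (q + 1)) x = x - r p x := by
    intro p x
    induction p with
    | zero => simp [hr0]
    | succ p ih => rw [Finset.sum_range_succ, ih, LinearMap.sub_apply, sub_add_sub_cancel]
  refine ⟨fun p => r p - r (p + 1), fun p x => sub_mem (hr p x) (hF p.le_succ (hr (p + 1) x)),
    fun p x hx => ?_, fun p x => ?_⟩
  · rw [LinearMap.sub_apply, hr' p x (hF p.le_succ hx), hr' (p + 1) x hx, sub_self]
  · rw [hsum, sub_sub_cancel]
    exact hr p x

/-- Maps defined on the pieces of a filtration glue to a filtered map. -/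
theorem exists_filtered_sum (hF : Antitone F) {hG : Antitone G}
    (hc : IsCompleteFilt hG) (c : ℕ) (e : ℕ → M →ₗ[R] M) (he : ∀ p x, e p x ∈ F p)
    (he' : ∀ p x, x ∈ F (p + 1) → e p x = 0) (t : ℕ → M →ₗ[R] N)
    (ht : ∀ p x, x ∈ F p → t p x ∈ G (p + c)) :
    ∃ l : M →ₗ[R] N, (∀ p x, x ∈ F p → l x ∈ G (p + c)) ∧
      ∀ p x, l x - ∑ q ∈ Finset.range p, t q (e q x) ∈ G (p + c) := by
  obtain ⟨l, hl⟩ := hc.exists_linearMap_limit c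
    (fun p => ∑ q ∈ Finset.range p, t q ∘ₗ e q) (fun p x => by
      rw [Finset.sum_range_succ, LinearMap.add_apply, add_sub_cancel_left]
      exact ht p _ (he p x))
  have hl' : ∀ p x, l x - ∑ q ∈ Finset.range p, t q (e q x) ∈ G (p + c) := fun p x => by
    have := hl p x
    rwa [LinearMap.sum_apply] at this
  refine ⟨l, fun p x hx => ?_, hl'⟩
  have := hl' p x
  -- On `F p` the partial sum vanishes: for `q < p`, the map `e q` kills `F (q + 1) ⊇ F p`.
  rwa [Finset.sum_eq_zero, sub_zero] at this
  intro q hq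
  rw [he' q x (hF (Finset.mem_range.1 hq) hx), map_zero]

/-- Each `t p` matters only through the map it induces on the `p`-th graded piece. Splitting the
source glues these induced maps into one filtered map. -/
theorem exists_filtered_approx (hF : Antitone F) (h0 : F 0 = ⊤) {hG : Antitone G}
    (hc : IsCompleteFilt hG) (t : ℕ → M →ₗ[R] N)
    (ht : ∀ p x, x ∈ F p → t p x ∈ G p) (ht' : ∀ p x, x ∈ F (p + 1) → t p x ∈ G (p + 1)) :
    ∃ l : M →ₗ[R] N, (∀ p x, x ∈ F p → l x ∈ G p) ∧
      ∀ p x, x ∈ F p → l x - t p x ∈ G (p + 1) := by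
  obtain ⟨e, he, he', hes⟩ := exists_splitting hF h0
  obtain ⟨l, hl, hl'⟩ := exists_filtered_sum hF hc 0 e he he' t ht
  refine ⟨l, hl, fun p x hx => ?_⟩
  have h1 := hl' (p + 1) x
  have h2 := hes (p + 1) x
  have hz : ∀ q ∈ Finset.range p, e q x = 0 := fun q hq =>
    he' q x (hF (Finset.mem_range.1 hq) hx)
  rw [Finset.sum_range_succ, Finset.sum_eq_zero hz, zero_add] at h2
  rw [Finset.sum_range_succ, Finset.sum_eq_zero (fun q hq => by rw [hz q hq, map_zero]),
    zero_add] at h1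
  have := sub_mem h1 (ht' p _ h2)
  convert this using 1
  rw [map_sub]
  abel

/-- Filtered maps lift along strict surjections. -/
theorem exists_filtered_lift {P : Type u} [AddCommGroup P] [Module R P] {H : ℕ → Submodule R P}
    (hF : Antitone F) (h0 : F 0 = ⊤) {hG : Antitone G} (hc : IsCompleteFilt hG)
    {hH : Antitone H} (hcH : IsCompleteFilt hH) (f : N →ₗ[R] P)
    (hf : ∀ p x, x ∈ G p → f x ∈ H p) (hs : ∀ p y, y ∈ H p → ∃ x ∈ G p, f x = y) (c : ℕ)
    (g : M →ₗ[R] P) (hg : ∀ p x, x ∈ F p → g x ∈ H (p + c)) :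
    ∃ l : M →ₗ[R] N, (∀ p x, x ∈ F p → l x ∈ G (p + c)) ∧ ∀ x, f (l x) = g x := by
  obtain ⟨e, he, he', hes⟩ := exists_splitting hF h0
  have ht : ∀ p, ∃ t : M →ₗ[R] N, ∀ x, x ∈ F p → t x ∈ G (p + c) ∧ f (t x) = g x := by
    intro p
    obtain ⟨s, hs'⟩ := (f.restrict (hf (p + c))).exists_rightInverse_of_surjective
      (LinearMap.range_eq_top.2 fun y => by
        obtain ⟨x, hx, hxy⟩ := hs _ _ y.2
        exact ⟨⟨x, hx⟩, Subtype.ext hxy⟩)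
    obtain ⟨t, ht⟩ := LinearMap.exists_extend
      ((G (p + c)).subtype ∘ₗ s ∘ₗ g.restrict (hg p))
    refine ⟨t, fun x hx => ?_⟩
    have h1 : t x = s (g.restrict (hg p) ⟨x, hx⟩) := LinearMap.congr_fun ht ⟨x, hx⟩
    rw [h1]
    exact ⟨Subtype.prop _, congrArg Subtype.val (LinearMap.congr_fun hs' _)⟩
  choose t ht using ht
  obtain ⟨l, hl, hl'⟩ := exists_filtered_sum hF hc c e he he' t fun p x hx => (ht p x hx).1
  -- Modulo `H (p + c)`, both `f (l x)` and `g x` equal the partial sum of the `g (e q x)`.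
  -- Separatedness of the target concludes.
  refine ⟨l, hl, fun x => hcH.eq_of_sub_mem fun p => hH (Nat.le_add_right p c) ?_⟩
  have h1 := hf _ _ (hl' p x)
  have h2 := hg p _ (hes p x)
  rw [map_sub, map_sum] at h1 h2
  rw [Finset.sum_congr rfl fun q _ => (ht q _ (he q x)).2] at h1
  have := sub_mem h1 h2
  rwa [sub_sub_sub_cancel_right] at this

/-- A linear choice of approximate preimages. -/
theorem exists_linear_preimage (D : N →ₗ[R] M) (S : Submodule R N) (Z E : Submodule R M)
    (h : ∀ z ∈ Z, ∃ a ∈ S, z - D a ∈ E) :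
    ∃ t : M →ₗ[R] N, (∀ z ∈ Z, t z ∈ S ∧ z - D (t z) ∈ E) ∧ ∀ z ∈ E, t z = 0 := by
  -- The choice is made on `M ⧸ E`, not on `M`, so that the resulting map kills `E`. The contraction
  -- below relies on this.
  set f : S →ₗ[R] M ⧸ E := E.mkQ ∘ₗ D ∘ₗ S.subtype with hf
  obtain ⟨s, hs⟩ := f.rangeRestrict.exists_rightInverse_of_surjective f.range_rangeRestrict
  obtain ⟨v, hv⟩ := LinearMap.exists_extend s
  refine ⟨S.subtype ∘ₗ v ∘ₗ E.mkQ, fun z hz => ⟨Subtype.prop _, ?_⟩, fun z hz => ?_⟩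
  · obtain ⟨a, ha, haz⟩ := h z hz
    have hfa : f ⟨a, ha⟩ = E.mkQ z := ((Submodule.Quotient.eq _).2 haz).symm
    have hz' : E.mkQ z ∈ LinearMap.range f := ⟨_, hfa⟩
    have h1 : v (E.mkQ z) = s ⟨_, hz'⟩ := LinearMap.congr_fun hv ⟨_, hz'⟩
    have h2 : f (s ⟨_, hz'⟩) = E.mkQ z := congrArg Subtype.val (LinearMap.congr_fun hs ⟨_, hz'⟩)
    refine (Submodule.Quotient.eq _).1 ?_
    rw [LinearMap.comp_apply, LinearMap.comp_apply, h1]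
    exact h2.symm
  · rw [LinearMap.comp_apply, LinearMap.comp_apply,
      show E.mkQ z = 0 from (Submodule.Quotient.mk_eq_zero _).2 hz, map_zero, map_zero]

end FieldLinearAlgebra

end GrDG

/-! ### Quasi-isomorphisms of module complexes by elements -/

section QuasiIso

variable {R : Type u} [Ring R] {S T : ShortComplex (ModuleCat.{u} R)}

/-- With homology modelled as cycles modulo boundaries, the induced map is the explicit `h`. The two
clauses are its injectivity and surjectivity on representatives. -/
theorem moduleCat_quasiIso_iff (φ : S ⟶ T) : ShortComplex.QuasiIso φ ↔
    (∀ x, S.g x = 0 → (∃ y, T.f y = φ.τ₂ x) → ∃ y, S.f y = x) ∧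
      ∀ x, T.g x = 0 → ∃ z, S.g z = 0 ∧ ∃ y, T.f y = x - φ.τ₂ z := by
  have hg : ∀ x, T.g (φ.τ₂ x) = φ.τ₃ (S.g x) := fun x =>
    (ConcreteCategory.congr_hom φ.comm₂₃ x)
  have hf : ∀ x, T.f (φ.τ₁ x) = φ.τ₂ (S.f x) := fun x =>
    (ConcreteCategory.congr_hom φ.comm₁₂ x)
  let k : LinearMap.ker S.g.hom →ₗ[R] LinearMap.ker T.g.hom :=
    φ.τ₂.hom.restrict (p := LinearMap.ker S.g.hom) (q := LinearMap.ker T.g.hom) fun x hx => by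
      rw [LinearMap.mem_ker] at hx ⊢
      exact (hg x).trans (by rw [show S.g x = 0 from hx, map_zero])
  let h : (LinearMap.ker S.g.hom ⧸ LinearMap.range S.moduleCatToCycles) →ₗ[R]
      (LinearMap.ker T.g.hom ⧸ LinearMap.range T.moduleCatToCycles) :=
    Submodule.mapQ _ _ k (by
      rintro _ ⟨y, rfl⟩
      exact ⟨φ.τ₁ y, Subtype.ext (hf y)⟩)
  let γ : ShortComplex.LeftHomologyMapData φ S.moduleCatLeftHomologyData
      T.moduleCatLeftHomologyData :=
    { φK := ModuleCat.ofHom k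
      φH := ModuleCat.ofHom h
      commi := rfl
      commf' := by
        ext x
        exact Subtype.ext (hf x).symm
      commπ := rfl }
  rw [γ.quasiIso_iff, ConcreteCategory.isIso_iff_bijective]
  change Function.Bijective h ↔ _
  refine and_congr ?_ ?_
  · rw [injective_iff_map_eq_zero]
    constructor
    · rintro H x hx ⟨y, hy⟩
      have h1 := H ((LinearMap.range S.moduleCatToCycles).mkQ ⟨x, hx⟩)
        ((Submodule.Quotient.mk_eq_zero _).2 ⟨y, Subtype.ext hy⟩)
      obtain ⟨z, hz⟩ := (Submodule.Quotient.mk_eq_zero _).1 h1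
      exact ⟨z, congrArg Subtype.val hz⟩
    · intro H x hx
      obtain ⟨⟨x, hx'⟩, rfl⟩ := Submodule.mkQ_surjective _ x
      obtain ⟨y, hy⟩ := (Submodule.Quotient.mk_eq_zero _).1 hx
      obtain ⟨z, hz⟩ := H x hx' ⟨y, congrArg Subtype.val hy⟩
      exact (Submodule.Quotient.mk_eq_zero _).2 ⟨z, Subtype.ext hz⟩
  · constructor
    · intro H x hx
      obtain ⟨z, hz⟩ := H ((LinearMap.range T.moduleCatToCycles).mkQ ⟨x, hx⟩)
      obtain ⟨⟨z, hz'⟩, rfl⟩ := Submodule.mkQ_surjective _ z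
      obtain ⟨y, hy⟩ := (Submodule.Quotient.eq _).1 hz.symm
      exact ⟨z, hz', y, congrArg Subtype.val hy⟩
    · intro H x
      obtain ⟨⟨x, hx⟩, rfl⟩ := Submodule.mkQ_surjective _ x
      obtain ⟨z, hz, y, hy⟩ := H x hx
      refine ⟨(LinearMap.range S.moduleCatToCycles).mkQ ⟨z, hz⟩, Eq.symm ?_⟩
      exact (Submodule.Quotient.eq _).2 ⟨y, Subtype.ext hy⟩

theorem chainComplex_quasiIso_iff {K L : ChainComplex (ModuleCat.{u} R) ℤ} (f : K ⟶ L) :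
    QuasiIso f ↔ ∀ m n l : ℤ, n + 1 = m → l + 1 = n →
      (∀ x, K.d n l x = 0 → (∃ y, L.d m n y = f.f n x) → ∃ y, K.d m n y = x) ∧
        ∀ x, L.d n l x = 0 → ∃ z, K.d n l z = 0 ∧ ∃ y, L.d m n y = x - f.f n z := by
  rw [quasiIso_iff]
  constructor
  · rintro H m n l hm hl
    have := H n
    rw [quasiIsoAt_iff' f m n l (ComplexShape.prev_eq' _ (by simpa using hm))
      (ComplexShape.next_eq' _ (by simpa using hl))] at this
    exact (moduleCat_quasiIso_iff _).1 this
  · intro H n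
    rw [quasiIsoAt_iff' f (n + 1) n (n - 1) (ComplexShape.prev_eq' _ (by simp))
      (ComplexShape.next_eq' _ (by simp))]
    exact (moduleCat_quasiIso_iff _).2 (H (n + 1) n (n - 1) rfl (by omega))

end QuasiIso

namespace GrDG

open FiltGrDGMod

/-! ### Representatives in the associated graded complexes -/

namespace CompleteGrDGMod

variable {R : Type u} [CommRing R] {V W T : CompleteGrDGMod R}

theorem f_F (f : V ⟶ W) {i : ℤ} {p : ℕ} {x : V.obj.X i} (hx : x ∈ V.obj.F i p) :
    hf f i x ∈ W.obj.F i p := f.hom.f_F i p x hx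

theorem f_d (f : V ⟶ W) (i j : ℤ) (x : V.obj.X i) :
    hf f j (V.obj.d i j x) = W.obj.d i j (hf f i x) := f.hom.f_d i j x

theorem d_mem {i j : ℤ} {p : ℕ} {x : V.obj.X i} (hx : x ∈ V.obj.F i p) :
    V.obj.d i j x ∈ V.obj.F j p := V.obj.d_F i j p x hx

theorem d_d_mem {i j k : ℤ} {p : ℕ} {x : V.obj.X i} (hx : x ∈ V.obj.F i p) :
    V.obj.d j k (V.obj.d i j x) ∈ V.obj.F k (p + 1) := V.obj.d_d i j k p x hx

theorem F_succ_le {i : ℤ} {p : ℕ} {x : V.obj.X i} (hx : x ∈ V.obj.F i (p + 1)) :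
    x ∈ V.obj.F i p := V.obj.F_anti i p.le_succ hx

/-- The class in `F_p V / F_{p+1} V` of an element of `F_p V`. -/
def grMk (V : CompleteGrDGMod R) (p : ℕ) (n : ℤ) (v : V.obj.X n) (hv : v ∈ V.obj.F n p) :
    ((gr p).obj V.obj).X n :=
  Submodule.mkQ ((V.obj.F n (p + 1)).submoduleOf (V.obj.F n p)) ⟨v, hv⟩

theorem grMk_surjective (p : ℕ) (n : ℤ) (x : ((gr p).obj V.obj).X n) :
    ∃ v hv, grMk V p n v hv = x := by
  obtain ⟨⟨v, hv⟩, rfl⟩ := Submodule.mkQ_surjective _ x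
  exact ⟨v, hv, rfl⟩

theorem grMk_eq_zero {p : ℕ} {n : ℤ} {v : V.obj.X n} (hv : v ∈ V.obj.F n p) :
    grMk V p n v hv = 0 ↔ v ∈ V.obj.F n (p + 1) :=
  Submodule.Quotient.mk_eq_zero _

theorem grMk_eq {p : ℕ} {n : ℤ} {v w : V.obj.X n} (hv : v ∈ V.obj.F n p) (hw : w ∈ V.obj.F n p) :
    grMk V p n v hv = grMk V p n w hw ↔ v - w ∈ V.obj.F n (p + 1) :=
  Submodule.Quotient.eq _

theorem grMk_sub {p : ℕ} {n : ℤ} {v w : V.obj.X n} (hv : v ∈ V.obj.F n p)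
    (hw : w ∈ V.obj.F n p) :
    grMk V p n v hv - grMk V p n w hw = grMk V p n (v - w) (sub_mem hv hw) := rfl

theorem gr_d_grMk {p : ℕ} {n : ℤ} (l : ℤ) {v : V.obj.X n} (hv : v ∈ V.obj.F n p) :
    ((gr p).obj V.obj).d n l (grMk V p n v hv) = grMk V p l (V.obj.d n l v) (d_mem hv) := rfl

theorem gr_map_grMk (f : V ⟶ W) {p : ℕ} {n : ℤ} {v : V.obj.X n} (hv : v ∈ V.obj.F n p) :
    ((gr p).map f.hom).f n (grMk V p n v hv) = grMk W p n (hf f n v) (f_F f hv) := rfl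

/-- Injectivity and surjectivity on the homology of the associated graded complexes, in terms of
representatives. -/
theorem gradedQuasiIso_iff (f : V ⟶ W) : gradedQuasiIso R f ↔
    ∀ (p : ℕ) (m n l : ℤ), n + 1 = m → l + 1 = n →
      (∀ v ∈ V.obj.F n p, V.obj.d n l v ∈ V.obj.F l (p + 1) →
        (∃ a ∈ W.obj.F m p, hf f n v - W.obj.d m n a ∈ W.obj.F n (p + 1)) →
          ∃ a ∈ V.obj.F m p, v - V.obj.d m n a ∈ V.obj.F n (p + 1)) ∧
      ∀ w ∈ W.obj.F n p, W.obj.d n l w ∈ W.obj.F l (p + 1) →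
        ∃ v ∈ V.obj.F n p, V.obj.d n l v ∈ V.obj.F l (p + 1) ∧
          ∃ a ∈ W.obj.F m p, w - hf f n v - W.obj.d m n a ∈ W.obj.F n (p + 1) := by
  refine forall_congr' fun p => (chainComplex_quasiIso_iff _).trans ?_
  refine forall_congr' fun m => forall_congr' fun n => forall_congr' fun l =>
    forall_congr' fun hm => forall_congr' fun hl => and_congr ?_ ?_
  · constructor
    · rintro H v hv hdv ⟨a, ha, hfa⟩
      obtain ⟨y, hy⟩ := H (grMk V p n v hv) (by rwa [gr_d_grMk, grMk_eq_zero])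
        ⟨grMk W p m a ha, by rw [gr_d_grMk, gr_map_grMk, eq_comm, grMk_eq]; exact hfa⟩
      obtain ⟨y, hy', rfl⟩ := grMk_surjective _ _ y
      rw [gr_d_grMk, eq_comm, grMk_eq] at hy
      exact ⟨y, hy', hy⟩
    · rintro H x hx ⟨y, hy⟩
      obtain ⟨x, hx', rfl⟩ := grMk_surjective _ _ x
      obtain ⟨y, hy', rfl⟩ := grMk_surjective _ _ y
      rw [gr_d_grMk, grMk_eq_zero] at hx
      rw [gr_d_grMk, gr_map_grMk, eq_comm, grMk_eq] at hy
      obtain ⟨a, ha, hva⟩ := H x hx' hx ⟨y, hy', hy⟩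
      exact ⟨grMk V p m a ha, by rwa [gr_d_grMk, eq_comm, grMk_eq]⟩
  · constructor
    · intro H w hw hdw
      obtain ⟨z, hz, y, hy⟩ := H (grMk W p n w hw) (by rwa [gr_d_grMk, grMk_eq_zero])
      obtain ⟨z, hz', rfl⟩ := grMk_surjective _ _ z
      obtain ⟨y, hy', rfl⟩ := grMk_surjective _ _ y
      rw [gr_d_grMk, grMk_eq_zero] at hz
      rw [gr_d_grMk, gr_map_grMk, grMk_sub, eq_comm, grMk_eq] at hy
      exact ⟨z, hz', hz, y, hy', hy⟩
    · intro H x hx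
      obtain ⟨x, hx', rfl⟩ := grMk_surjective _ _ x
      rw [gr_d_grMk, grMk_eq_zero] at hx
      obtain ⟨v, hv, hdv, a, ha, hva⟩ := H x hx' hx
      exact ⟨grMk V p n v hv, by rwa [gr_d_grMk, grMk_eq_zero], grMk W p m a ha,
        by rwa [gr_d_grMk, gr_map_grMk, grMk_sub, eq_comm, grMk_eq]⟩

/-! ### Iterated predifferentials and maps out of the generators -/

variable (V)

/-- The `k`-fold composition of predifferentials from degree `n` to degree `m = n - k`. -/
def dPow (n : ℤ) : ℕ → ∀ m : ℤ, V.obj.X n →ₗ[R] V.obj.X m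
  | 0, m => castX V n m
  | k + 1, m => V.obj.d (m + 1) m ∘ₗ dPow n k (m + 1)

/-- The iterated predifferential from degree `n` to degree `m`, zero unless `m ≤ n`. -/
def iterD (n m : ℤ) : V.obj.X n →ₗ[R] V.obj.X m :=
  if m ≤ n then dPow V n (n - m).toNat m else 0

variable {V}

theorem iterD_self (n : ℤ) (v : V.obj.X n) : iterD V n n v = v := by
  rw [iterD, if_pos le_rfl, sub_self]
  exact castX_self V n v

theorem iterD_of_lt {n m : ℤ} (h : n < m) (v : V.obj.X n) : iterD V n m v = 0 := by
  rw [iterD, if_neg (not_le.2 h), LinearMap.zero_apply]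

theorem d_iterD {n m l : ℤ} (hl : l + 1 = m) (hm : m ≤ n) (v : V.obj.X n) :
    V.obj.d m l (iterD V n m v) = iterD V n l v := by
  subst hl
  rw [iterD, iterD, if_pos hm, if_pos (by omega),
    show (n - l).toNat = (n - (l + 1)).toNat + 1 by omega]
  rfl

theorem iterD_d {n n' : ℤ} (hn : n' + 1 = n) {m : ℤ} (hm : m ≤ n') (v : V.obj.X n) :
    iterD V n' m (V.obj.d n n' v) = iterD V n m v := by
  induction m, hm using Int.leInductionDown with
  | base => rw [iterD_self, ← d_iterD hn le_rfl, iterD_self]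
  | pred m hm ih =>
    rw [← d_iterD (sub_add_cancel m 1) hm, ih, d_iterD (sub_add_cancel m 1) (by omega)]

/-- Each pair of consecutive predifferentials gains one unit of weight, and a leftover one gains
none. This explains the weights `⌊k/2⌋` of the towers. -/
theorem iterD_mem {n m : ℤ} {p : ℕ} {v : V.obj.X n} (hv : v ∈ V.obj.F n p) :
    iterD V n m v ∈ V.obj.F m (p + (n - m).toNat / 2) := by
  have key : ∀ (k : ℕ) (m : ℤ), m + 2 * k = n → iterD V n m v ∈ V.obj.F m (p + k) := by
    intro k
    induction k with
    | zero =>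
      intro m hm
      obtain rfl : m = n := by simpa using hm
      rwa [iterD_self]
    | succ k ih =>
      intro m hm
      push_cast at hm
      rw [← d_iterD (m := m + 1) rfl (by omega), ← d_iterD (m := m + 1 + 1) rfl (by omega)]
      exact d_d_mem (ih (m + 1 + 1) (by omega))
  rcases lt_or_ge n m with h | h
  · rw [iterD_of_lt h]
    exact zero_mem _
  · obtain ⟨k, rfl⟩ : ∃ k : ℕ, n = m + k := ⟨(n - m).toNat, by omega⟩
    rw [show (m + (k : ℤ) - m).toNat = k by omega]
    rcases Nat.even_or_odd' k with ⟨c, rfl | rfl⟩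
    · rw [show 2 * c / 2 = c by omega]
      exact key c m (by push_cast; ring)
    · rw [show (2 * c + 1) / 2 = c by omega, ← d_iterD (m := m + 1) rfl (by push_cast; omega)]
      exact d_mem (key c (m + 1) (by push_cast; ring))

theorem f_iterD (f : V ⟶ W) (n m : ℤ) (v : V.obj.X n) :
    hf f m (iterD V n m v) = iterD W n m (hf f n v) := by
  rcases lt_or_ge n m with h | h
  · rw [iterD_of_lt h, iterD_of_lt h, map_zero]
  · induction m, h using Int.leInductionDown with
    | base => rw [iterD_self, iterD_self]
    | pred m hm ih =>
      rw [← d_iterD (sub_add_cancel m 1) hm, ← d_iterD (sub_add_cancel m 1) hm, f_d, ih]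

section Tower

variable {n : ℤ} {w : ℕ → ℕ} {h₁ : ∀ k, w k ≤ w (k + 1)} {h₂ : ∀ k, w k + 1 ≤ w (k + 2)}

/-- The generator of a tower. -/
def towerGen : (tower R n w h₁ h₂).obj.X n := ⟨1, fun h => absurd h (lt_irrefl n)⟩

theorem towerGen_mem : (towerGen : (tower R n w h₁ h₂).obj.X n) ∈
    (tower R n w h₁ h₂).obj.F n (w 0) := fun h => by
  rw [sub_self] at h
  exact absurd h (lt_irrefl _)

/-- The coefficient in `R` of an element of a tower. -/
def towerCoe (m : ℤ) : (tower R n w h₁ h₂).obj.X m →ₗ[R] R := Submodule.subtype _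

theorem towerCoe_injective (m : ℤ) :
    Function.Injective (towerCoe m : (tower R n w h₁ h₂).obj.X m →ₗ[R] R) :=
  Subtype.val_injective

theorem towerCoe_gen : towerCoe n (towerGen : (tower R n w h₁ h₂).obj.X n) = 1 := rfl

theorem towerCoe_of_lt {m : ℤ} (h : n < m) (x : (tower R n w h₁ h₂).obj.X m) :
    towerCoe m x = 0 := x.2 h

theorem towerCoe_of_mem {m : ℤ} {p : ℕ} {x : (tower R n w h₁ h₂).obj.X m}
    (hx : x ∈ (tower R n w h₁ h₂).obj.F m p) (hp : w (n - m).toNat < p) : towerCoe m x = 0 :=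
  congrArg Subtype.val (hx hp)

theorem towerCoe_d {i j : ℤ} (h : j + 1 = i) (x : (tower R n w h₁ h₂).obj.X i) :
    towerCoe j ((tower R n w h₁ h₂).obj.d i j x) = towerCoe i x := by
  have : (tower R n w h₁ h₂).obj.d i j = Submodule.inclusion _ := dif_pos h
  rw [this]
  rfl

theorem towerCoe_iterD_gen {m : ℤ} (hm : m ≤ n) :
    towerCoe m (iterD (tower R n w h₁ h₂) n m towerGen) = 1 := by
  induction m, hm using Int.leInductionDown with
  | base => rw [iterD_self, towerCoe_gen]
  | pred m hm ih =>
    rw [← d_iterD (sub_add_cancel m 1) hm, towerCoe_d (sub_add_cancel m 1), ih]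

/-- The morphism out of a tower that sends the generator to a given element. -/
def towerDesc (v : V.obj.X n) (hv : ∀ k m, m + (k : ℕ) = n → iterD V n m v ∈ V.obj.F m (w k)) :
    tower R n w h₁ h₂ ⟶ V := ObjectProperty.homMk
  { f := fun m => (LinearMap.toSpanSingleton R _ (iterD V n m v)) ∘ₗ towerCoe m
    f_F := fun m p x hx => by
      rw [LinearMap.comp_apply, LinearMap.toSpanSingleton_apply]
      rcases lt_or_ge n m with h | h
      · rw [towerCoe_of_lt h, zero_smul]
        exact zero_mem _
      · by_cases hp : w (n - m).toNat < p
        · rw [towerCoe_of_mem hx hp, zero_smul]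
          exact zero_mem _
        · exact Submodule.smul_mem _ _ (V.obj.F_anti m (not_lt.1 hp) (hv _ _ (by omega)))
    f_d := fun i j x => by
      rw [LinearMap.comp_apply, LinearMap.toSpanSingleton_apply, LinearMap.comp_apply,
        LinearMap.toSpanSingleton_apply]
      by_cases h : j + 1 = i
      · rw [towerCoe_d h, map_smul]
        rcases lt_or_ge n i with h' | h'
        · rw [towerCoe_of_lt h', zero_smul, zero_smul]
        · rw [d_iterD h h']
      · rw [FiltGrDGMod.d_shape _ _ _ h, FiltGrDGMod.d_shape _ _ _ h, LinearMap.zero_apply,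
          LinearMap.zero_apply, map_zero, zero_smul] }

theorem towerDesc_gen (v : V.obj.X n)
    (hv : ∀ k m, m + (k : ℕ) = n → iterD V n m v ∈ V.obj.F m (w k)) :
    hf (towerDesc v hv : tower R n w h₁ h₂ ⟶ V) n towerGen = v := by
  change towerCoe n (towerGen : (tower R n w h₁ h₂).obj.X n) • iterD V n n v = v
  rw [towerCoe_gen, one_smul, iterD_self]

/-- In degree `m ≤ n` a tower is spanned by the iterated differential of its generator, and
morphisms commute with `iterD`. -/
theorem tower_ext {f g : tower R n w h₁ h₂ ⟶ V} (h : hf f n towerGen = hf g n towerGen) :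
    f = g := by
  refine hom_ext' fun m x => ?_
  rcases lt_or_ge n m with hm | hm
  · obtain rfl : x = 0 := towerCoe_injective m (by rw [towerCoe_of_lt hm, map_zero])
    rw [map_zero, map_zero]
  · have : x = towerCoe m x • iterD _ n m towerGen := towerCoe_injective m (by
      rw [map_smul, towerCoe_iterD_gen hm, smul_eq_mul, mul_one])
    rw [this, map_smul, map_smul, f_iterD, f_iterD, h]

end Tower

/-- The generator of `𝒵^{0,∞}_{q,n}`. -/
def Z0gen (q : ℕ) (n : ℤ) : (Z0 R q n).obj.X n := towerGen

theorem Z0gen_mem (q : ℕ) (n : ℤ) : Z0gen q n ∈ (Z0 R q n).obj.F n q := towerGen_mem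

/-- The morphism `𝒵^{0,∞}_{q,n} → V` given by an element of `F_q V` of degree `n`. -/
def Z0desc {q : ℕ} {n : ℤ} (v : V.obj.X n) (hv : v ∈ V.obj.F n q) : Z0 R q n ⟶ V :=
  towerDesc v fun k m hm => by
    have := iterD_mem (m := m) hv
    rwa [show (n - m).toNat = k by omega] at this

theorem Z0desc_gen {q : ℕ} {n : ℤ} (v : V.obj.X n) (hv : v ∈ V.obj.F n q) :
    hf (Z0desc v hv) n (Z0gen q n) = v := towerDesc_gen v _

theorem Z0_ext {q : ℕ} {n : ℤ} {f g : Z0 R q n ⟶ V}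
    (h : hf f n (Z0gen q n) = hf g n (Z0gen q n)) : f = g := tower_ext h

/-- The generator of `𝒵^{1,∞}_{q,n}`. -/
def Z1gen (q : ℕ) (n : ℤ) : (Z1 R q n).obj.X n := towerGen

theorem Z1gen_mem (q : ℕ) (n : ℤ) : Z1gen q n ∈ (Z1 R q n).obj.F n q := towerGen_mem

theorem d_Z1gen_mem (q : ℕ) {n l : ℤ} (hl : l + 1 = n) :
    (Z1 R q n).obj.d n l (Z1gen q n) ∈ (Z1 R q n).obj.F l (q + 1) := fun h => by
  rw [show (n - l).toNat = 1 by omega] at h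
  exact absurd h (lt_irrefl _)

/-- The morphism `𝒵^{1,∞}_{q,n} → V` given by `v ∈ F_q V` of degree `n` with `d v ∈ F_{q+1} V`. -/
def Z1desc {q : ℕ} {n l : ℤ} (hl : l + 1 = n) (v : V.obj.X n) (hv : v ∈ V.obj.F n q)
    (hdv : V.obj.d n l v ∈ V.obj.F l (q + 1)) : Z1 R q n ⟶ V :=
  towerDesc v fun k m hm => by
    rcases k with _ | k
    · obtain rfl : m = n := by simpa using hm
      rwa [iterD_self]
    · push_cast at hm
      -- Iteration starts from `d v`, already of weight `q + 1`. After `k` more steps the weight is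
      -- `q + 1 + ⌊k/2⌋`, which is `q + ⌈(k+1)/2⌉`.
      rw [← iterD_d hl (by omega)]
      have := iterD_mem (m := m) hdv
      rw [show (l - m).toNat = k by omega] at this
      exact V.obj.F_anti m (by omega) this

theorem Z1desc_gen {q : ℕ} {n l : ℤ} (hl : l + 1 = n) (v : V.obj.X n) (hv : v ∈ V.obj.F n q)
    (hdv : V.obj.d n l v ∈ V.obj.F l (q + 1)) : hf (Z1desc hl v hv hdv) n (Z1gen q n) = v :=
  towerDesc_gen v _

theorem Z1_ext {q : ℕ} {n : ℤ} {f g : Z1 R q n ⟶ V}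
    (h : hf f n (Z1gen q n) = hf g n (Z1gen q n)) : f = g := tower_ext h

/-- The morphism out of a direct sum. -/
def directSumDesc (f : V ⟶ T) (g : W ⟶ T) : directSum V W ⟶ T := ObjectProperty.homMk
  { f := fun m => (hf f m).coprod (hf g m)
    f_F := fun m p x hx => add_mem (f_F f hx.1) (f_F g hx.2)
    f_d := fun i j x => by
      change hf f j (V.obj.d i j x.1) + hf g j (W.obj.d i j x.2) =
        T.obj.d i j (hf f i x.1 + hf g i x.2)
      rw [map_add, f_d, f_d] }

variable (V W)

/-- The first inclusion into a direct sum. -/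
def directSumInl : V ⟶ directSum V W := ObjectProperty.homMk
  { f := fun _ => LinearMap.inl R _ _
    f_F := fun _ _ _ hx => ⟨hx, zero_mem _⟩
    f_d := fun i j _ => Prod.ext rfl (map_zero (W.obj.d i j)).symm }

/-- The second inclusion into a direct sum. -/
def directSumInr : W ⟶ directSum V W := ObjectProperty.homMk
  { f := fun _ => LinearMap.inr R _ _
    f_F := fun _ _ _ hx => ⟨zero_mem _, hx⟩
    f_d := fun i j _ => Prod.ext (map_zero (V.obj.d i j)).symm rfl }

variable {V W}

theorem directSumInl_desc (f : V ⟶ T) (g : W ⟶ T) :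
    directSumInl V W ≫ directSumDesc f g = f :=
  hom_ext' fun i x => by
    change hf f i x + hf g i 0 = _
    rw [map_zero, add_zero]

theorem directSumInr_desc (f : V ⟶ T) (g : W ⟶ T) :
    directSumInr V W ≫ directSumDesc f g = g :=
  hom_ext' fun i x => by
    change hf f i 0 + hf g i x = _
    rw [map_zero, zero_add]

theorem directSum_ext {f g : directSum V W ⟶ T} (h : directSumInl V W ≫ f = directSumInl V W ≫ g)
    (h' : directSumInr V W ≫ f = directSumInr V W ≫ g) : f = g := by
  refine hom_ext' fun i x => ?_
  have hx : x = hf (directSumInl V W) i x.1 + hf (directSumInr V W) i x.2 :=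
    Prod.ext (add_zero _).symm (zero_add _).symm
  rw [hx, map_add, map_add, ← hf_comp, ← hf_comp, ← hf_comp, ← hf_comp, h, h']

/-- The first inclusion into `ℬ^{1,∞}_{q,n}`. -/
def B1inl (q : ℕ) (n : ℤ) : Z0 R q (n + 1) ⟶ B1 R q n := directSumInl _ _

/-- The second inclusion into `ℬ^{1,∞}_{q,n}`. -/
def B1inr (q : ℕ) (n : ℤ) : Z0 R (q + 1) n ⟶ B1 R q n := directSumInr _ _

/-- The morphism out of `ℬ^{1,∞}_{q,n}` with given components. -/
def B1desc {q : ℕ} {n : ℤ} (f : Z0 R q (n + 1) ⟶ V) (g : Z0 R (q + 1) n ⟶ V) : B1 R q n ⟶ V :=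
  directSumDesc f g

theorem B1inl_desc {q : ℕ} {n : ℤ} (f : Z0 R q (n + 1) ⟶ V) (g : Z0 R (q + 1) n ⟶ V) :
    B1inl q n ≫ B1desc f g = f := directSumInl_desc f g

theorem B1inr_desc {q : ℕ} {n : ℤ} (f : Z0 R q (n + 1) ⟶ V) (g : Z0 R (q + 1) n ⟶ V) :
    B1inr q n ≫ B1desc f g = g := directSumInr_desc f g

theorem B1_ext {q : ℕ} {n : ℤ} {f g : B1 R q n ⟶ V} (h : B1inl q n ≫ f = B1inl q n ≫ g)
    (h' : B1inr q n ≫ f = B1inr q n ≫ g) : f = g := directSum_ext h h'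

/-- The first component of `phi` sends the generator to the differential of the generator of degree
`n + 1`, since both have coefficient `1`. Thus a square from `phi` to `f` encodes an equation `f z =
d a + b`. -/
theorem phi_desc_gen {q : ℕ} {n : ℤ} (f : Z0 R q (n + 1) ⟶ V) (g : Z0 R (q + 1) n ⟶ V) :
    hf (phi R q n ≫ B1desc f g) n (Z1gen q n) =
      V.obj.d (n + 1) n (hf f (n + 1) (Z0gen q (n + 1))) + hf g n (Z0gen (q + 1) n) := by
  rw [← f_d]
  refine congrArg₂ (· + ·) (congrArg (hf f n) ?_) rfl
  exact (towerCoe_injective (w := fun k => q + k / 2) n (towerCoe_d (n := n + 1) rfl _)).symm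

/-! ### Lifting properties against the generators -/

theorem zero_ext {f g : zeroObj R ⟶ V} : f = g := hom_ext' fun i x => by
  obtain rfl : x = 0 := Subsingleton.elim (α := PUnit) _ _
  rw [map_zero, map_zero]

/-- The lower map of a lifting square is an element of `F_q W`, and a lift is a preimage in `F_q V`.
-/
theorem rlp_genTrivCof_iff (f : V ⟶ W) : (genTrivCof R).rlp f ↔
    ∀ (q : ℕ) (n : ℤ), ∀ w ∈ W.obj.F n q, ∃ v ∈ V.obj.F n q, hf f n v = w := by
  constructor
  · intro H q n w hw
    have : HasLiftingProperty (fromZero (Z0 R q n)) f := H _ (MorphismProperty.ofHoms.mk (q, n))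
    have sq : CommSq (fromZero V) (fromZero (Z0 R q n)) f (Z0desc w hw) := ⟨zero_ext⟩
    refine ⟨hf sq.lift n (Z0gen q n), f_F _ (Z0gen_mem q n), ?_⟩
    rw [← hf_comp, sq.fac_right, Z0desc_gen]
  · rintro H _ _ _ ⟨q, n⟩
    change HasLiftingProperty (fromZero (Z0 R q n)) f
    refine ⟨fun {a b} sq => ?_⟩
    obtain ⟨v, hv, hvw⟩ := H q n (hf b n (Z0gen q n)) (f_F _ (Z0gen_mem q n))
    exact ⟨⟨{ l := Z0desc v hv
              fac_left := zero_ext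
              fac_right := Z0_ext (by rw [hf_comp, Z0desc_gen, hvw]) }⟩⟩

/-- The square is the datum of `z`, `a`, `b` with `f z = d a + b`. A lift is a pair over `(a, b)`
that solves the same equation for `z` upstairs. -/
theorem rlp_genCof_iff (f : V ⟶ W) : (genCof R).rlp f ↔
    ∀ (q : ℕ) (m n l : ℤ), n + 1 = m → l + 1 = n →
      ∀ z ∈ V.obj.F n q, V.obj.d n l z ∈ V.obj.F l (q + 1) →
      ∀ a ∈ W.obj.F m q, ∀ b ∈ W.obj.F n (q + 1), hf f n z = W.obj.d m n a + b →
        ∃ a' ∈ V.obj.F m q, ∃ b' ∈ V.obj.F n (q + 1),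
          hf f m a' = a ∧ hf f n b' = b ∧ z = V.obj.d m n a' + b' := by
  constructor
  · rintro H q _ n l rfl hl z hz hdz a ha b hb hzab
    have : HasLiftingProperty (phi R q n) f := H _ (MorphismProperty.ofHoms.mk (q, n))
    have sq : CommSq (Z1desc hl z hz hdz) (phi R q n) f
        (B1desc (Z0desc a ha) (Z0desc b hb)) := ⟨Z1_ext (by
      rw [phi_desc_gen, hf_comp, Z1desc_gen, Z0desc_gen, Z0desc_gen, hzab])⟩
    have h1 : B1desc (B1inl q n ≫ sq.lift) (B1inr q n ≫ sq.lift) =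
        sq.lift := B1_ext (B1inl_desc _ _) (B1inr_desc _ _)
    refine ⟨hf (B1inl q n ≫ sq.lift) _ (Z0gen q (n + 1)), f_F _ (Z0gen_mem q _),
      hf (B1inr q n ≫ sq.lift) _ (Z0gen (q + 1) n), f_F _ (Z0gen_mem _ n), ?_, ?_, ?_⟩
    · rw [← hf_comp, Category.assoc, sq.fac_right, B1inl_desc, Z0desc_gen]
    · rw [← hf_comp, Category.assoc, sq.fac_right, B1inr_desc, Z0desc_gen]
    · rw [← phi_desc_gen, h1, sq.fac_left, Z1desc_gen]
  · rintro H _ _ _ ⟨q, n⟩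
    change HasLiftingProperty (phi R q n) f
    refine ⟨fun {s t} sq => ?_⟩
    obtain ⟨t₁, t₂, rfl⟩ : ∃ t₁ t₂, t = B1desc t₁ t₂ := ⟨B1inl q n ≫ t,
      B1inr q n ≫ t, B1_ext (B1inl_desc _ _).symm
        (B1inr_desc _ _).symm⟩
    have hl : n - 1 + 1 = n := by ring
    obtain ⟨a, ha, b, hb, hfa, hfb, hz⟩ := H q (n + 1) n (n - 1) rfl hl
      (hf s n (Z1gen q n)) (f_F _ (Z1gen_mem q n))
      (by rw [← f_d]; exact f_F _ (d_Z1gen_mem q hl))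
      (hf t₁ _ (Z0gen q (n + 1))) (f_F _ (Z0gen_mem q _))
      (hf t₂ _ (Z0gen (q + 1) n)) (f_F _ (Z0gen_mem _ n))
      (by rw [← phi_desc_gen, ← sq.w, hf_comp])
    refine ⟨⟨{ l := B1desc (Z0desc a ha) (Z0desc b hb)
               fac_left := Z1_ext ?_
               fac_right := B1_ext ?_ ?_ }⟩⟩
    · rw [phi_desc_gen, Z0desc_gen, Z0desc_gen, hz]
    · rw [← Category.assoc, B1inl_desc, B1inl_desc]
      exact Z0_ext (by rw [hf_comp, Z0desc_gen, hfa])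
    · rw [← Category.assoc, B1inr_desc, B1inr_desc]
      exact Z0_ext (by rw [hf_comp, Z0desc_gen, hfb])

end CompleteGrDGMod

end GrDG

namespace GrDG

open FiltGrDGMod

namespace CompleteGrDGMod

/-! ### Trivial fibrations as strict surjections with acyclic kernel -/

section Acyclic

variable {R : Type u} [CommRing R] {V W T : CompleteGrDGMod R}

/-- For surjective `f`, strictness says that `f (F_q V) = F_q W`. Weight `0` contains everything, so
plain surjectivity is the case `q = 0`. -/
theorem strictSurjection_iff (f : V ⟶ W) : strictSurjection R f ↔
    ∀ (q : ℕ) (n : ℤ), ∀ w ∈ W.obj.F n q, ∃ v ∈ V.obj.F n q, hf f n v = w := by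
  constructor
  · intro H q n w hw
    have h : w ∈ LinearMap.range (hf f n) ⊓ W.obj.F n q := ⟨(H n).1 w, hw⟩
    rw [← (H n).2 q] at h
    exact h
  · intro H n
    have hs : Function.Surjective (hf f n) := fun w => by
      obtain ⟨v, -, hv⟩ := H 0 n w (mem_F_zero _ w)
      exact ⟨v, hv⟩
    refine ⟨hs, fun q => le_antisymm ?_ fun w hw => H q n w hw.2⟩
    rintro _ ⟨v, hv, rfl⟩
    exact ⟨⟨v, rfl⟩, f_F f hv⟩

theorem rlp_genTrivCof : (genTrivCof R).rlp = strictSurjection R := by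
  ext V W f
  rw [rlp_genTrivCof_iff, strictSurjection_iff]

/-- The kernel of a morphism of complete gr-dg modules. -/
def kerObj (f : V ⟶ W) : CompleteGrDGMod R where
  obj :=
    { X := fun n => LinearMap.ker (hf f n)
      F := fun n p => (V.obj.F n p).comap (LinearMap.ker (hf f n)).subtype
      F_zero := fun n => by rw [V.obj.F_zero, Submodule.comap_top]
      F_anti := fun n p q h => Submodule.comap_mono (V.obj.F_anti n h)
      d := fun i j => (V.obj.d i j).restrict fun x hx => by
        rw [LinearMap.mem_ker] at hx ⊢
        rw [f_d, hx, map_zero]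
      d_shape := fun i j h => by
        ext x
        change V.obj.d i j x.1 = 0
        rw [V.obj.d_shape i j h, LinearMap.zero_apply]
      d_F := fun i j p x hx => V.obj.d_F i j p _ hx
      d_d := fun i j k p x hx => V.obj.d_d i j k p _ hx }
  property n := isCompleteFilt_of
    (fun x hx => Subtype.ext ((V.property n).eq_zero hx))
    (fun s hs => by
      obtain ⟨x, hx⟩ := (V.property n).exists_limit (fun p => (s p).1) hs
      refine ⟨⟨x, (W.property n).eq_zero fun p => ?_⟩, hx⟩
      have := f_F f (hx p)
      rwa [map_sub, show hf f n (s p).1 = 0 from (s p).2, sub_zero] at this)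

/-- The inclusion of the kernel of a morphism. -/
def kerι (f : V ⟶ W) (n : ℤ) : (kerObj f).obj.X n →ₗ[R] V.obj.X n :=
  (LinearMap.ker (hf f n)).subtype

theorem hf_kerι (f : V ⟶ W) (n : ℤ) (x : (kerObj f).obj.X n) : hf f n (kerι f n x) = 0 := x.2

/-- A complete gr-dg module whose associated graded complexes are acyclic. -/
def IsAcyclic (K : CompleteGrDGMod R) : Prop :=
  ∀ (p : ℕ) (m n l : ℤ), n + 1 = m → l + 1 = n → ∀ k ∈ K.obj.F n p,
    K.obj.d n l k ∈ K.obj.F l (p + 1) →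
      ∃ a ∈ K.obj.F m p, k - K.obj.d m n a ∈ K.obj.F n (p + 1)

/-- This is the long exact sequence argument, done by hand modulo higher weight. -/
theorem isAcyclic_kerObj {f : V ⟶ W} (hs : strictSurjection R f) (hq : gradedQuasiIso R f) :
    IsAcyclic (kerObj f) := by
  rw [strictSurjection_iff] at hs
  rw [gradedQuasiIso_iff] at hq
  rintro p m n l hm hl ⟨k, hk⟩ hkF hdk
  -- Injectivity on homology makes `k` a boundary `d a` in `V` modulo weight `p + 1`, but `a` need
  -- not lie in the kernel.
  obtain ⟨a, ha, hka⟩ := (hq p m n l hm hl).1 k hkF hdk ⟨0, zero_mem _, by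
    rw [show hf f n k = 0 from hk, map_zero, sub_zero]
    exact zero_mem _⟩
  have hda : W.obj.d m n (hf f m a) ∈ W.obj.F n (p + 1) := by
    have := f_F f hka
    rw [map_sub, show hf f n k = 0 from hk, zero_sub, f_d] at this
    exact neg_mem_iff.1 this
  -- The image `f a` is a cycle modulo weight `p + 1`, so it is the image of a cycle `v` up to a
  -- boundary and an error. Lifting the latter two to `d b'` and `c` corrects `a` to an element of
  -- the kernel with the same differential modulo weight `p + 1`.
  obtain ⟨v, hv, hdv, b, hb, hab⟩ := (hq p (m + 1) m n rfl hm).2 _ (f_F f ha) hda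
  obtain ⟨b', hb', rfl⟩ := hs _ _ b hb
  obtain ⟨c, hc, hfc⟩ := hs _ _ _ hab
  refine ⟨⟨a - v - V.obj.d (m + 1) m b' - c, ?_⟩, ?_, ?_⟩
  · rw [LinearMap.mem_ker, map_sub, map_sub, map_sub, hfc, f_d, sub_self]
  · exact sub_mem (sub_mem (sub_mem ha hv) (d_mem hb')) (F_succ_le hc)
  · change k - V.obj.d m n (a - v - V.obj.d (m + 1) m b' - c) ∈ V.obj.F n (p + 1)
    have := add_mem (add_mem (add_mem hka hdv) (d_d_mem (k := n) (j := m) hb')) (d_mem (j := n) hc)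
    convert this using 1
    simp only [map_sub]
    abel

/-- After arbitrary lifts of `a` and `b`, the defect `z - d a - b` is a cycle of the kernel modulo
weight `q + 1`, so it is a boundary `d c` there. Replacing `a` by `a + c` and taking what remains of
`z` as `b'` solves the problem. -/
theorem rlp_genCof_of_isAcyclic {f : V ⟶ W} (hs : strictSurjection R f)
    (h : IsAcyclic (kerObj f)) : (genCof R).rlp f := by
  rw [strictSurjection_iff] at hs
  rw [rlp_genCof_iff]
  rintro q m n l hm hl z hz hdz _ hfa _ hfb hzab
  obtain ⟨a, ha, rfl⟩ := hs _ _ _ hfa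
  obtain ⟨b, hb, rfl⟩ := hs _ _ _ hfb
  obtain ⟨⟨c, hc⟩, hcF, hzc⟩ := h q m n l hm hl ⟨z - V.obj.d m n a - b, by
    rw [LinearMap.mem_ker, map_sub, map_sub, hzab, f_d]; abel⟩
    (sub_mem (sub_mem hz (d_mem ha)) (F_succ_le hb)) (by
      change V.obj.d n l (z - V.obj.d m n a - b) ∈ V.obj.F l (q + 1)
      rw [map_sub, map_sub]
      exact sub_mem (sub_mem hdz (d_d_mem ha)) (d_mem hb))
  change z - V.obj.d m n a - b - V.obj.d m n c ∈ V.obj.F n (q + 1) at hzc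
  refine ⟨a + c, add_mem ha hcF, z - V.obj.d m n (a + c), ?_, ?_, ?_, ?_⟩
  · have := add_mem hzc hb
    convert this using 1
    rw [map_add]
    abel
  · rw [map_add, show hf f m c = 0 from hc, add_zero]
  · rw [map_sub, hzab, f_d, map_add, show hf f m c = 0 from hc, add_zero]
    abel
  · abel

theorem rlp_genCof : (genCof R).rlp = strictSurjection R ⊓ gradedQuasiIso R := by
  ext V W f
  constructor
  · intro H
    rw [rlp_genCof_iff] at H
    -- The case `z = 0`, `b = -d a`: cycles of the graded pieces of `W` lift to cycles of those of
    -- `V`.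
    have H₁ : ∀ (q : ℕ) (m n : ℤ), n + 1 = m → ∀ a ∈ W.obj.F m q,
        W.obj.d m n a ∈ W.obj.F n (q + 1) →
          ∃ a' ∈ V.obj.F m q, V.obj.d m n a' ∈ V.obj.F n (q + 1) ∧ hf f m a' = a := by
      intro q m n hm a ha hda
      obtain ⟨a', ha', b', hb', haa', -, h⟩ := H q m n (n - 1) hm (by omega) 0 (zero_mem _)
        (by rw [map_zero]; exact zero_mem _) a ha _ (neg_mem hda)
        (by rw [map_zero, add_neg_cancel])
      refine ⟨a', ha', ?_, haa'⟩
      rw [eq_neg_of_add_eq_zero_left h.symm]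
      exact neg_mem hb'
    refine ⟨(strictSurjection_iff f).2 fun q n w hw => ?_, (gradedQuasiIso_iff f).2
      fun p m n l hm hl => ⟨fun v hv hdv => ?_, fun w hw hdw => ?_⟩⟩
    -- A general `w` is lifted in two stages: its differential is always a cycle modulo higher
    -- weight and lifts to `z`, and then the problem with data `z`, `a = w`, `b = 0` is solved.
    · obtain ⟨z, hz, hdz, hzw⟩ := H₁ q (n - 1) (n - 1 - 1) (by omega) (W.obj.d n (n - 1) w)
        (d_mem hw) (d_d_mem hw)
      obtain ⟨a', ha', b', hb', haa', -, h⟩ := H q n (n - 1) (n - 1 - 1) (by omega) (by omega)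
        z hz hdz w hw 0 (zero_mem _) (by rw [hzw, add_zero])
      exact ⟨a', ha', haa'⟩
    · rintro ⟨a, ha, hva⟩
      obtain ⟨a', ha', b', hb', -, -, h⟩ := H p m n l hm hl v hv hdv a ha _ hva (by abel)
      refine ⟨a', ha', ?_⟩
      rw [h, add_sub_cancel_left]
      exact hb'
    · obtain ⟨v, hv, hdv, rfl⟩ := H₁ p n l hl w hw hdw
      exact ⟨v, hv, hdv, 0, zero_mem _, by
        rw [map_zero, sub_self, sub_zero]; exact zero_mem _⟩
  · rintro ⟨hs, hq⟩
    exact rlp_genCof_of_isAcyclic hs (isAcyclic_kerObj hs hq)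

end Acyclic

/-! ### Contractions of acyclic objects over a field -/

section Contraction

variable {R : Type u} [Field R]

/-- Over a field, an acyclic complete gr-dg module is contractible up to filtration one. -/
theorem IsAcyclic.exists_contraction {K : CompleteGrDGMod R} (h : IsAcyclic K) :
    ∃ s : ∀ n m : ℤ, K.obj.X n →ₗ[R] K.obj.X m,
      (∀ n m p x, n + 1 = m → x ∈ K.obj.F n p → s n m x ∈ K.obj.F m p) ∧
      ∀ m n l : ℤ, n + 1 = m → l + 1 = n → ∀ p, ∀ x ∈ K.obj.F n p,
        x - K.obj.d m n (s n m x) - s l n (K.obj.d n l x) ∈ K.obj.F n (p + 1) := by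
  have ht : ∀ (p : ℕ) (n m : ℤ), ∃ t : K.obj.X n →ₗ[R] K.obj.X m, n + 1 = m →
      (∀ l, l + 1 = n → ∀ z ∈ K.obj.F n p, K.obj.d n l z ∈ K.obj.F l (p + 1) →
        t z ∈ K.obj.F m p ∧ z - K.obj.d m n (t z) ∈ K.obj.F n (p + 1)) ∧
      ∀ z ∈ K.obj.F n (p + 1), t z = 0 := by
    intro p n m
    by_cases hm : n + 1 = m
    -- The map `t p` picks primitives of weight-`p` cycles modulo `F (p + 1)`, and kills `F (p +
    -- 1)`.
    · obtain ⟨t, ht, ht'⟩ := exists_linear_preimage (K.obj.d m n) (K.obj.F m p)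
        (K.obj.F n p ⊓ (K.obj.F (n - 1) (p + 1)).comap (K.obj.d n (n - 1)))
        (K.obj.F n (p + 1)) fun z hz => h p m n (n - 1) hm (by omega) z hz.1 hz.2
      refine ⟨t, fun _ => ⟨fun l hl z hz hdz => ?_, ht'⟩⟩
      obtain rfl : l = n - 1 := by omega
      exact ht z ⟨hz, hdz⟩
    · exact ⟨0, fun h => absurd h hm⟩
  choose t ht using ht
  have key : ∀ n m : ℤ, ∃ s : K.obj.X n →ₗ[R] K.obj.X m, n + 1 = m → ∀ l, l + 1 = n →
      (∀ p x, x ∈ K.obj.F n p → s x ∈ K.obj.F m p) ∧ ∀ p x, x ∈ K.obj.F n p →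
        s x - t p n m (x - t p l n (K.obj.d n l x)) ∈ K.obj.F m (p + 1) := by
    intro n m
    by_cases hm : n + 1 = m
    · have hl : n - 1 + 1 = n := by omega
      -- On weight `p` the contraction is `t (x - t (d x))`. The inner term is a cycle modulo weight
      -- `p + 1`, because `d x` is one and `t` gives it a primitive.
      obtain ⟨s, hs, hs'⟩ := exists_filtered_approx (K.obj.F_anti n) (K.obj.F_zero n)
        (K.property m) (fun p => t p n m ∘ₗ (LinearMap.id - t p (n - 1) n ∘ₗ K.obj.d n (n - 1)))
        (fun p x hx => by
          have h1 := (ht p (n - 1) n hl).1 (n - 1 - 1) (by omega) (K.obj.d n (n - 1) x)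
            (d_mem hx) (d_d_mem hx)
          refine ((ht p n m hm).1 (n - 1) hl _ (sub_mem hx h1.1) ?_).1
          rw [map_sub]
          exact h1.2)
        (fun p x hx => by
          have h1 := (ht p (n - 1) n hl).2 (K.obj.d n (n - 1) x) (d_mem hx)
          rw [LinearMap.comp_apply, LinearMap.sub_apply, LinearMap.comp_apply, h1, sub_zero,
            LinearMap.id_apply, (ht p n m hm).2 x hx]
          exact zero_mem _)
      refine ⟨s, fun _ l hl' => ?_⟩
      obtain rfl : l = n - 1 := by omega
      exact ⟨hs, hs'⟩
    · exact ⟨0, fun h => absurd h hm⟩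
  choose s hs using key
  refine ⟨s, fun n m p x hm hx => (hs n m hm (n - 1) (by omega)).1 p x hx, ?_⟩
  intro m n l hm hl p x hx
  have hl' : l - 1 + 1 = l := by omega
  have h1 := (ht p l n hl).1 (l - 1) hl' (K.obj.d n l x) (d_mem hx) (d_d_mem hx)
  have h2 := (ht p n m hm).1 l hl (x - t p l n (K.obj.d n l x)) (sub_mem hx h1.1) (by
    rw [map_sub]; exact h1.2)
  have h3 := d_mem (j := n) ((hs n m hm l hl).2 p x hx)
  have h4 := (hs l n hl (l - 1) hl').2 p _ (d_mem hx)
  -- Since `d (d x)` has weight `p + 1`, it is killed by `t`, and `s (d x)` reduces to `t (d x)`.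
  -- With `d (s x)` congruent to `x - t (d x)`, the sum is `x`.
  rw [(ht p (l - 1) l hl').2 _ (d_d_mem hx), sub_zero] at h4
  have := sub_mem (sub_mem h2.2 h3) h4
  convert this using 1
  simp only [map_sub]
  abel

end Contraction

/-! ### Maps lifting against strict surjections are deformation retracts -/

section Retract

variable {R : Type u} [CommRing R] {A B V W : CompleteGrDGMod R}

theorem castX_mem (V : CompleteGrDGMod R) (i j : ℤ) {p : ℕ} {x : V.obj.X i}
    (hx : x ∈ V.obj.F i p) : castX V i j x ∈ V.obj.F j p := by
  by_cases h : i = j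
  · subst h
    rwa [castX_self]
  · rw [castX, dif_neg h]
    exact zero_mem _

theorem castX_of_ne (V : CompleteGrDGMod R) {i j : ℤ} (h : i ≠ j) : castX V i j = 0 := by
  rw [castX, dif_neg h]

/-- The path object based at zero: `B ⊕ B[1]` with `d (x, z) = (d x, x - d z)`. -/
def coneObj (B : CompleteGrDGMod R) : CompleteGrDGMod R where
  obj :=
    { X := fun n => B.obj.X n × B.obj.X (n + 1)
      F := fun n p => (B.obj.F n p).prod (B.obj.F (n + 1) p)
      F_zero := fun n => by rw [B.obj.F_zero, B.obj.F_zero, Submodule.prod_top]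
      F_anti := fun n => prod_antitone (B.obj.F_anti n) (B.obj.F_anti (n + 1))
      d := fun n m => LinearMap.prod (B.obj.d n m ∘ₗ LinearMap.fst R _ _)
        (castX B n (m + 1) ∘ₗ LinearMap.fst R _ _ -
          B.obj.d (n + 1) (m + 1) ∘ₗ LinearMap.snd R _ _)
      d_shape := fun n m h => by
        rw [B.obj.d_shape n m h, B.obj.d_shape (n + 1) (m + 1) (by omega),
          castX_of_ne B (by omega)]
        exact LinearMap.ext fun x => Prod.ext rfl (sub_zero _)
      d_F := fun n m p x hx => ⟨d_mem hx.1, sub_mem (castX_mem B _ _ hx.1) (d_mem hx.2)⟩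
      d_d := fun n m k p x hx => by
        refine ⟨d_d_mem hx.1, ?_⟩
        -- The two copies of `d x` cancel, so the second component of the square of the
        -- predifferential is `d (d z)`.
        change castX B m (k + 1) (B.obj.d n m x.1) - B.obj.d (m + 1) (k + 1)
          (castX B n (m + 1) x.1 - B.obj.d (n + 1) (m + 1) x.2) ∈ B.obj.F (k + 1) (p + 1)
        have h := d_d_mem (j := m + 1) (k := k + 1) hx.2
        rw [map_sub, ← sub_add]
        refine add_mem ?_ h
        by_cases hk : k + 1 = m
        · subst hk
          by_cases hm : k + 1 + 1 = n
          · subst hm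
            rw [castX_self, castX_self, sub_self]
            exact zero_mem _
          · rw [B.obj.d_shape _ _ hm, castX_of_ne B (Ne.symm hm), LinearMap.zero_apply,
              LinearMap.zero_apply, map_zero, map_zero, sub_zero]
            exact zero_mem _
        · rw [castX_of_ne B (Ne.symm hk), B.obj.d_shape (m + 1) (k + 1) (by omega),
            LinearMap.zero_apply, LinearMap.zero_apply, sub_zero]
          exact zero_mem _ }
  property n := isCompleteFilt_prod (B.property n) (B.property (n + 1))

/-- The projection of the based path object. -/
def coneFst (B : CompleteGrDGMod R) : coneObj B ⟶ B := ObjectProperty.homMk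
  { f := fun _ => LinearMap.fst R _ _
    f_F := fun _ _ _ hx => hx.1
    f_d := fun _ _ _ => rfl }

theorem hf_congr {f g : V ⟶ W} (h : f = g) (i : ℤ) (x : V.obj.X i) : hf f i x = hf g i x := by
  rw [h]

/-- The zero morphism. -/
def zeroHom (V W : CompleteGrDGMod R) : V ⟶ W := ObjectProperty.homMk
  { f := fun _ => 0
    f_F := fun _ _ _ _ => zero_mem _
    f_d := fun i j x => by
      rw [LinearMap.zero_apply, LinearMap.zero_apply, map_zero] }

theorem hf_zeroHom (i : ℤ) (x : V.obj.X i) : hf (zeroHom V W) i x = 0 := rfl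

/-- The difference of two morphisms. -/
def subHom (f g : V ⟶ W) : V ⟶ W := ObjectProperty.homMk
  { f := fun n => hf f n - hf g n
    f_F := fun _ _ _ hx => sub_mem (f_F f hx) (f_F g hx)
    f_d := fun i j x => by
      rw [LinearMap.sub_apply, LinearMap.sub_apply, map_sub, f_d, f_d] }

theorem hf_subHom (f g : V ⟶ W) (i : ℤ) (x : V.obj.X i) :
    hf (subHom f g) i x = hf f i x - hf g i x := rfl

/-- Morphisms with the left lifting property against the strict surjections are inclusions of
strong deformation retracts. -/
theorem exists_deformation_retract {f : A ⟶ B} (h : (strictSurjection R).llp f) :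
    ∃ r : B ⟶ A, f ≫ r = 𝟙 A ∧ ∃ s : ∀ n m : ℤ, B.obj.X n →ₗ[R] B.obj.X m,
      (∀ n m p x, x ∈ B.obj.F n p → s n m x ∈ B.obj.F m p) ∧
      (∀ n m a, s n m (hf f n a) = 0) ∧
      ∀ m n l : ℤ, n + 1 = m → l + 1 = n → ∀ x,
        x - hf f n (hf r n x) = B.obj.d m n (s n m x) + s l n (B.obj.d n l x) := by
  have h₁ : HasLiftingProperty f (zeroHom A (zeroObj R)) := h _ ((strictSurjection_iff _).2
    -- Lifting against `A → 0` produces the retraction `r`.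
    fun q n w _ => ⟨0, zero_mem _, Subsingleton.elim (α := PUnit) _ _⟩)
  have sq₁ : CommSq (𝟙 A) f (zeroHom A (zeroObj R)) (zeroHom B (zeroObj R)) :=
    ⟨hom_ext' fun i x => Subsingleton.elim (α := PUnit) _ _⟩
  obtain ⟨r, hr⟩ : ∃ r : B ⟶ A, f ≫ r = 𝟙 A := ⟨sq₁.lift, sq₁.fac_left⟩
  have h₂ : HasLiftingProperty f (coneFst B) := h _ ((strictSurjection_iff _).2
    fun q n w hw => ⟨(w, 0), ⟨hw, zero_mem _⟩, rfl⟩)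
  have hfr : ∀ n a, hf r n (hf f n a) = a := fun n a => by rw [← hf_comp, hr, hf_id]
  -- A lift of `1 - f r` to the based path object that vanishes on `A` has as its second component a
  -- null-homotopy of `1 - f r` relative to `A`.
  have sq₂ : CommSq (zeroHom A (coneObj B)) f (coneFst B) (subHom (𝟙 B) (r ≫ f)) :=
    ⟨hom_ext' fun i x => by
      rw [hf_comp, hf_comp, hf_zeroHom, map_zero, hf_subHom, hf_comp, hfr, hf_id, sub_self]⟩
  obtain ⟨L, hL, hL'⟩ : ∃ L : B ⟶ coneObj B, f ≫ L = zeroHom A (coneObj B) ∧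
    L ≫ coneFst B = subHom (𝟙 B) (r ≫ f) := ⟨sq₂.lift, sq₂.fac_left, sq₂.fac_right⟩
  have hL₁ : ∀ n x, (hf L n x).1 = x - hf f n (hf r n x) := fun n x =>
    hf_congr hL' n x
  refine ⟨r, hr, fun n m => castX B (n + 1) m ∘ₗ LinearMap.snd R _ _ ∘ₗ hf L n, ?_, ?_, ?_⟩
  · exact fun n m p x hx => castX_mem _ _ _ (f_F L hx).2
  · intro n m a
    have h0 : hf L n (hf f n a) = 0 := hf_congr hL n a
    change castX B (n + 1) m (hf L n (hf f n a)).2 = 0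
    rw [h0]
    exact map_zero _
  · rintro _ _ l rfl rfl x
    have h3 := congrArg Prod.snd (f_d L (l + 1) l x)
    have h4 : (hf L l (B.obj.d (l + 1) l x)).2 = castX B (l + 1) (l + 1) (hf L (l + 1) x).1 -
      B.obj.d (l + 1 + 1) (l + 1) (hf L (l + 1) x).2 := h3
    rw [castX_self, hL₁] at h4
    change _ = B.obj.d (l + 1 + 1) (l + 1) (castX B (l + 1 + 1) (l + 1 + 1) (hf L (l + 1) x).2) +
      castX B (l + 1) (l + 1) (hf L l (B.obj.d (l + 1) l x)).2
    rw [castX_self, castX_self, h4]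
    abel

/-- The retraction gives injectivity on the homology of the graded pieces, and the filtered homotopy
gives surjectivity. -/
theorem gradedQuasiIso_of_llp {f : A ⟶ B} (h : (strictSurjection R).llp f) :
    gradedQuasiIso R f := by
  obtain ⟨r, hr, s, hs, -, hrs⟩ := exists_deformation_retract h
  have hfr : ∀ n a, hf r n (hf f n a) = a := fun n a => by rw [← hf_comp, hr, hf_id]
  refine (gradedQuasiIso_iff f).2 fun p m n l hm hl => ⟨?_, fun w hw hdw => ?_⟩
  · rintro v hv hdv ⟨a, ha, hva⟩
    have := f_F r hva
    rw [map_sub, hfr, f_d] at this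
    exact ⟨_, f_F r ha, this⟩
  · refine ⟨hf r n w, f_F r hw, by rw [← f_d]; exact f_F r hdw, s n m w, hs _ _ _ _ hw, ?_⟩
    rw [hrs m n l hm hl, add_sub_cancel_left]
    exact hs _ _ _ _ hdw

end Retract

end CompleteGrDGMod

end GrDG

namespace GrDG

open FiltGrDGMod

theorem IsCompleteFilt.exists_limit_shift {R : Type u} [CommRing R] {M : Type u} [AddCommGroup M]
    [Module R M] {F : ℕ → Submodule R M} {hF : Antitone F} (h : IsCompleteFilt hF) (c : ℕ)
    (s : ℕ → M) (hs : ∀ p, s (p + 1) - s p ∈ F (p + c)) : ∃ x, ∀ p, x - s p ∈ F (p + c) := by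
  obtain ⟨x, hx⟩ := h.exists_limit (fun p => s (p - c)) fun p => by
    rcases lt_or_ge p c with hp | hp
    · rw [show p + 1 - c = p - c by omega, sub_self]
      exact zero_mem _
    · obtain ⟨k, rfl⟩ := Nat.exists_eq_add_of_le' hp
      have := hs k
      rwa [show k + c + 1 - c = k + 1 by omega, show k + c - c = k by omega]
  exact ⟨x, fun p => by simpa using hx (p + c)⟩

namespace CompleteGrDGMod

/-! ### Cofree objects and filtered retractions of cofibrations -/

section Cofree

variable {R : Type u} [CommRing R] {V W : CompleteGrDGMod R}

/-- The degree `n` part of the cofree complete gr-dg module on the filtered graded module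
underlying `T`. -/
def cofreeX (T : CompleteGrDGMod R) (n : ℤ) (p : ℕ) : Submodule R (∀ j, T.obj.X j) where
  carrier := {x | ∀ j, (n < j → x j = 0) ∧ x j ∈ T.obj.F j (p + (n - j).toNat / 2)}
  add_mem' ha hb j := ⟨fun h => by rw [Pi.add_apply, (ha j).1 h, (hb j).1 h, add_zero],
    add_mem (ha j).2 (hb j).2⟩
  zero_mem' _ := ⟨fun _ => rfl, zero_mem _⟩
  smul_mem' c a ha j := ⟨fun h => by rw [Pi.smul_apply, (ha j).1 h, smul_zero],
    Submodule.smul_mem _ c (ha j).2⟩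

theorem cofreeX_anti (T : CompleteGrDGMod R) (n : ℤ) : Antitone (cofreeX T n) :=
  fun _ _ h _ hx j => ⟨(hx j).1, T.obj.F_anti j (by omega) (hx j).2⟩

/-- Truncation of a family of elements. -/
def cofreeTrunc (T : CompleteGrDGMod R) (n m : ℤ) :
    (∀ j, T.obj.X j) →ₗ[R] (∀ j, T.obj.X j) :=
  LinearMap.pi fun j => if m + 1 = n ∧ j ≤ m then LinearMap.proj j else 0

theorem cofreeTrunc_apply (T : CompleteGrDGMod R) (n m : ℤ) (x : ∀ j, T.obj.X j) (j : ℤ) :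
    cofreeTrunc T n m x j = if m + 1 = n ∧ j ≤ m then x j else 0 := by
  rw [cofreeTrunc, LinearMap.pi_apply]
  split_ifs <;> rfl

theorem cofreeTrunc_mem {T : CompleteGrDGMod R} {n m : ℤ} {p : ℕ} {x : ∀ j, T.obj.X j}
    (hx : x ∈ cofreeX T n p) : cofreeTrunc T n m x ∈ cofreeX T m p := fun j => by
  rw [cofreeTrunc_apply]
  split_ifs with h
  · exact ⟨fun h' => absurd h.2 (not_le.2 h'), T.obj.F_anti j (by omega) (hx j).2⟩
  · exact ⟨fun _ => rfl, zero_mem _⟩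

/-- The cofree complete gr-dg module on the filtered graded module underlying `T`. -/
def cofreeObj (T : CompleteGrDGMod R) : CompleteGrDGMod R where
  obj :=
    { X := fun n => cofreeX T n 0
      F := fun n p => (cofreeX T n p).submoduleOf (cofreeX T n 0)
      F_zero := fun n => Submodule.submoduleOf_self _
      F_anti := fun n p q h => Submodule.comap_mono (cofreeX_anti T n h)
      d := fun n m => (cofreeTrunc T n m).restrict fun x hx => cofreeTrunc_mem hx
      d_shape := fun n m h => LinearMap.ext fun x => Subtype.ext (funext fun j =>
        (cofreeTrunc_apply T n m x.1 j).trans (if_neg fun h' => h h'.1))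
      d_F := fun n m p x hx => cofreeTrunc_mem hx
      d_d := fun n m k p x hx j => by
        change (_ → cofreeTrunc T m k (cofreeTrunc T n m x.1) j = 0) ∧
          cofreeTrunc T m k (cofreeTrunc T n m x.1) j ∈ _
        rw [cofreeTrunc_apply, cofreeTrunc_apply]
        split_ifs with h h'
        · exact ⟨fun h' => absurd h.2 (not_le.2 h'), T.obj.F_anti j (by omega) (hx j).2⟩
        · exact ⟨fun _ => rfl, zero_mem _⟩
        · exact ⟨fun _ => rfl, zero_mem _⟩ }
  property n := isCompleteFilt_of
    (fun x hx => Subtype.ext (funext fun j => (T.property j).eq_zero fun p =>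
      T.obj.F_anti j (Nat.le_add_right p _) (hx p j).2))
    (fun s hs => by
      choose x hx using fun j => (T.property j).exists_limit_shift ((n - j).toNat / 2)
        (fun p => (s p).1 j) fun p => (hs p j).2
      have h0 : ∀ j, n < j → x j = 0 := fun j h => (T.property j).eq_zero fun p => by
        have := hx j p
        rw [((s p).2 j).1 h, sub_zero] at this
        exact T.obj.F_anti j (Nat.le_add_right p _) this
      refine ⟨⟨x, fun j => ⟨h0 j, ?_⟩⟩, fun p j => ⟨fun h => ?_, hx j p⟩⟩
      · have := add_mem (hx j 0) ((s 0).2 j).2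
        rwa [sub_add_cancel] at this
      · change x j - (s p).1 j = 0
        rw [h0 j h, ((s p).2 j).1 h, sub_zero])

/-- The projection of the cofree complete gr-dg module onto the cogenerators. -/
def cofreeEv (T : CompleteGrDGMod R) (n j : ℤ) : (cofreeObj T).obj.X n →ₗ[R] T.obj.X j :=
  LinearMap.proj j ∘ₗ Submodule.subtype _

theorem cofreeEv_mem {T : CompleteGrDGMod R} {n j : ℤ} {p : ℕ} {x : (cofreeObj T).obj.X n}
    (hx : x ∈ (cofreeObj T).obj.F n p) :
    cofreeEv T n j x ∈ T.obj.F j (p + (n - j).toNat / 2) := (hx j).2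

theorem cofreeEv_ext {T : CompleteGrDGMod R} {n : ℤ} {x y : (cofreeObj T).obj.X n}
    (h : ∀ j, cofreeEv T n j x = cofreeEv T n j y) : x = y := Subtype.ext (funext h)

theorem cofreeEv_of_lt {T : CompleteGrDGMod R} {n j : ℤ} (h : n < j)
    (x : (cofreeObj T).obj.X n) : cofreeEv T n j x = 0 := (x.2 j).1 h

theorem cofreeEv_d {T : CompleteGrDGMod R} {n m j : ℤ} (hm : m + 1 = n) (hj : j ≤ m)
    (x : (cofreeObj T).obj.X n) :
    cofreeEv T m j ((cofreeObj T).obj.d n m x) = cofreeEv T n j x :=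
  (cofreeTrunc_apply T n m x.1 j).trans (if_pos ⟨hm, hj⟩)

theorem cofreeEv_iterD {T : CompleteGrDGMod R} {n m j : ℤ} (hm : m ≤ n) (hj : j ≤ m)
    (x : (cofreeObj T).obj.X n) :
    cofreeEv T m j (iterD (cofreeObj T) n m x) = cofreeEv T n j x := by
  induction m, hm using Int.leInductionDown with
  | base => rw [iterD_self]
  | pred m hm ih =>
    rw [← d_iterD (sub_add_cancel m 1) hm, cofreeEv_d (sub_add_cancel m 1) hj, ih (by omega)]

/-- The `j`-th coordinate in degree `n` is the diagonal coordinate of the iterated differential from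
degree `n` to `j`. So filtered linear maps `V → T` ignoring `d` correspond to morphisms into
`cofreeObj T`. -/
theorem cofree_ext {T : CompleteGrDGMod R} {f g : V ⟶ cofreeObj T}
    (h : ∀ n v, cofreeEv T n n (hf f n v) = cofreeEv T n n (hf g n v)) : f = g := by
  refine hom_ext' fun n v => cofreeEv_ext fun j => ?_
  rcases lt_or_ge n j with hj | hj
  · rw [cofreeEv_of_lt hj, cofreeEv_of_lt hj]
  · rw [← cofreeEv_iterD hj le_rfl, ← cofreeEv_iterD hj le_rfl, ← f_iterD, ← f_iterD, h]

/-- The morphism to a cofree complete gr-dg module given by filtered linear maps. -/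
def cofreeLift {T : CompleteGrDGMod R} (r : ∀ j, V.obj.X j →ₗ[R] T.obj.X j)
    (hr : ∀ j p x, x ∈ V.obj.F j p → r j x ∈ T.obj.F j p) : V ⟶ cofreeObj T :=
  ObjectProperty.homMk
    { f := fun n => (LinearMap.pi fun j => r j ∘ₗ iterD V n j).codRestrict (cofreeX T n 0)
        fun x j => ⟨fun h => by
          change r j (iterD V n j x) = 0
          rw [iterD_of_lt h, map_zero], hr j _ _ (iterD_mem (mem_F_zero _ x))⟩
      f_F := fun n p x hx j => ⟨fun h => by
          change r j (iterD V n j x) = 0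
          rw [iterD_of_lt h, map_zero], hr j _ _ (iterD_mem hx)⟩
      f_d := fun n m x => by
        by_cases hm : m + 1 = n
        · refine cofreeEv_ext fun j => ?_
          rcases lt_or_ge m j with hj | hj
          · rw [cofreeEv_of_lt hj, cofreeEv_of_lt hj]
          · rw [cofreeEv_d hm hj]
            change r j (iterD V m j (V.obj.d n m x)) = r j (iterD V n j x)
            rw [iterD_d hm hj]
        · rw [FiltGrDGMod.d_shape _ _ _ hm, FiltGrDGMod.d_shape _ _ _ hm, LinearMap.zero_apply,
            LinearMap.zero_apply]
          exact map_zero _ }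

theorem cofreeEv_lift {T : CompleteGrDGMod R} (r : ∀ j, V.obj.X j →ₗ[R] T.obj.X j)
    (hr : ∀ j p x, x ∈ V.obj.F j p → r j x ∈ T.obj.F j p) (n : ℤ) (v : V.obj.X n) :
    cofreeEv T n n (hf (cofreeLift r hr) n v) = r n v := by
  change r n (iterD V n n v) = r n v
  rw [iterD_self]

/-- The differential forgets the top coordinate and otherwise only shifts the degree. Whether the
weight bound `⌊(n-j)/2⌋` changes under this shift depends on the parity of `n - j`. -/
theorem exists_cofreeTrunc_decomposition {T : CompleteGrDGMod R} {q : ℕ} {m n l : ℤ}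
    (hm : n + 1 = m) (hl : l + 1 = n) {z : ∀ j, T.obj.X j} (hz : z ∈ cofreeX T n q)
    (hdz : cofreeTrunc T n l z ∈ cofreeX T l (q + 1)) :
    ∃ a ∈ cofreeX T m q, z - cofreeTrunc T m n a ∈ cofreeX T n (q + 1) := by
  -- Coordinates with `n - j` even satisfy the same bound in degree `n + 1`, so they can be moved
  -- into `a`.
  refine ⟨fun j => if Even (n - j) then z j else 0, fun j => ?_, fun j => ?_⟩
  · beta_reduce
    split_ifs with h
    · refine ⟨fun h' => (hz j).1 (by omega), ?_⟩
      rcases lt_or_ge n j with h' | h'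
      · rw [(hz j).1 h']
        exact zero_mem _
      · have := (hz j).2
        obtain ⟨k, hk⟩ := h
        rwa [show (m - j).toNat / 2 = (n - j).toNat / 2 by omega]
    · exact ⟨fun _ => rfl, zero_mem _⟩
  · rw [Pi.sub_apply, cofreeTrunc_apply]
    rcases lt_or_ge n j with h | h
    · rw [if_neg (by omega), sub_zero, (hz j).1 h]
      exact ⟨fun _ => rfl, zero_mem _⟩
    · rw [if_pos ⟨hm, h⟩]
      refine ⟨fun h' => absurd h' (not_lt.2 h), ?_⟩
      split_ifs with h'
      · rw [sub_self]
        exact zero_mem _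
      -- For odd `n - j` the bounds in degrees `n` and `n - 1` coincide, so the hypothesis on `d z`
      -- gives the extra unit of weight.
      · obtain ⟨k, hk⟩ := Int.not_even_iff_odd.1 h'
        have h1 := (hdz j).2
        rw [cofreeTrunc_apply, if_pos ⟨hl, by omega⟩] at h1
        rwa [sub_zero, show (n - j).toNat / 2 = (l - j).toNat / 2 by omega]

/-- A cofree object is acyclic, so every cofibration lifts against its map to zero. -/
theorem rlp_genCof_cofree (T : CompleteGrDGMod R) :
    (genCof R).rlp (zeroHom (cofreeObj T) (zeroObj R)) := by
  rw [rlp_genCof_iff]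
  intro q m n l hm hl z hz hdz a ha b hb _
  obtain ⟨a', ha', hza⟩ := exists_cofreeTrunc_decomposition hm hl hz hdz
  exact ⟨⟨a', cofreeX_anti T m (Nat.zero_le q) ha'⟩, ha', z - (cofreeObj T).obj.d m n _, hza,
    Subsingleton.elim (α := PUnit) _ _, Subsingleton.elim (α := PUnit) _ _,
    (add_sub_cancel _ _).symm⟩

/-- Cofibrations have filtered retractions in each degree. -/
theorem exists_filtered_retraction {f : V ⟶ W} (h : (genCof R).rlp.llp f) :
    ∃ r : ∀ n, W.obj.X n →ₗ[R] V.obj.X n, (∀ n p x, x ∈ W.obj.F n p → r n x ∈ V.obj.F n p) ∧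
      ∀ n v, r n (hf f n v) = v := by
  have := h _ (rlp_genCof_cofree V)
  -- The unit `V → cofreeObj V` extends along `f`, and projecting the extension to the cogenerators
  -- is the retraction.
  have sq : CommSq (cofreeLift (T := V) (fun _ => LinearMap.id) fun _ _ _ h => h) f
    (zeroHom (cofreeObj V) (zeroObj R)) (zeroHom W (zeroObj R)) :=
    ⟨hom_ext' fun i x => Subsingleton.elim (α := PUnit) _ _⟩
  refine ⟨fun n => cofreeEv V n n ∘ₗ hf sq.lift n, fun n p x hx => ?_, fun n v => ?_⟩
  · have := cofreeEv_mem (j := n) (f_F sq.lift hx)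
    rwa [sub_self] at this
  · rw [LinearMap.comp_apply, ← hf_comp, sq.fac_left, cofreeEv_lift, LinearMap.id_apply]

end Cofree

/-! ### Limits, formed degreewise -/

section Limits

variable {R : Type u} [CommRing R]

/-- The limit of a diagram of complete gr-dg modules. -/
def limObj {J : Type u} [Category.{u} J] (D : J ⥤ CompleteGrDGMod R) : CompleteGrDGMod R where
  obj :=
    { X := fun n =>
        ({ carrier := {x | ∀ i j (f : i ⟶ j), hf (D.map f) n (x i) = x j}
           add_mem' := fun ha hb i j f => by
             rw [Pi.add_apply, map_add, ha i j f, hb i j f, Pi.add_apply]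
           zero_mem' := fun i j f => map_zero _
           smul_mem' := fun c a ha i j f => by
             rw [Pi.smul_apply, map_smul, ha i j f, Pi.smul_apply] } :
          Submodule R (∀ j, (D.obj j).obj.X n))
      F := fun n p =>
        { carrier := {x | ∀ j, x.1 j ∈ (D.obj j).obj.F n p}
          add_mem' := fun ha hb j => add_mem (ha j) (hb j)
          zero_mem' := fun _ => zero_mem _
          smul_mem' := fun c a ha j => Submodule.smul_mem _ c (ha j) }
      F_zero := fun n => Submodule.eq_top_iff'.2 fun x j => mem_F_zero _ _
      F_anti := fun n p q h x hx j => (D.obj j).obj.F_anti n h (hx j)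
      d := fun n m => (LinearMap.pi fun j => (D.obj j).obj.d n m ∘ₗ LinearMap.proj j).restrict
        fun x hx i j f => by
          change hf (D.map f) m ((D.obj i).obj.d n m (x i)) = (D.obj j).obj.d n m (x j)
          rw [f_d, hx i j f]
      d_shape := fun n m h => LinearMap.ext fun x => Subtype.ext (funext fun j => by
        change (D.obj j).obj.d n m (x.1 j) = 0
        rw [(D.obj j).obj.d_shape n m h, LinearMap.zero_apply])
      d_F := fun n m p x hx j => d_mem (hx j)
      d_d := fun n m k p x hx j => d_d_mem (hx j) }
  property n := isCompleteFilt_of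
    (fun x hx => Subtype.ext (funext fun j => ((D.obj j).property n).eq_zero fun p => hx p j))
    (fun s hs => by
      choose x hx using fun j => ((D.obj j).property n).exists_limit
        (fun p => (s p).1 j) fun p => hs p j
      refine ⟨⟨x, fun i j f => ((D.obj j).property n).eq_of_sub_mem fun p => ?_⟩,
        fun p j => hx j p⟩
      have := sub_mem (f_F (D.map f) (hx i p)) (hx j p)
      rwa [map_sub, (s p).2 i j f, sub_sub_sub_cancel_right] at this)

/-- The limit cone of a diagram of complete gr-dg modules. -/
def limCone {J : Type u} [Category.{u} J] (D : J ⥤ CompleteGrDGMod R) : Cone D where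
  pt := limObj D
  π :=
    { app := fun j => ObjectProperty.homMk
        { f := fun n => LinearMap.proj j ∘ₗ Submodule.subtype _
          f_F := fun n p x hx => hx j
          f_d := fun n m x => rfl }
      naturality := fun i j f => hom_ext' fun n x => (x.2 i j f).symm }

/-- The limit cone is a limit cone. -/
def limConeIsLimit {J : Type u} [Category.{u} J] (D : J ⥤ CompleteGrDGMod R) :
    IsLimit (limCone D) where
  lift s := ObjectProperty.homMk
    { f := fun n => (LinearMap.pi fun j => (hf (V := s.pt) (s.π.app j) n)).codRestrict _
        fun x i j f => by exact hf_congr (s.w f) n x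
      f_F := fun n p x hx j => f_F _ hx
      f_d := fun n m x => Subtype.ext (funext fun j => f_d (s.π.app j) n m x) }
  fac s j := rfl
  uniq s m hm := hom_ext' fun n x => Subtype.ext (funext fun j => hf_congr (hm j) n x)

instance : HasLimits (CompleteGrDGMod R) where
  has_limits_of_shape _ _ := ⟨fun D => ⟨⟨⟨limCone D, limConeIsLimit D⟩⟩⟩⟩

end Limits

/-! ### Generators, cogenerators and colimits -/

section Colimits

theorem isIso_of_bijective {R : Type u} [CommRing R] {V W : CompleteGrDGMod R} (f : V ⟶ W)
    (hs : ∀ (q : ℕ) (n : ℤ), ∀ w ∈ W.obj.F n q, ∃ v ∈ V.obj.F n q, hf f n v = w)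
    (hi : ∀ n x, hf f n x = 0 → x = 0) : IsIso f := by
  have hi' : ∀ n, Function.Injective (hf f n) := fun n =>
    (injective_iff_map_eq_zero (hf f n)).2 (hi n)
  let e := fun n => LinearEquiv.ofBijective (hf f n) ⟨hi' n, fun w => by
    obtain ⟨v, -, hv⟩ := hs 0 n w (mem_F_zero _ w)
    exact ⟨v, hv⟩⟩
  have he : ∀ n w, hf f n ((e n).symm w) = w := fun n => (e n).apply_symm_apply
  refine ⟨ObjectProperty.homMk
    { f := fun n => (e n).symm.toLinearMap
      f_F := fun n p x hx => ?_
      f_d := fun n m x => hi' m ?_ }, hom_ext' fun n x => hi' n (he n _), hom_ext' fun n x => he n x⟩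
  · obtain ⟨v, hv, rfl⟩ := hs p n x hx
    rwa [show (e n).symm.toLinearMap (hf f n v) = v from hi' n (he n _)]
  · refine (he m _).trans ?_
    rw [f_d]
    exact congrArg _ (he n x).symm

variable (R : Type u)

/-- The objects `𝒵^{0,∞}_{q,n}`. -/
def towers [CommRing R] : ObjectProperty (CompleteGrDGMod R) :=
  ObjectProperty.ofObj fun x : ℕ × ℤ => Z0 R x.1 x.2

instance [CommRing R] : ObjectProperty.Small.{u} (towers R) := by
  have : Small.{u} (ℕ × ℤ) := small_lift _
  exact inferInstanceAs (ObjectProperty.Small.{u} (ObjectProperty.ofObj _))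

theorem isSeparating_towers [CommRing R] : (towers R).IsSeparating := fun V W f g h =>
  hom_ext' fun n x => by
    have := hf_congr (h _ (ObjectProperty.ofObj_apply _ (0, n)) (Z0desc x (mem_F_zero _ x))) n
      (Z0gen 0 n)
    rwa [hf_comp, hf_comp, Z0desc_gen] at this

/-- Composition with `f` on maps out of `Z0 R q n` is `f` on `F_q` in degree `n`. The hypotheses
thus say that `f` is injective and maps each `F_q` onto `F_q`. -/
theorem isIso_of_towers [CommRing R] {V W : CompleteGrDGMod R} (f : V ⟶ W)
    (hs : ∀ q n, Function.Surjective (fun g : Z0 R q n ⟶ V => g ≫ f))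
    (hi : ∀ n, Function.Injective (fun g : Z0 R 0 n ⟶ V => g ≫ f)) : IsIso f := by
  refine isIso_of_bijective f (fun q n w hw => ?_) fun n x hx => ?_
  · obtain ⟨g, hg⟩ := hs q n (Z0desc w hw)
    refine ⟨hf g n (Z0gen q n), f_F g (Z0gen_mem q n), ?_⟩
    rw [← hf_comp, show g ≫ f = _ from hg, Z0desc_gen]
  · have h := @hi n (Z0desc x (mem_F_zero _ x)) (Z0desc 0 (zero_mem _))
      (Z0_ext (by
        change hf (_ ≫ f) n _ = hf (_ ≫ f) n _
        rw [hf_comp, hf_comp, Z0desc_gen, Z0desc_gen, hx, map_zero]))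
    rw [← Z0desc_gen (q := 0) x (mem_F_zero _ x), h, Z0desc_gen]

theorem isDetecting_towers [CommRing R] : (towers R).IsDetecting := fun V W f h =>
  isIso_of_towers R f
    (fun q n g => (h _ (ObjectProperty.ofObj_apply _ (q, n)) g).exists)
    (fun n g g' hg => (h _ (ObjectProperty.ofObj_apply _ (0, n)) (g' ≫ f)).unique hg rfl)

theorem isStrongGenerator_towers [CommRing R] : (towers R).IsStrongGenerator :=
  ObjectProperty.isStrongGenerator_iff.2 ⟨isSeparating_towers R, fun V W f _ h =>
    isIso_of_towers R f (fun q n => h _ (ObjectProperty.ofObj_apply _ (q, n)))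
      (fun n g g' hg => (cancel_mono f).1 hg)⟩

/-- The cofree objects on the `𝒵^{0,∞}_{q,n}`. -/
def cotowers [CommRing R] : ObjectProperty (CompleteGrDGMod R) :=
  ObjectProperty.ofObj fun x : ℕ × ℤ => cofreeObj (Z0 R x.1 x.2)

instance [CommRing R] : ObjectProperty.Small.{u} (cotowers R) := by
  have : Small.{u} (ℕ × ℤ) := small_lift _
  exact inferInstanceAs (ObjectProperty.Small.{u} (ObjectProperty.ofObj _))

/-- A nonzero difference `f x - g x` lies outside some `F_q`, and over a field a functional kills
`F_q` but not this difference. Placed on a generator of weight exactly `q` it is a filtered map, and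
so it gives a morphism to a cofree object. -/
theorem isCoseparating_cotowers [Field R] : (cotowers R).IsCoseparating := by
  intro V W f g h
  by_contra hfg
  obtain ⟨n, x, hx⟩ : ∃ n x, hf f n x ≠ hf g n x := by
    by_contra! H
    exact hfg (hom_ext' H)
  obtain ⟨q, hq⟩ : ∃ q, hf f n x - hf g n x ∉ W.obj.F n q := by
    by_contra! H
    exact hx ((W.property n).eq_of_sub_mem H)
  obtain ⟨φ, hφ, hφ'⟩ := Submodule.exists_le_ker_of_notMem hq
  have hr : ∀ j p y, y ∈ W.obj.F j p →
      ((castX (Z0 R q n) n j ∘ₗ LinearMap.toSpanSingleton R _ (Z0gen q n)) ∘ₗ φ ∘ₗ castX W j n) y ∈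
        (Z0 R q n).obj.F j p := by
    intro j p y hy
    change castX (Z0 R q n) n j (φ (castX W j n y) • Z0gen q n) ∈ _
    have hy' := castX_mem W j n hy
    -- For `p ≤ q` the generator already lies in `F p`, and for `p ≥ q` the functional vanishes on
    -- `F p`.
    rcases le_total p q with hpq | hpq
    · exact castX_mem _ _ _ (Submodule.smul_mem _ _ ((Z0 R q n).obj.F_anti n hpq (Z0gen_mem q n)))
    · rw [show φ (castX W j n y) = 0 from hφ' (W.obj.F_anti n hpq hy'), zero_smul, map_zero]
      exact zero_mem _
  have h1 := hf_congr (h _ (ObjectProperty.ofObj_apply _ (q, n)) (cofreeLift _ hr)) n x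
  rw [hf_comp, hf_comp] at h1
  have h2 := congrArg (cofreeEv (Z0 R q n) n n) h1
  rw [cofreeEv_lift, cofreeEv_lift] at h2
  change castX (Z0 R q n) n n (φ (castX W n n _) • Z0gen q n) =
    castX (Z0 R q n) n n (φ (castX W n n _) • Z0gen q n) at h2
  rw [castX_self, castX_self, castX_self, castX_self] at h2
  have h3 : φ (hf f n x) • (1 : R) = φ (hf g n x) • (1 : R) :=
    congrArg (towerCoe (w := fun k => q + k / 2) n) h2
  rw [smul_eq_mul, smul_eq_mul, mul_one, mul_one] at h3
  exact hφ (by rw [map_sub, h3, sub_self])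

instance [CommRing R] : WellPowered.{u} (CompleteGrDGMod R) :=
  wellPowered_of_isDetecting (isDetecting_towers R)

/-- Special adjoint functor theorem: the category is complete and well-powered and has a small
coseparating family. -/
instance [Field R] : HasColimits (CompleteGrDGMod R) :=
  hasColimits_of_hasLimits_of_isCoseparating (isCoseparating_cotowers R)

end Colimits

end CompleteGrDGMod

end GrDG

namespace GrDG

open FiltGrDGMod

namespace CompleteGrDGMod

/-! ### Colimits of `ℵ₁`-filtered diagrams -/

section FilteredColimits

open IsFiltered (leftToMax rightToMax)

variable {R : Type u} [CommRing R] {J : Type u} [SmallCategory J] (D : J ⥤ CompleteGrDGMod R)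

variable (R) in
/-- The functor sending a complete gr-dg module to its degree `n` part. -/
def degFunctor (n : ℤ) : CompleteGrDGMod R ⥤ ModuleCat.{u} R where
  obj V := ModuleCat.of R (V.obj.X n)
  map f := ModuleCat.ofHom (hf f n)

/-- The colimit of the degree `n` parts of a diagram. -/
abbrev ColimX (n : ℤ) : Type u := ↥(colimit (D ⋙ degFunctor R n))

/-- The canonical map to the colimit of the degree `n` parts of a diagram. -/
def colimι (n : ℤ) (j : J) : (D.obj j).obj.X n →ₗ[R] ColimX D n :=
  (colimit.ι (D ⋙ degFunctor R n) j).hom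

variable {D}

theorem colimι_map {n : ℤ} {j k : J} (f : j ⟶ k) (x : (D.obj j).obj.X n) :
    colimι D n k (hf (D.map f) n x) = colimι D n j x :=
  ConcreteCategory.congr_hom (colimit.w (D ⋙ degFunctor R n) f) x

/-- The cocone on the degree `n` parts of a diagram given by a compatible family. -/
def degCocone {n : ℤ} {N : Type u} [AddCommGroup N] [Module R N]
    (g : ∀ j, (D.obj j).obj.X n →ₗ[R] N)
    (hg : ∀ j k (f : j ⟶ k) x, g k (hf (D.map f) n x) = g j x) :
    Cocone (D ⋙ degFunctor R n) where
  pt := ModuleCat.of R N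
  ι :=
    { app := fun j => ModuleCat.ofHom (g j)
      naturality := fun j k f => by
        ext x
        exact hg j k f x }

/-- Maps out of the colimit of the degree `n` parts of a diagram. -/
def colimDesc {n : ℤ} {N : Type u} [AddCommGroup N] [Module R N]
    (g : ∀ j, (D.obj j).obj.X n →ₗ[R] N)
    (hg : ∀ j k (f : j ⟶ k) x, g k (hf (D.map f) n x) = g j x) : ColimX D n →ₗ[R] N :=
  (colimit.desc (D ⋙ degFunctor R n) (degCocone g hg)).hom

theorem colimDesc_ι {n : ℤ} {N : Type u} [AddCommGroup N] [Module R N]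
    (g : ∀ j, (D.obj j).obj.X n →ₗ[R] N)
    (hg : ∀ j k (f : j ⟶ k) x, g k (hf (D.map f) n x) = g j x) (j : J)
    (x : (D.obj j).obj.X n) : colimDesc g hg (colimι D n j x) = g j x :=
  ConcreteCategory.congr_hom (colimit.ι_desc (degCocone g hg) j) x

theorem exists_colimι_eq [IsFiltered J] {n : ℤ} (x : ColimX D n) :
    ∃ j y, colimι D n j y = x :=
  Concrete.colimit_exists_rep (D ⋙ degFunctor R n) x

theorem colimι_eq_zero [IsFiltered J] {n : ℤ} {j : J} {x : (D.obj j).obj.X n}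
    (h : colimι D n j x = 0) : ∃ (k : J) (f : j ⟶ k), hf (D.map f) n x = 0 :=
  Concrete.colimit_rep_eq_zero R (D ⋙ degFunctor R n) j x h

variable (D)

/-- The filtration of the colimit of the degree `n` parts of a filtered diagram. -/
def colimF [IsFiltered J] (n : ℤ) (p : ℕ) : Submodule R (ColimX D n) where
  carrier := {x | ∃ j, ∃ y ∈ (D.obj j).obj.F n p, colimι D n j y = x}
  add_mem' := by
    rintro _ _ ⟨j, y, hy, rfl⟩ ⟨k, z, hz, rfl⟩
    exact ⟨_, _, add_mem (f_F (D.map (leftToMax j k)) hy) (f_F (D.map (rightToMax j k)) hz), by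
      rw [map_add, colimι_map, colimι_map]⟩
  zero_mem' := ⟨IsFiltered.nonempty.some, 0, zero_mem _, map_zero _⟩
  smul_mem' := by
    rintro c _ ⟨j, y, hy, rfl⟩
    exact ⟨j, c • y, Submodule.smul_mem _ c hy, map_smul _ _ _⟩

variable {D}

theorem colimι_mem_iff [IsFiltered J] {n : ℤ} {p : ℕ} {j : J} {x : (D.obj j).obj.X n} :
    colimι D n j x ∈ colimF D n p ↔
      ∃ (k : J) (f : j ⟶ k), hf (D.map f) n x ∈ (D.obj k).obj.F n p := by
  constructor
  · rintro ⟨k, y, hy, hyx⟩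
    obtain ⟨l, f, hl⟩ := colimι_eq_zero (x := hf (D.map (leftToMax j k)) n x -
      hf (D.map (rightToMax j k)) n y) (by rw [map_sub, colimι_map, colimι_map, hyx, sub_self])
    refine ⟨l, leftToMax j k ≫ f, ?_⟩
    rw [D.map_comp, hf_comp, ← sub_add_cancel (hf (D.map (leftToMax j k)) n x)
      (hf (D.map (rightToMax j k)) n y), map_add, hl, zero_add]
    exact f_F _ (f_F _ hy)
  · rintro ⟨k, f, h⟩
    exact ⟨k, _, h, colimι_map f x⟩

variable (D) in
/-- The predifferential of the colimit. -/
def colimD (n m : ℤ) : ColimX D n →ₗ[R] ColimX D m :=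
  colimDesc (fun j => colimι D m j ∘ₗ (D.obj j).obj.d n m) fun j k f x => by
    rw [LinearMap.comp_apply, LinearMap.comp_apply, ← f_d, colimι_map]

theorem colimD_ι (n m : ℤ) (j : J) (x : (D.obj j).obj.X n) :
    colimD D n m (colimι D n j x) = colimι D m j ((D.obj j).obj.d n m x) :=
  colimDesc_ι _ _ j x

theorem colimF_antitone [IsFiltered J] (n : ℤ) : Antitone (colimF D n) := by
  rintro p q h _ ⟨j, y, hy, rfl⟩
  exact ⟨j, y, (D.obj j).obj.F_anti n h hy, rfl⟩

section

open Cardinal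

instance fact_isRegular_aleph_one : Fact (ℵ₁ : Cardinal.{u}).IsRegular := ⟨isRegular_aleph_one⟩

theorem hasCardinalLT_nat : HasCardinalLT ℕ (ℵ₁ : Cardinal.{u}) := by
  rw [HasCardinalLT]
  simp

variable [IsCardinalFiltered J (ℵ₁ : Cardinal.{u})]

/-- Each membership holds from some stage on, and an `ℵ₁`-filtered category bounds countably many
stages. -/
theorem exists_common_stage [IsFiltered J] {n : ℤ} {j : J} (c : ℕ → ℕ)
    (y : ℕ → (D.obj j).obj.X n)
    (hy : ∀ p, colimι D n j (y p) ∈ colimF D n (c p)) :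
    ∃ (k : J) (f : j ⟶ k), ∀ p, hf (D.map f) n (y p) ∈ (D.obj k).obj.F n (c p) := by
  choose k f hkf using fun p => colimι_mem_iff.1 (hy p)
  obtain ⟨m, a, b, hab⟩ := IsCardinalFiltered.wideSpan f hasCardinalLT_nat
  refine ⟨m, b, fun p => ?_⟩
  rw [← hab p, D.map_comp, hf_comp]
  exact f_F _ (hkf p)

/-- A Cauchy sequence, with all its estimates, consists of countably many data, so it already lives
at one stage and converges there. No completion of the colimit is needed. -/
theorem colim_isComplete [IsFiltered J] (n : ℤ) :
    IsCompleteFilt (colimF_antitone (D := D) n) := by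
  refine isCompleteFilt_of (fun x hx => ?_) fun s hs => ?_
  · obtain ⟨j, y, rfl⟩ := exists_colimι_eq x
    obtain ⟨k, f, hf'⟩ := exists_common_stage id (fun _ => y) hx
    rw [← colimι_map f, ((D.obj k).property n).eq_zero hf', map_zero]
  · choose j y hy using fun p => exists_colimι_eq (s p)
    set i := IsCardinalFiltered.max j (hasCardinalLT_nat.{u})
    let u : ∀ p, j p ⟶ i := IsCardinalFiltered.toMax j hasCardinalLT_nat
    have hu : ∀ p, colimι D n i (hf (D.map (u p)) n (y p)) = s p := fun p => by
      rw [colimι_map, hy]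
    obtain ⟨k, f, hf'⟩ := exists_common_stage id
      (fun p => hf (D.map (u (p + 1))) n (y (p + 1)) - hf (D.map (u p)) n (y p))
      (fun p => by rw [map_sub, hu, hu]; exact hs p)
    obtain ⟨x, hx⟩ := ((D.obj k).property n).exists_limit
      (fun p => hf (D.map f) n (hf (D.map (u p)) n (y p))) fun p => by
        rw [← map_sub]
        exact hf' p
    refine ⟨colimι D n k x, fun p => ⟨k, _, hx p, ?_⟩⟩
    rw [map_sub, colimι_map, hu]

variable (D) in
/-- The colimit of an `ℵ₁`-filtered diagram of complete gr-dg modules. -/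
def colimObj [IsFiltered J] : CompleteGrDGMod R where
  obj :=
    { X := fun n => ColimX D n
      F := fun n p => colimF D n p
      F_zero := fun n => Submodule.eq_top_iff'.2 fun x => by
        obtain ⟨j, y, rfl⟩ := exists_colimι_eq x
        exact ⟨j, y, mem_F_zero _ y, rfl⟩
      F_anti := fun n => colimF_antitone n
      d := fun n m => colimD D n m
      d_shape := fun n m h => LinearMap.ext fun x => by
        obtain ⟨j, y, rfl⟩ := exists_colimι_eq x
        rw [colimD_ι, (D.obj j).obj.d_shape n m h, LinearMap.zero_apply, map_zero,
          LinearMap.zero_apply]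
      d_F := by
        rintro n m p _ ⟨j, y, hy, rfl⟩
        rw [colimD_ι]
        exact ⟨j, _, d_mem hy, rfl⟩
      d_d := by
        rintro n m k p _ ⟨j, y, hy, rfl⟩
        rw [colimD_ι, colimD_ι]
        exact ⟨j, _, d_d_mem hy, rfl⟩ }
  property n := colim_isComplete n

variable (D) in
/-- The colimit cocone of an `ℵ₁`-filtered diagram of complete gr-dg modules. -/
def colimCocone [IsFiltered J] : Cocone D where
  pt := colimObj D
  ι :=
    { app := fun j => ObjectProperty.homMk
        { f := fun n => colimι D n j
          f_F := fun n p x hx => ⟨j, x, hx, rfl⟩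
          f_d := fun n m x => (colimD_ι n m j x).symm }
      naturality := fun j k f => hom_ext' fun n x => colimι_map f x }

variable (D) in
/-- The cocone `colimCocone` is a colimit cocone. -/
def colimCoconeIsColimit [IsFiltered J] : IsColimit (colimCocone D) where
  desc s := ObjectProperty.homMk
    { f := fun n => colimDesc (fun j => hf (W := s.pt) (s.ι.app j) n)
        fun j k f x => by exact hf_congr (s.w f) n x
      f_F := by
        rintro n p _ ⟨j, y, hy, rfl⟩
        change colimDesc _ _ (colimι D n j y) ∈ _
        rw [colimDesc_ι]
        exact f_F _ hy
      f_d := fun n m x => by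
        obtain ⟨j, y, rfl⟩ := exists_colimι_eq x
        change colimDesc _ _ (colimD D n m (colimι D n j y)) = _
        rw [colimD_ι, colimDesc_ι]
        change _ = s.pt.obj.d n m (colimDesc _ _ (colimι D n j y))
        rw [colimDesc_ι]
        exact f_d (s.ι.app j) n m y }
  fac s j := hom_ext' fun n x => colimDesc_ι _ _ j x
  uniq s m hm := hom_ext' fun n x => by
    obtain ⟨j, y, rfl⟩ := exists_colimι_eq x
    refine (hf_congr (hm j) n y).trans (Eq.symm ?_)
    change colimDesc _ _ (colimι D n j y) = _
    rw [colimDesc_ι]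

/-- A criterion for `ℵ₁`-presentability of an object which is generated by one element. -/
theorem isCardinalPresentable_of_generator (A : CompleteGrDGMod R) {n : ℤ} (g : A.obj.X n)
    (hext : ∀ {V : CompleteGrDGMod R} {f f' : A ⟶ V}, hf f n g = hf f' n g → f = f')
    (hlift : ∀ {J : Type u} [SmallCategory J] [IsFiltered J]
      [IsCardinalFiltered J (ℵ₁ : Cardinal.{u})] (D : J ⥤ CompleteGrDGMod R)
      (f : A ⟶ colimObj D), ∃ (j : J) (f' : A ⟶ D.obj j), colimι D n j (hf f' n g) = hf f n g) :
    IsCardinalPresentable A (ℵ₁ : Cardinal.{u}) where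
  preservesColimitOfShape J _ _ := ⟨fun {D} => by
    have := isFiltered_of_isCardinalFiltered J (ℵ₁ : Cardinal.{u})
    refine preservesColimit_of_preserves_colimit_cocone (colimCoconeIsColimit D)
      (Types.FilteredColimit.isColimitOf' _ _ (fun f => ?_) fun j f f' h => ?_)
    · obtain ⟨j, f', hf'⟩ := hlift D f
      exact ⟨j, f', hext hf'.symm⟩
    · have h1 : colimι D n j (hf (V := A) f n g - hf (V := A) f' n g) = 0 := by
        rw [map_sub, sub_eq_zero]
        exact hf_congr (V := A) h n g
      obtain ⟨k, u, hu⟩ := colimι_eq_zero h1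
      refine ⟨k, u, hext ?_⟩
      rw [map_sub, sub_eq_zero] at hu
      exact hu⟩

instance (q : ℕ) (n : ℤ) : IsCardinalPresentable (Z0 R q n) (ℵ₁ : Cardinal.{u}) := by
  refine isCardinalPresentable_of_generator _ (Z0gen q n) Z0_ext fun D f => ?_
  obtain ⟨j, y, hy, h⟩ : hf f n (Z0gen q n) ∈ colimF D n q := f_F f (Z0gen_mem q n)
  exact ⟨j, Z0desc y hy, by rw [Z0desc_gen, h]⟩

instance (q : ℕ) (n : ℤ) : IsCardinalPresentable (Z1 R q n) (ℵ₁ : Cardinal.{u}) := by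
  refine isCardinalPresentable_of_generator _ (Z1gen q n) Z1_ext fun D f => ?_
  obtain ⟨j, y, hy, h⟩ : hf f n (Z1gen q n) ∈ colimF D n q := f_F f (Z1gen_mem q n)
  have hl : n - 1 + 1 = n := by ring
  have h1 : colimι D (n - 1) j ((D.obj j).obj.d n (n - 1) y) ∈ colimF D (n - 1) (q + 1) := by
    rw [← colimD_ι, h]
    have := f_F f (d_Z1gen_mem q hl)
    rwa [f_d] at this
  -- The differential of the representative has weight `q + 1` only in the colimit. It acquires this
  -- weight at a later stage `k`.
  obtain ⟨k, u, hk⟩ := colimι_mem_iff.1 h1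
  rw [f_d] at hk
  exact ⟨k, Z1desc hl _ (f_F (D.map u) hy) hk, by rw [Z1desc_gen, colimι_map, h]⟩

end

end FilteredColimits

/-! ### Local presentability and the small object argument -/

section Presentable

open Cardinal

variable (R : Type u) [Field R]

instance : IsCardinalLocallyPresentable (CompleteGrDGMod R) (ℵ₁ : Cardinal.{u}) :=
  (IsCardinalLocallyPresentable.iff_exists_isStrongGenerator _ _).2
    ⟨towers R, inferInstance, isStrongGenerator_towers R, by
      rintro _ ⟨q, n⟩
      exact inferInstanceAs (IsCardinalPresentable (Z0 R q n) (ℵ₁ : Cardinal.{u}))⟩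

instance : IsLocallyPresentable.{u} (CompleteGrDGMod R) :=
  ⟨ℵ₁, inferInstance, inferInstance⟩

variable {R}

/-- Every object of a locally presentable category is presentable, so it is small relative to any
class of maps. -/
theorem isSmallRelativeTo (A : CompleteGrDGMod R) (N : MorphismProperty (CompleteGrDGMod R)) :
    IsSmallRelativeTo A N := by
  obtain ⟨κ, hκ, _⟩ := (inferInstance : IsPresentable.{u} A).exists_cardinal
  refine ⟨κ, hκ, fun J _ _ _ _ _ _ F _ _ => ?_⟩
  have := preservesColimitsOfShape_of_isCardinalPresentable A κ J
  infer_instance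

theorem hasSmallObjectArgument {I : MorphismProperty (CompleteGrDGMod R)}
    (κ : Cardinal.{u}) [Fact κ.IsRegular] [MorphismProperty.IsSmall.{u} I]
    (h : ∀ {A B : CompleteGrDGMod R} (i : A ⟶ B), I i → IsCardinalPresentable A κ) :
    MorphismProperty.HasSmallObjectArgument.{u} I := by
  have hκ : κ ≠ 0 := (Cardinal.IsRegular.pos Fact.out).ne'
  have : Nonempty κ.ord.ToType := by
    rw [← Cardinal.mk_ne_zero_iff, Cardinal.mk_ord_toType]
    exact hκ
  let _ : OrderBot κ.ord.ToType := WellFoundedLT.toOrderBot _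
  refine ⟨κ, inferInstance, inferInstance, { preservesColimit := fun {A B X Y} i hi f hf => ?_ }⟩
  have := h i hi
  have := preservesColimitsOfShape_of_isCardinalPresentable A κ κ.ord.ToType
  infer_instance

instance : MorphismProperty.IsSmall.{u} (genCof R) := by
  have : Small.{u} (ℕ × ℤ) := small_lift _
  exact inferInstanceAs (MorphismProperty.IsSmall.{u} (MorphismProperty.ofHoms _))

instance : MorphismProperty.IsSmall.{u} (genTrivCof R) := by
  have : Small.{u} (ℕ × ℤ) := small_lift _
  exact inferInstanceAs (MorphismProperty.IsSmall.{u} (MorphismProperty.ofHoms _))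

instance : MorphismProperty.HasSmallObjectArgument.{u} (genCof R) :=
  hasSmallObjectArgument ℵ₁ (by
    rintro _ _ _ ⟨q, n⟩
    exact inferInstanceAs (IsCardinalPresentable (Z1 R q n) (ℵ₁ : Cardinal.{u})))

instance : MorphismProperty.HasSmallObjectArgument.{u} (genTrivCof R) := by
  obtain ⟨κ, hκ, _⟩ := (inferInstance : IsPresentable.{u} (zeroObj R)).exists_cardinal
  exact hasSmallObjectArgument κ (by
    rintro _ _ _ ⟨q, n⟩
    exact inferInstanceAs (IsCardinalPresentable (zeroObj R) κ))

end Presentable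

end CompleteGrDGMod

end GrDG

namespace GrDG

open FiltGrDGMod

namespace CompleteGrDGMod

/-! ### The model structure -/

section ModelStructure

variable (R : Type u) [Field R]

variable {R} in
theorem gr_map_comp {X Y Z : CompleteGrDGMod R} (f : X ⟶ Y) (g : Y ⟶ Z) (p : ℕ) :
    (gr p).map (f ≫ g).hom = (gr p).map f.hom ≫ (gr p).map g.hom :=
  (gr p).map_comp f.hom g.hom

instance : (gradedQuasiIso R).HasTwoOutOfThreeProperty where
  comp_mem f g hf hg p := by
    have := hf p
    have := hg p
    rw [gr_map_comp]
    infer_instance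
  of_postcomp f g hg hfg p := by
    have := hg p
    have h := hfg p
    rw [gr_map_comp] at h
    exact quasiIso_of_comp_right _ ((gr p).map g.hom)
  of_precomp f g hf hfg p := by
    have := hf p
    have h := hfg p
    rw [gr_map_comp] at h
    exact quasiIso_of_comp_left ((gr p).map f.hom) _

scoped instance : CategoryWithFibrations (CompleteGrDGMod R) := ⟨strictSurjection R⟩

scoped instance : CategoryWithCofibrations (CompleteGrDGMod R) := ⟨(genCof R).rlp.llp⟩

scoped instance : CategoryWithWeakEquivalences (CompleteGrDGMod R) := ⟨gradedQuasiIso R⟩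

theorem fibrations_eq : fibrations (CompleteGrDGMod R) = strictSurjection R := rfl

theorem cofibrations_eq : cofibrations (CompleteGrDGMod R) = (genCof R).rlp.llp := rfl

theorem trivialFibrations_eq : trivialFibrations (CompleteGrDGMod R) = (genCof R).rlp :=
  rlp_genCof.symm

/-- Retract argument: factor a trivial cofibration through the second factorization. By
two-out-of-three the fibration part is a weak equivalence, hence a trivial fibration, so the map
lifts against it and is a retract of the first factor. The converse is `gradedQuasiIso_of_llp`,
together with the fact that trivial fibrations are strict surjections. -/
theorem trivialCofibrations_eq :
    trivialCofibrations (CompleteGrDGMod R) = (genTrivCof R).rlp.llp := by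
  refine le_antisymm ?_ fun A B f h => ⟨?_, ?_⟩
  · rintro A B f ⟨hc, hw⟩
    obtain ⟨⟨Z, i, p, fac, hi, hp⟩⟩ :=
      MorphismProperty.HasFactorization.nonempty_mapFactorizationData
        (W₁ := (genTrivCof R).rlp.llp) (W₂ := (genTrivCof R).rlp) f
    have hiw : gradedQuasiIso R i := gradedQuasiIso_of_llp (by rwa [← rlp_genTrivCof])
    have hpw : gradedQuasiIso R p := MorphismProperty.of_precomp _ i p hiw (by rwa [fac])
    have hpc : (genCof R).rlp p := by
      rw [rlp_genCof]
      exact ⟨by rwa [← rlp_genTrivCof], hpw⟩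
    have : HasLiftingProperty f p := hc p hpc
    exact MorphismProperty.of_retract (RetractArrow.ofLeftLiftingProperty fac) hi
  · refine MorphismProperty.antitone_llp ?_ f h
    rw [rlp_genCof, rlp_genTrivCof]
    exact inf_le_left
  · exact gradedQuasiIso_of_llp (by rwa [← rlp_genTrivCof])

instance : MorphismProperty.IsWeakFactorizationSystem (cofibrations (CompleteGrDGMod R))
    (trivialFibrations (CompleteGrDGMod R)) := by
  rw [trivialFibrations_eq, cofibrations_eq]
  exact { rlp := MorphismProperty.rlp_llp_rlp _, llp := rfl }

instance : MorphismProperty.IsWeakFactorizationSystem (trivialCofibrations (CompleteGrDGMod R))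
    (fibrations (CompleteGrDGMod R)) := by
  rw [trivialCofibrations_eq, fibrations_eq, ← rlp_genTrivCof]
  exact { rlp := MorphismProperty.rlp_llp_rlp _, llp := rfl }

instance : (weakEquivalences (CompleteGrDGMod R)).HasTwoOutOfThreeProperty :=
  inferInstanceAs (gradedQuasiIso R).HasTwoOutOfThreeProperty

/-- The model structure on complete gr-dg modules. -/
scoped instance modelCategory : ModelCategory (CompleteGrDGMod R) := ModelCategory.mk' _

theorem hasFunctorialFactorizations : HasFunctorialFactorizations (CompleteGrDGMod R) where
  left := by
    change MorphismProperty.HasFunctorialFactorization (genCof R).rlp.llp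
      (trivialFibrations (CompleteGrDGMod R))
    rw [trivialFibrations_eq]
    infer_instance
  right := by
    change MorphismProperty.HasFunctorialFactorization (trivialCofibrations (CompleteGrDGMod R))
      (strictSurjection R)
    rw [trivialCofibrations_eq, ← rlp_genTrivCof]
    infer_instance

theorem isCofibrantlyGeneratedBy :
    IsCofibrantlyGeneratedBy (CompleteGrDGMod R) (genCof R) (genTrivCof R) where
  isSmall_I := inferInstance
  isSmall_J := inferInstance
  small_dom_I _ _ := isSmallRelativeTo _ _
  small_dom_J _ _ := isSmallRelativeTo _ _
  fibrations_eq := rlp_genTrivCof.symm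
  trivialFibrations_eq := trivialFibrations_eq R

theorem isCombinatorial : IsCombinatorial (CompleteGrDGMod R) where
  locallyPresentable := inferInstance
  cofibrantlyGenerated := ⟨_, _, isCofibrantlyGeneratedBy R⟩

end ModelStructure

end CompleteGrDGMod

end GrDG

namespace GrDG

open FiltGrDGMod

namespace CompleteGrDGMod

/-! ### Right properness -/

section Pullbacks

variable {R : Type u} [CommRing R] {P X Y Z : CompleteGrDGMod R}
  {g' : P ⟶ X} {p' : P ⟶ Y} {p : X ⟶ Z} {g : Y ⟶ Z}

/-- Since `Z0 R q n` corepresents `F_q` in degree `n`, the universal property computes pullbacks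
degreewise, filtration included. -/
theorem exists_of_isPullback (sq : IsPullback g' p' p g) {q : ℕ} {n : ℤ} {x : X.obj.X n}
    {y : Y.obj.X n} (hx : x ∈ X.obj.F n q) (hy : y ∈ Y.obj.F n q) (h : hf p n x = hf g n y) :
    ∃ v ∈ P.obj.F n q, hf g' n v = x ∧ hf p' n v = y := by
  have w : Z0desc x hx ≫ p = Z0desc y hy ≫ g := Z0_ext (by
    rw [hf_comp, hf_comp, Z0desc_gen, Z0desc_gen, h])
  refine ⟨hf (sq.lift _ _ w) n (Z0gen q n), f_F _ (Z0gen_mem q n), ?_, ?_⟩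
  · rw [← hf_comp, sq.lift_fst, Z0desc_gen]
  · rw [← hf_comp, sq.lift_snd, Z0desc_gen]

theorem mem_of_isPullback (sq : IsPullback g' p' p g) {q : ℕ} {n : ℤ} {v : P.obj.X n}
    (hx : hf g' n v ∈ X.obj.F n q) (hy : hf p' n v ∈ Y.obj.F n q) : v ∈ P.obj.F n q := by
  obtain ⟨w, hw, h₁, h₂⟩ := exists_of_isPullback sq hx hy (hf_congr sq.w n v)
  have : Z0desc v (mem_F_zero _ v) = Z0desc w (mem_F_zero _ w) := sq.hom_ext
    (Z0_ext (by rw [hf_comp, hf_comp, Z0desc_gen, Z0desc_gen, h₁]))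
    (Z0_ext (by rw [hf_comp, hf_comp, Z0desc_gen, Z0desc_gen, h₂]))
  rwa [← Z0desc_gen v (mem_F_zero _ v), this, Z0desc_gen]

/-- Graded quasi-isomorphisms are stable under pullback along strict surjections. -/
theorem gradedQuasiIso_of_isPullback (sq : IsPullback g' p' p g) (hp : strictSurjection R p)
    (hg : gradedQuasiIso R g) : gradedQuasiIso R g' := by
  rw [strictSurjection_iff] at hp
  rw [gradedQuasiIso_iff] at hg ⊢
  have hw : ∀ n v, hf p n (hf g' n v) = hf g n (hf p' n v) := hf_congr sq.w
  refine fun q m n l hm hl => ⟨?_, fun x hx hdx => ?_⟩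
  · rintro v hv hdv ⟨a, ha, hva⟩
    have h1 := f_F p hva
    rw [map_sub, hw, f_d] at h1
    obtain ⟨c, hc, hyc⟩ := (hg q m n l hm hl).1 (hf p' n v) (f_F _ hv)
      (by rw [← f_d]; exact f_F _ hdv) ⟨_, f_F p ha, h1⟩
    -- The primitives `p a` and `g c` have the same differential modulo weight `q + 1`. Their
    -- difference is thus a cycle, which surjectivity for `g` lifts to `c₂` up to `d h` and an
    -- error. Correcting `a` by lifts of those two makes it match `c + c₂` over `Z`.
    obtain ⟨c₂, hc₂, hdc₂, h, hh, hr⟩ := (hg q (m + 1) m n rfl hm).2 (hf p m a - hf g m c)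
      (sub_mem (f_F _ ha) (f_F _ hc)) (by
        have := sub_mem (f_F g hyc) h1
        rw [map_sub, sub_sub_sub_cancel_left, f_d] at this
        rwa [map_sub])
    obtain ⟨h', hh', rfl⟩ := hp _ _ h hh
    obtain ⟨r, hr', hpr⟩ := hp _ _ _ hr
    obtain ⟨b, hb, hb₁, hb₂⟩ := exists_of_isPullback sq (q := q)
      (x := a - X.obj.d (m + 1) m h' - r) (y := c + c₂)
      (sub_mem (sub_mem ha (d_mem hh')) (F_succ_le hr')) (add_mem hc hc₂) (by
        rw [map_sub, map_sub, f_d, hpr, map_add]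
        abel)
    refine ⟨b, hb, mem_of_isPullback sq ?_ ?_⟩
    · rw [map_sub, f_d, hb₁, map_sub, map_sub]
      have := add_mem (add_mem hva (d_d_mem (j := m) (k := n) hh')) (d_mem (j := n) hr')
      convert this using 1
      abel
    · rw [map_sub, f_d, hb₂, map_add, ← sub_sub]
      exact sub_mem hyc hdc₂
  · obtain ⟨y, hy, hdy, a, ha, hr⟩ := (hg q m n l hm hl).2 (hf p n x) (f_F _ hx)
      (by rw [← f_d]; exact f_F _ hdx)
    obtain ⟨a', ha', rfl⟩ := hp _ _ a ha
    obtain ⟨r, hr', hpr⟩ := hp _ _ _ hr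
    -- Subtracting lifts of the boundary and of the error from `x` makes its image equal to `g y`,
    -- so the pair lies in the pullback.
    obtain ⟨v, hv, hv₁, hv₂⟩ := exists_of_isPullback sq (q := q)
      (x := x - X.obj.d m n a' - r) (y := y)
      (sub_mem (sub_mem hx (d_mem ha')) (F_succ_le hr')) hy (by
        rw [map_sub, map_sub, f_d, hpr]
        abel)
    refine ⟨v, hv, mem_of_isPullback sq ?_ ?_, a', ha', ?_⟩
    · rw [f_d, hv₁, map_sub, map_sub]
      exact sub_mem (sub_mem hdx (d_d_mem ha')) (d_mem hr')
    · rwa [f_d, hv₂]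
    · rw [hv₁]
      convert hr' using 1
      abel

end Pullbacks

/-! ### Pushouts tested on filtered linear maps -/

section Pushouts

variable {R : Type u} [CommRing R] {A B X Y T : CompleteGrDGMod R}
  {i : A ⟶ B} {g : A ⟶ X} {g' : B ⟶ Y} {i' : X ⟶ Y}

/-- Forgetting `d` is a left adjoint, so it preserves pushouts. Concretely, `φ` and `ψ` are turned
into morphisms to a cofree object. -/
theorem filtered_ext_of_isPushout (sq : IsPushout i g g' i')
    {φ ψ : ∀ n, Y.obj.X n →ₗ[R] T.obj.X n} (hφ : ∀ n p x, x ∈ Y.obj.F n p → φ n x ∈ T.obj.F n p)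
    (hψ : ∀ n p x, x ∈ Y.obj.F n p → ψ n x ∈ T.obj.F n p)
    (h₁ : ∀ n b, φ n (hf g' n b) = ψ n (hf g' n b))
    (h₂ : ∀ n x, φ n (hf i' n x) = ψ n (hf i' n x)) (n : ℤ) (y : Y.obj.X n) : φ n y = ψ n y := by
  have : cofreeLift φ hφ = cofreeLift ψ hψ := sq.hom_ext
    (cofree_ext fun n v => by
      rw [hf_comp, hf_comp, cofreeEv_lift, cofreeEv_lift, h₁])
    (cofree_ext fun n v => by
      rw [hf_comp, hf_comp, cofreeEv_lift, cofreeEv_lift, h₂])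
  rw [← cofreeEv_lift φ hφ, this, cofreeEv_lift]

/-- The existence half of the same adjunction argument: the descent takes place among morphisms to
`cofreeObj T` and is then projected to `T`. -/
theorem exists_filtered_desc_of_isPushout (sq : IsPushout i g g' i')
    {β : ∀ n, B.obj.X n →ₗ[R] T.obj.X n} {ξ : ∀ n, X.obj.X n →ₗ[R] T.obj.X n}
    (hβ : ∀ n p x, x ∈ B.obj.F n p → β n x ∈ T.obj.F n p)
    (hξ : ∀ n p x, x ∈ X.obj.F n p → ξ n x ∈ T.obj.F n p)
    (h : ∀ n a, β n (hf i n a) = ξ n (hf g n a)) :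
    ∃ φ : ∀ n, Y.obj.X n →ₗ[R] T.obj.X n, (∀ n p x, x ∈ Y.obj.F n p → φ n x ∈ T.obj.F n p) ∧
      (∀ n b, φ n (hf g' n b) = β n b) ∧ ∀ n x, φ n (hf i' n x) = ξ n x := by
  have w : i ≫ cofreeLift β hβ = g ≫ cofreeLift ξ hξ := cofree_ext fun n v => by
    rw [hf_comp, hf_comp, cofreeEv_lift, cofreeEv_lift, h]
  refine ⟨fun n => cofreeEv T n n ∘ₗ hf (sq.desc _ _ w) n, fun n p x hx => ?_, fun n b => ?_,
    fun n x => ?_⟩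
  · have := cofreeEv_mem (j := n) (f_F (sq.desc _ _ w) hx)
    rwa [sub_self] at this
  · rw [LinearMap.comp_apply, ← hf_comp, sq.inl_desc, cofreeEv_lift]
  · rw [LinearMap.comp_apply, ← hf_comp, sq.inr_desc, cofreeEv_lift]

end Pushouts

/-! ### Left properness -/

section Proper

variable {R : Type u} [Field R] {A B X Y : CompleteGrDGMod R}
  {i : A ⟶ B} {g : A ⟶ X} {g' : B ⟶ Y} {i' : X ⟶ Y}

/-- The section comes from lifting the identity through `f` in each degree. It respects weights but
not `d`. -/
theorem exists_filtered_section {V W : CompleteGrDGMod R} {f : V ⟶ W}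
    (h : strictSurjection R f) : ∃ σ : ∀ n, W.obj.X n →ₗ[R] V.obj.X n,
      (∀ n p x, x ∈ W.obj.F n p → σ n x ∈ V.obj.F n p) ∧ ∀ n x, hf f n (σ n x) = x := by
  rw [strictSurjection_iff] at h
  choose σ hσ hσ' using fun n => exists_filtered_lift (W.obj.F_anti n) (W.obj.F_zero n)
    (V.property n) (W.property n) (hf f n) (fun p x hx => f_F f hx) (fun p y hy => h p n y hy) 0
    LinearMap.id (fun p x hx => hx)
  exact ⟨σ, hσ, hσ'⟩

/-- Trivial fibrations are stable under pushout along cofibrations. -/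
theorem rlp_genCof_of_isPushout (sq : IsPushout i g g' i') (hi : (genCof R).rlp.llp i)
    (hg : (genCof R).rlp g) : (genCof R).rlp g' := by
  rw [rlp_genCof] at hg
  have hK := isAcyclic_kerObj hg.1 hg.2
  obtain ⟨r, hr, hri⟩ := exists_filtered_retraction hi
  obtain ⟨σ, hσ, hgσ⟩ := exists_filtered_section hg.1
  have hw : ∀ n a, hf g' n (hf i n a) = hf i' n (hf g n a) := hf_congr sq.w
  -- The map `κ` retracts `B` to `A` and then projects to `ker g` along the section `σ`.
  let κ : ∀ n, B.obj.X n →ₗ[R] A.obj.X n := fun n =>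
    (LinearMap.id - σ n ∘ₗ hf g n) ∘ₗ r n
  have hκ : ∀ n b, κ n b = r n b - σ n (hf g n (r n b)) := fun n b => rfl
  have hκF : ∀ n p b, b ∈ B.obj.F n p → κ n b ∈ A.obj.F n p := fun n p b hb =>
    sub_mem (hr _ _ _ hb) (hσ _ _ _ (f_F g (hr _ _ _ hb)))
  have hgκ : ∀ n b, hf g n (κ n b) = 0 := fun n b => by
    rw [hκ, map_sub, hgσ, sub_self]
  -- A filtered section of `g'` is glued from `1 - i κ` on `B` and `i σ` on `X`.
  obtain ⟨σ', hσ', hσg, hσi⟩ := exists_filtered_desc_of_isPushout sq (T := B)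
    (β := fun n => LinearMap.id - hf i n ∘ₗ κ n) (ξ := fun n => hf i n ∘ₗ σ n)
    (fun n p x hx => sub_mem hx (f_F i (hκF n p x hx))) (fun n p x hx => f_F i (hσ _ _ _ hx))
    (fun n a => by
      change hf i n a - hf i n (κ n (hf i n a)) = hf i n (σ n (hf g n a))
      rw [hκ, hri, map_sub, sub_sub_cancel])
  have hσg' : ∀ n b, σ' n (hf g' n b) = b - hf i n (κ n b) := hσg
  have hsec : ∀ n y, hf g' n (σ' n y) = y := fun n y =>
    filtered_ext_of_isPushout sq (φ := fun n => hf g' n ∘ₗ σ' n) (ψ := fun n => LinearMap.id)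
      (fun n p x hx => f_F g' (hσ' _ _ _ hx)) (fun n p x hx => hx)
      (fun n b => by
        change hf g' n (σ' n (hf g' n b)) = hf g' n b
        rw [hσg', map_sub, hw, hgκ, map_zero, sub_zero])
      (fun n x => by
        change hf g' n (σ' n (hf i' n x)) = hf i' n x
        rw [hσi]
        change hf g' n (hf i n (σ n x)) = hf i' n x
        rw [hw, hgσ]) n y
  refine rlp_genCof_of_isAcyclic ((strictSurjection_iff g').2 fun q n w hw' =>
    ⟨σ' n w, hσ' _ _ _ hw', hsec n w⟩) ?_
  rintro p m n l hm hl ⟨b, hb⟩ hbF hdb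
  -- On `ker g'` the section gives `0 = b - i κ b`, so this kernel is the image of `ker g`, and its
  -- acyclicity is inherited through `i` and `r`.
  have hbi : b = hf i n (κ n b) := by
    have := hσg' n b
    rw [show hf g' n b = 0 from hb, map_zero] at this
    exact sub_eq_zero.1 this.symm
  have hdb' : B.obj.d n l b ∈ B.obj.F l (p + 1) := hdb
  obtain ⟨⟨a, ha⟩, haF, hka⟩ := hK p m n l hm hl ⟨κ n b, hgκ n b⟩ (hκF n p b hbF) (by
    change A.obj.d n l (κ n b) ∈ A.obj.F l (p + 1)
    rw [← hri l (A.obj.d n l (κ n b)), f_d, ← hbi]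
    exact hr _ _ _ hdb')
  refine ⟨⟨hf i m a, ?_⟩, f_F i haF, ?_⟩
  · rw [LinearMap.mem_ker, hw, show hf g m a = 0 from ha, map_zero]
  · change b - B.obj.d m n (hf i m a) ∈ B.obj.F n (p + 1)
    have h1 : hf i n (κ n b - A.obj.d m n a) ∈ B.obj.F n (p + 1) := f_F i hka
    rwa [map_sub, ← hbi, f_d] at h1

/-- Graded quasi-isomorphisms are stable under pushout along cofibrations. -/
theorem gradedQuasiIso_of_isPushout (sq : IsPushout i g g' i') (hi : (genCof R).rlp.llp i)
    (hg : gradedQuasiIso R g) : gradedQuasiIso R g' := by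
  -- With `g = j ≫ q`, the pushout of `j` is again a left-lifting map and the pushout of `q` is a
  -- trivial fibration. Both are graded quasi-isomorphisms.
  obtain ⟨⟨W, j, q, fac, hj, hq⟩⟩ :=
    MorphismProperty.HasFactorization.nonempty_mapFactorizationData
      (W₁ := (genTrivCof R).rlp.llp) (W₂ := (genTrivCof R).rlp) g
  subst fac
  rw [rlp_genTrivCof] at hq hj
  have hqw : (genCof R).rlp q := by
    rw [rlp_genCof]
    exact ⟨hq, MorphismProperty.of_precomp _ j q (gradedQuasiIso_of_llp hj) hg⟩
  have sq₁ := IsPushout.of_hasPushout i j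
  have w : i ≫ g' = j ≫ q ≫ i' := by rw [sq.w, Category.assoc]
  have sq₂ : IsPushout (pushout.inr i j) q (sq₁.desc g' (q ≫ i') w) i' :=
    (IsPushout.of_left (by rw [sq₁.inl_desc]; exact sq.flip) (sq₁.inr_desc _ _ _).symm
      sq₁.flip).flip
  have h₁ : gradedQuasiIso R (pushout.inl i j) :=
    gradedQuasiIso_of_llp (MorphismProperty.of_isPushout sq₁ hj)
  have h₂ : (genCof R).rlp (sq₁.desc g' (q ≫ i') w) :=
    rlp_genCof_of_isPushout sq₂ (MorphismProperty.of_isPushout sq₁.flip hi) hqw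
  rw [rlp_genCof] at h₂
  have := MorphismProperty.comp_mem _ _ _ h₁ h₂.2
  rwa [sq₁.inl_desc] at this

variable (R) in
theorem isProper : IsProper (CompleteGrDGMod R) where
  left _ _ _ _ sq hi hg := gradedQuasiIso_of_isPushout sq hi hg
  right _ _ _ _ sq hp hg := gradedQuasiIso_of_isPullback sq hp hg

end Proper

end CompleteGrDGMod

end GrDG

namespace GrDG

open FiltGrDGMod

namespace CompleteGrDGMod

/-! ### The internal hom and its adjunction -/

section InternalHom

variable {R : Type u} [CommRing R] (B T : CompleteGrDGMod R)

/-- Families of linear maps between the components of complete gr-dg modules. -/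
abbrev LinFam : Type u := ∀ i j, B.obj.X i →ₗ[R] T.obj.X j

/-- The families of linear maps of degree `n` that raise the filtration by `q`. -/
def homF (n : ℤ) (q : ℕ) : Submodule R (LinFam B T) where
  carrier := {z | ∀ i j, (i + n ≠ j → z i j = 0) ∧
    ∀ p x, x ∈ B.obj.F i p → z i j x ∈ T.obj.F j (p + q)}
  add_mem' ha hb i j := ⟨fun h => by
    rw [Pi.add_apply, Pi.add_apply, (ha i j).1 h, (hb i j).1 h, add_zero],
    fun p x hx => add_mem ((ha i j).2 p x hx) ((hb i j).2 p x hx)⟩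
  zero_mem' i j := ⟨fun _ => rfl, fun p x _ => zero_mem _⟩
  smul_mem' c a ha i j := ⟨fun h => by
    rw [Pi.smul_apply, Pi.smul_apply, (ha i j).1 h, smul_zero],
    fun p x hx => Submodule.smul_mem _ c ((ha i j).2 p x hx)⟩

theorem homF_anti (n : ℤ) : Antitone (homF B T n) := fun _ _ h _ hz i j =>
  ⟨(hz i j).1, fun p x hx => T.obj.F_anti j (by omega) ((hz i j).2 p x hx)⟩

/-- The component of the differential of a family of linear maps,
`(d z)_i = (-1)^i (d z_i - z_{i-1} d)`. -/
def homD₀ (i j : ℤ) : LinFam B T →ₗ[R] (B.obj.X i →ₗ[R] T.obj.X j) where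
  toFun z := sgn R i • (T.obj.d (j + 1) j ∘ₗ z i (j + 1) - z (i - 1) j ∘ₗ B.obj.d i (i - 1))
  map_add' z z' := by
    rw [Pi.add_apply, Pi.add_apply, Pi.add_apply, Pi.add_apply, LinearMap.comp_add,
      LinearMap.add_comp, ← smul_add]
    congr 1
    abel
  map_smul' c z := by
    rw [Pi.smul_apply, Pi.smul_apply, Pi.smul_apply, Pi.smul_apply, LinearMap.comp_smul,
      LinearMap.smul_comp, ← smul_sub, smul_comm, RingHom.id_apply]

/-- The predifferential on families of linear maps. -/
def homD (n m : ℤ) : LinFam B T →ₗ[R] LinFam B T :=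
  if m + 1 = n then LinearMap.pi fun i => LinearMap.pi fun j => homD₀ B T i j else 0

variable {B T}

theorem homD_apply {n m : ℤ} (h : m + 1 = n) (z : LinFam B T) (i j : ℤ) (x : B.obj.X i) :
    homD B T n m z i j x =
      sgn R i • (T.obj.d (j + 1) j (z i (j + 1) x) - z (i - 1) j (B.obj.d i (i - 1) x)) := by
  rw [homD, if_pos h]
  rfl

theorem homD_mem {n : ℤ} (m : ℤ) {q : ℕ} {z : LinFam B T} (hz : z ∈ homF B T n q) :
    homD B T n m z ∈ homF B T m q := by
  by_cases h : m + 1 = n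
  · refine fun i j => ⟨fun hij => LinearMap.ext fun x => ?_, fun p x hx => ?_⟩
    · rw [homD_apply h, (hz i (j + 1)).1 (by omega), (hz (i - 1) j).1 (by omega)]
      simp
    · rw [homD_apply h]
      exact Submodule.smul_mem _ _ (sub_mem (d_mem ((hz i (j + 1)).2 p x hx))
        ((hz (i - 1) j).2 p _ (d_mem hx)))
  · rw [homD, if_neg h]
    exact zero_mem _

/-- Signs of adjacent degrees are opposite, so the cross terms cancel and the square sends `z` to
`d² ∘ z - z ∘ d²`. Each term raises the weight by one. -/
theorem homD_homD_mem {n : ℤ} (m k : ℤ) {q : ℕ} {z : LinFam B T} (hz : z ∈ homF B T n q) :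
    homD B T m k (homD B T n m z) ∈ homF B T k (q + 1) := by
  by_cases h : m + 1 = n
  · by_cases h' : k + 1 = m
    · refine fun i j => ⟨(homD_mem k (homD_mem m hz) i j).1, fun p x hx => ?_⟩
      rw [homD_apply h', homD_apply h, homD_apply h]
      have h1 := d_d_mem (j := j + 1) (k := j) ((hz i (j + 1 + 1)).2 p x hx)
      have h2 := (hz (i - 1 - 1) j).2 _ _ (d_d_mem (j := i - 1) (k := i - 1 - 1) hx)
      have h3 : sgn R i = - sgn R (i - 1) := by rw [← sgn_succ, sub_add_cancel]
      have h4 := sgn_mul_self (R := R) (i - 1)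
      have h5 := sub_mem h1 (show _ ∈ T.obj.F j (p + q + 1) by
        rwa [show p + 1 + q = p + q + 1 by ring] at h2)
      have h6 : ∀ (j : ℤ) (y : T.obj.X j), sgn R (i - 1) • sgn R (i - 1) • y = y := fun j y => by
        rw [smul_smul, h4, one_smul]
      rw [← add_assoc]
      convert h5 using 1
      rw [h3]
      simp only [map_smul, map_sub, smul_sub, neg_smul, smul_neg, h6, neg_neg, map_neg]
      abel
    · rw [homD, if_neg h']
      exact zero_mem _
  · rw [homD, homD, if_neg h, LinearMap.zero_apply, map_zero]
    exact zero_mem _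


theorem homF_eq_zero {n : ℤ} {z : LinFam B T} (hz : ∀ q, z ∈ homF B T n q) : z = 0 :=
  funext fun i => funext fun j => LinearMap.ext fun x =>
    (T.property j).eq_zero fun p => by
      have := ((hz p) i j).2 0 x (mem_F_zero _ x)
      rwa [Nat.zero_add] at this

theorem exists_homF_limit {n : ℤ} (s : ℕ → LinFam B T) (hs : ∀ p, s (p + 1) - s p ∈ homF B T n p)
    (h0 : ∀ p, s p ∈ homF B T n 0) : ∃ z ∈ homF B T n 0, ∀ p, z - s p ∈ homF B T n p := by
  have hs' : ∀ p k, s (p + k) - s p ∈ homF B T n p := by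
    intro p k
    induction k with
    | zero => simp
    | succ k ih =>
      have := add_mem (homF_anti B T n (Nat.le_add_right p k) (hs (p + k))) ih
      rwa [sub_add_sub_cancel] at this
  have hl : ∀ i j, ∃ l : B.obj.X i →ₗ[R] T.obj.X j, ∀ p x, l x - s p i j x ∈ T.obj.F j (p + 0) :=
    fun i j => (T.property j).exists_linearMap_limit 0 (fun p => s p i j) fun p x => by
      have := (hs p i j).2 0 x (mem_F_zero _ x)
      rwa [Nat.zero_add] at this
  choose l hl using hl
  have key : ∀ p, l - s p ∈ homF B T n p := fun p i j => by
    refine ⟨fun h => LinearMap.ext fun x => (T.property j).eq_zero fun r => ?_, fun r x hx => ?_⟩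
    · have h1 := hl i j r x
      rw [(h0 r i j).1 h] at h1
      change l i j x - s p i j x ∈ _
      rwa [(h0 p i j).1 h]
    -- The limit is pointwise, but the bound must be uniform. For `x` of weight `r`, stage `p + r`
    -- approximates the limit to weight `p + r`, and it differs from stage `p` by a map raising the
    -- weight by `p`.
    · have h1 := (hs' p r i j).2 r x hx
      have h2 := hl i j (p + r) x
      change l i j x - s p i j x ∈ _
      change s (p + r) i j x - s p i j x ∈ _ at h1
      rw [add_comm r p] at h1 ⊢
      have := add_mem h2 h1
      rwa [sub_add_sub_cancel] at this
  refine ⟨l, ?_, key⟩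
  have := add_mem (key 0) (h0 0)
  rwa [sub_add_cancel] at this

variable (B T)

/-- The internal hom of complete gr-dg modules. -/
def homObj : CompleteGrDGMod R where
  obj :=
    { X := fun n => homF B T n 0
      F := fun n q => (homF B T n q).submoduleOf (homF B T n 0)
      F_zero := fun n => Submodule.eq_top_iff'.2 fun x => x.2
      F_anti := fun n p q h x hx => homF_anti B T n h hx
      d := fun n m => (homD B T n m).restrict fun z hz => homD_mem m hz
      d_shape := fun n m h => by
        refine LinearMap.ext fun z => Subtype.ext ?_
        change homD B T n m z.1 = 0
        rw [homD, if_neg h, LinearMap.zero_apply]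
      d_F := fun n m q z hz => homD_mem m hz
      d_d := fun n m k q z hz => homD_homD_mem m k hz }
  property n := isCompleteFilt_of
    (fun z hz => Subtype.ext (homF_eq_zero hz))
    (fun s hs => by
      obtain ⟨z, hz, hz'⟩ := exists_homF_limit (fun p => (s p).1) hs fun p => (s p).2
      exact ⟨⟨z, hz⟩, hz'⟩)

variable {B T} {B' T' X X' : CompleteGrDGMod R}

theorem mem_homObj_F {n : ℤ} {q : ℕ} {z : (homObj B T).obj.X n} :
    z ∈ (homObj B T).obj.F n q ↔ ∀ i j, i + n = j → ∀ p x, x ∈ B.obj.F i p →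
      z.1 i j x ∈ T.obj.F j (p + q) :=
  ⟨fun h i j _ => (h i j).2, fun h i j => ⟨(z.2 i j).1, fun p x hx => by
    by_cases hij : i + n = j
    · exact h i j hij p x hx
    · exact (congrArg (· ∈ T.obj.F j (p + q)) (LinearMap.congr_fun ((z.2 i j).1 hij) x)).mpr
        (zero_mem _)⟩⟩

theorem homObj_ext {n : ℤ} {z z' : (homObj B T).obj.X n}
    (h : ∀ i j, i + n = j → ∀ x, z.1 i j x = z'.1 i j x) : z = z' :=
  Subtype.ext (funext fun i => funext fun j => LinearMap.ext fun x => by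
    by_cases hij : i + n = j
    · exact h i j hij x
    · rw [(z.2 i j).1 hij, (z'.2 i j).1 hij])

/-- The neighbouring degrees are free variables, so that no transport along identities such as `i -
1 + 1 = i` is needed when it is applied. -/
theorem homObj_d_apply {n m : ℤ} (h : m + 1 = n) (z : (homObj B T).obj.X n) {i j i' j' : ℤ}
    (hi : i' + 1 = i) (hj : j' = j + 1) (x : B.obj.X i) :
    ((homObj B T).obj.d n m z).1 i j x =
      sgn R i • (T.obj.d j' j (z.1 i j' x) - z.1 i' j (B.obj.d i i' x)) := by
  obtain rfl : i' = i - 1 := by omega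
  subst hj
  exact homD_apply h z.1 i j x

/-- Only the components from degree `i` to degree `i + n` matter, and the others are replaced by
zero. -/
theorem exists_homObj (n : ℤ) (q : ℕ) (z : LinFam B T)
    (hz : ∀ i j, i + n = j → ∀ p x, x ∈ B.obj.F i p → z i j x ∈ T.obj.F j (p + q)) :
    ∃ v : (homObj B T).obj.X n, v ∈ (homObj B T).obj.F n q ∧
      ∀ i j, i + n = j → ∀ x, v.1 i j x = z i j x := by
  have h : (fun i j => if i + n = j then z i j else 0) ∈ homF B T n q := fun i j => by
    refine ⟨fun h => if_neg h, fun p x hx => ?_⟩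
    beta_reduce
    split_ifs with h
    · exact hz i j h p x hx
    · exact zero_mem _
  exact ⟨⟨_, homF_anti B T n (Nat.zero_le q) h⟩, h, fun i j h x => LinearMap.congr_fun (if_pos h) x⟩

/-- The functoriality of the internal hom. -/
def homMap (f : B' ⟶ B) (g : T ⟶ T') : homObj B T ⟶ homObj B' T' := ObjectProperty.homMk
  { f := fun n =>
      { toFun := fun z => ⟨fun i j => hf g j ∘ₗ z.1 i j ∘ₗ hf f i, fun i j => ⟨fun h => by
          change hf g j ∘ₗ z.1 i j ∘ₗ hf f i = 0
          rw [(z.2 i j).1 h, LinearMap.zero_comp, LinearMap.comp_zero],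
          fun p x hx => f_F g ((z.2 i j).2 p _ (f_F f hx))⟩⟩
        map_add' := fun z z' => Subtype.ext (funext fun i => funext fun j =>
          LinearMap.ext fun x => map_add (hf g j) _ _)
        map_smul' := fun c z => Subtype.ext (funext fun i => funext fun j =>
          LinearMap.ext fun x => map_smul (hf g j) c _) }
    f_F := fun n q z hz i j => ⟨fun h => by
      change hf g j ∘ₗ z.1 i j ∘ₗ hf f i = 0
      rw [(z.2 i j).1 h, LinearMap.zero_comp, LinearMap.comp_zero],
      fun p x hx => f_F g ((hz i j).2 p _ (f_F f hx))⟩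
    f_d := fun n m z => by
      by_cases h : m + 1 = n
      · refine homObj_ext fun i j hij x => ?_
        rw [homObj_d_apply h _ (sub_add_cancel i 1) rfl]
        change hf g j (((homObj B T).obj.d n m z).1 i j (hf f i x)) = sgn R i •
          (T'.obj.d _ _ (hf g _ (z.1 _ _ (hf f _ x))) - hf g _ (z.1 _ _ (hf f _ (B'.obj.d _ _ x))))
        rw [homObj_d_apply h _ (sub_add_cancel i 1) rfl, map_smul, map_sub, f_d, f_d]
      · rw [FiltGrDGMod.d_shape _ _ _ h, FiltGrDGMod.d_shape _ _ _ h, LinearMap.zero_apply,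
          LinearMap.zero_apply, map_zero] }

/-- The family of linear maps `x ↦ (b ↦ φ (b ⊗ x))`. -/
def curryLin (φ : tensorObj' B X ⟶ T) (n : ℤ) : X.obj.X n →ₗ[R] LinFam B T :=
  LinearMap.pi fun i => LinearMap.pi fun j =>
    if h : i + n = j then ((tm B X i n j h).compr₂ (hf φ j)).flip else 0

theorem curryLin_apply (φ : tensorObj' B X ⟶ T) {n i j : ℤ} (h : i + n = j) (x : X.obj.X n)
    (b : B.obj.X i) : curryLin φ n x i j b = hf φ j (tm B X i n j h b x) := by
  simp only [curryLin, LinearMap.pi_apply, dif_pos h]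
  rfl

theorem curryLin_mem (φ : tensorObj' B X ⟶ T) {n : ℤ} {q : ℕ} {x : X.obj.X n}
    (hx : x ∈ X.obj.F n q) : curryLin φ n x ∈ homF B T n q := fun i j => by
  by_cases h : i + n = j
  · refine ⟨fun h' => absurd h h', fun p b hb => ?_⟩
    rw [curryLin_apply φ h]
    exact f_F φ (tm_mem h le_rfl hb hx)
  · have : curryLin φ n x i j = 0 := by
      simp only [curryLin, LinearMap.pi_apply, dif_neg h]
      rfl
    rw [this]
    exact ⟨fun _ => rfl, fun p b hb => zero_mem _⟩

/-- The morphism into the internal hom corresponding to a morphism out of a tensor product. -/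
def curry (φ : tensorObj' B X ⟶ T) : X ⟶ homObj B T := ObjectProperty.homMk
  { f := fun n => (curryLin φ n).codRestrict _ fun x => curryLin_mem φ (mem_F_zero _ x)
    f_F := fun n q x hx => curryLin_mem φ hx
    f_d := fun n m x => by
      by_cases h : m + 1 = n
      · refine homObj_ext fun i j hij b => ?_
        rw [homObj_d_apply h _ (sub_add_cancel i 1) rfl]
        change curryLin φ m (X.obj.d n m x) i j b = sgn R i • (T.obj.d _ _
          (curryLin φ n x i (j + 1) b) - curryLin φ n x (i - 1) j (B.obj.d _ _ b))
        rw [curryLin_apply φ hij, curryLin_apply φ (by omega), curryLin_apply φ (by omega),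
          ← f_d, d_tm (by omega) (sub_add_cancel i 1) h rfl, map_add, add_sub_cancel_left,
          map_smul, smul_smul, sgn_mul_self, one_smul]
      · rw [FiltGrDGMod.d_shape _ _ _ h, FiltGrDGMod.d_shape _ _ _ h, LinearMap.zero_apply,
          LinearMap.zero_apply]
        exact Subtype.ext (map_zero (curryLin φ m)) }

/-- The components of the elements of the internal hom. -/
def homEv (n i j : ℤ) : (homObj B T).obj.X n →ₗ[R] B.obj.X i →ₗ[R] T.obj.X j where
  toFun z := z.1 i j
  map_add' _ _ := rfl
  map_smul' _ _ := rfl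

/-- The morphism out of a tensor product corresponding to a morphism into the internal hom. -/
def uncurry (ψ : X ⟶ homObj B T) : tensorObj' B X ⟶ T := desc
  { b := fun i n j h => (homEv n i j ∘ₗ hf ψ n).flip
    b_F := fun i n j h p q b x hb hx => ((f_F ψ hx) i j).2 p b hb
    b_d := fun i n j i' n' m h hi hn hm b x => by
      change T.obj.d j m ((hf ψ n x).1 i j b) = (hf ψ n x).1 i' m (B.obj.d i i' b) +
        -- The sign `(-1)^i` in the hom differential makes this exactly the Leibniz rule of the
        -- tensor product, with the hom variable as the left factor.
        sgn R i • (hf ψ n' (X.obj.d n n' x)).1 i m b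
      rw [f_d, homObj_d_apply hn _ hi hm.symm, smul_smul, sgn_mul_self, one_smul,
        add_sub_cancel] }

theorem uncurry_tm (ψ : X ⟶ homObj B T) {i n j : ℤ} (h : i + n = j) (b : B.obj.X i)
    (x : X.obj.X n) : hf (uncurry ψ) j (tm B X i n j h b x) = (hf ψ n x).1 i j b :=
  desc_tm _ _ _ _ _ _ _

theorem curry_apply (φ : tensorObj' B X ⟶ T) {n i j : ℤ} (h : i + n = j) (x : X.obj.X n)
    (b : B.obj.X i) : (hf (curry φ) n x).1 i j b = hf φ j (tm B X i n j h b x) :=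
  curryLin_apply φ h x b

variable (B T X) in
/-- The adjunction between the tensor product and the internal hom. -/
def homObjEquiv : (tensorObj' B X ⟶ T) ≃ (X ⟶ homObj B T) where
  toFun := curry
  invFun := uncurry
  left_inv φ := tensor_ext fun i n j h b x => by rw [uncurry_tm, curry_apply φ h]
  right_inv ψ := hom_ext' fun n x => homObj_ext fun i j h b => by
    rw [curry_apply _ h, uncurry_tm]

variable (R) in
/-- The internal hom bifunctor. -/
def homFunctor : (CompleteGrDGMod R)ᵒᵖ ⥤ CompleteGrDGMod R ⥤ CompleteGrDGMod R where
  obj B :=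
    { obj := fun T => homObj B.unop T
      map := fun g => homMap (𝟙 _) g }
  map f := { app := fun T => homMap f.unop (𝟙 T) }

variable (R) in
/-- The parametrized adjunction between the tensor product and the internal hom. -/
def tensorHomAdjunction : curriedTensor (CompleteGrDGMod R) ⊣₂ homFunctor R :=
  .mk' (fun B => Adjunction.mkOfHomEquiv
    { homEquiv := fun X T => homObjEquiv B T X
      homEquiv_naturality_left_symm := fun {X' X T} f g => tensor_ext fun i n j h b x => by
        change hf (uncurry (f ≫ g)) j _ = hf (uncurry g) j (hf (tensorMap (𝟙 B) f) j _)
        rw [tensorMap_tm, uncurry_tm]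
        exact (uncurry_tm (ψ := g) h b _).symm
      homEquiv_naturality_right := fun {X T T'} f g => hom_ext' fun n x =>
        homObj_ext fun i j h b => by
          refine (curry_apply _ h x b).trans ?_
          exact congrArg (hf g j) (curry_apply f h x b).symm })
    (fun {B' B} f {X T} g => hom_ext' fun n x => homObj_ext fun i j h b => by
      simp only [Adjunction.mkOfHomEquiv_homEquiv]
      refine (curry_apply (B := B') _ h x b).trans ?_
      refine Eq.trans ?_ (curry_apply g h x (hf f i b)).symm
      exact congrArg (hf g j) (tensorMap_tm f (𝟙 X) i n j h b x))

end InternalHom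

end CompleteGrDGMod

end GrDG

namespace GrDG

open FiltGrDGMod Opposite

namespace CompleteGrDGMod

/-! ### Pullback-hom maps -/

section PullbackHom

variable {R : Type u} [Field R] {B B' T T' : CompleteGrDGMod R} {i : B' ⟶ B} {p : T ⟶ T'}

theorem eq_of_isPullback {P X Y Z : CompleteGrDGMod R} {g' : P ⟶ X} {p' : P ⟶ Y} {p : X ⟶ Z}
    {g : Y ⟶ Z} (sq : IsPullback g' p' p g) {n : ℤ} {v w : P.obj.X n}
    (h₁ : hf g' n v = hf g' n w) (h₂ : hf p' n v = hf p' n w) : v = w :=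
  (P.property n).eq_of_sub_mem fun q => mem_of_isPullback sq
    (by rw [map_sub, h₁, sub_self]; exact zero_mem _)
    (by rw [map_sub, h₂, sub_self]; exact zero_mem _)

/-- A filtered contraction of the fibers of a trivial fibration. -/
theorem exists_fiber_contraction {f : T ⟶ T'} (h : (genCof R).rlp f)
    (σ : ∀ n, T'.obj.X n →ₗ[R] T.obj.X n)
    (hσ : ∀ n q x, x ∈ T'.obj.F n q → σ n x ∈ T.obj.F n q) (hfσ : ∀ n x, hf f n (σ n x) = x) :
    ∃ S : ∀ n m : ℤ, T.obj.X n →ₗ[R] T.obj.X m,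
      (∀ n m q x, n + 1 = m → x ∈ T.obj.F n q → S n m x ∈ T.obj.F m q) ∧
      (∀ n m x, hf f m (S n m x) = 0) ∧ (∀ n m x, S n m (σ n x) = 0) ∧
      ∀ m n l : ℤ, n + 1 = m → l + 1 = n → ∀ q, ∀ x ∈ T.obj.F n q, hf f n x = 0 →
        x - T.obj.d m n (S n m x) - S l n (T.obj.d n l x) ∈ T.obj.F n (q + 1) := by
  rw [rlp_genCof] at h
  obtain ⟨s, hs, hs'⟩ := (isAcyclic_kerObj h.1 h.2).exists_contraction
  -- The projection `1 - σ f` onto the kernel extends the contraction of the kernel to all of `T`,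
  -- by zero on the image of `σ`.
  let ρ : ∀ n, T.obj.X n →ₗ[R] (kerObj f).obj.X n := fun n =>
    (LinearMap.id - σ n ∘ₗ hf f n).codRestrict (LinearMap.ker (hf f n)) fun x => by
      rw [LinearMap.mem_ker]
      change hf f n (x - σ n (hf f n x)) = 0
      rw [map_sub, hfσ, sub_self]
  have hρ : ∀ n q x, x ∈ T.obj.F n q → ρ n x ∈ (kerObj f).obj.F n q := fun n q x hx =>
    sub_mem hx (hσ n q _ (f_F f hx))
  have hρ' : ∀ n x, hf f n x = 0 → kerι f n (ρ n x) = x := fun n x hx => by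
    change x - σ n (hf f n x) = x
    rw [hx, map_zero, sub_zero]
  refine ⟨fun n m => kerι f m ∘ₗ s n m ∘ₗ ρ n, fun n m q x hm hx => hs n m q _ hm (hρ n q x hx),
    fun n m x => hf_kerι f m _, fun n m x => ?_, fun m n l hm hl q x hx hfx => ?_⟩
  · have : ρ n (σ n x) = 0 := Subtype.ext (by
      change σ n x - σ n (hf f n (σ n x)) = 0
      rw [hfσ, sub_self])
    rw [LinearMap.comp_apply, LinearMap.comp_apply, this, map_zero, map_zero]
  · have h1 := hs' m n l hm hl q (ρ n x) (hρ n q x hx)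
    have h2 : (kerObj f).obj.d n l (ρ n x) = ρ l (T.obj.d n l x) := Subtype.ext (by
      change T.obj.d n l (kerι f n (ρ n x)) = kerι f l (ρ l (T.obj.d n l x))
      rw [hρ' n x hfx, hρ' l _ (by rw [f_d, hfx, map_zero])])
    rw [h2] at h1
    change kerι f n (ρ n x) - T.obj.d m n _ - _ ∈ T.obj.F n (q + 1) at h1
    rw [hρ' n x hfx] at h1
    exact h1

variable (sq : (homFunctor R).PullbackObjObj i p)

theorem pullbackHom_fst {n : ℤ} (z : (homObj B T).obj.X n) (a b : ℤ) (x : B'.obj.X a) :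
    (show (homObj B' T).obj.X n from hf sq.fst n (hf sq.π n z)).1 a b x = z.1 a b (hf i a x) :=
  LinearMap.congr_fun (congrFun (congrFun (congrArg Subtype.val (hf_congr sq.π_fst n z)) a) b) x

theorem pullbackHom_snd {n : ℤ} (z : (homObj B T).obj.X n) (a b : ℤ) (x : B.obj.X a) :
    (show (homObj B T').obj.X n from hf sq.snd n (hf sq.π n z)).1 a b x = hf p b (z.1 a b x) :=
  LinearMap.congr_fun (congrFun (congrFun (congrArg Subtype.val (hf_congr sq.π_snd n z)) a) b) x

/-- An element of the pullback is determined by its two projections, which are restriction along `i`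
and composition with `p`. -/
theorem pullbackHom_eq_iff {n : ℤ} (z : (homObj B T).obj.X n) (w : sq.pt.obj.X n) :
    hf sq.π n z = w ↔
      (∀ a b, a + n = b → ∀ x,
        z.1 a b (hf i a x) = (show (homObj B' T).obj.X n from hf sq.fst n w).1 a b x) ∧
      ∀ a b, a + n = b → ∀ x,
        hf p b (z.1 a b x) = (show (homObj B T').obj.X n from hf sq.snd n w).1 a b x := by
  constructor
  · rintro rfl
    exact ⟨fun a b _ x => (pullbackHom_fst sq z a b x).symm,
      fun a b _ x => (pullbackHom_snd sq z a b x).symm⟩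
  · rintro ⟨h₁, h₂⟩
    refine eq_of_isPullback sq.isPullback ?_ ?_
    · exact homObj_ext (B := B') (T := T) fun a b h x =>
        (pullbackHom_fst sq z a b x).trans (h₁ a b h x)
    · exact homObj_ext (B := B) (T := T') fun a b h x =>
        (pullbackHom_snd sq z a b x).trans (h₂ a b h x)

theorem pullbackHom_eq_zero_iff {n : ℤ} (z : (homObj B T).obj.X n) :
    hf sq.π n z = 0 ↔ (∀ a b, a + n = b → ∀ x, z.1 a b (hf i a x) = 0) ∧
      ∀ a b, a + n = b → ∀ x, hf p b (z.1 a b x) = 0 := by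
  rw [pullbackHom_eq_iff, map_zero, map_zero]
  rfl

/-- Given compatible `α` on `B'` and `β` into `T'`, choose a filtered lift `h` of `β` along `p` that
ignores `α`. Then `α r + h - h i r` restricts to `α` and still lies over `β`. -/
theorem pullbackHom_strictSurjection (hi : (genCof R).rlp.llp i) (hp : strictSurjection R p) :
    strictSurjection R sq.π := by
  obtain ⟨r, hr, hri⟩ := exists_filtered_retraction hi
  rw [strictSurjection_iff] at hp ⊢
  intro q n w hw
  obtain ⟨α, hα⟩ : ∃ α : (homObj B' T).obj.X n, α = hf sq.fst n w := ⟨_, rfl⟩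
  obtain ⟨β, hβ⟩ : ∃ β : (homObj B T').obj.X n, β = hf sq.snd n w := ⟨_, rfl⟩
  have hαF : α ∈ (homObj B' T).obj.F n q := hα ▸ f_F sq.fst hw
  have hβF : β ∈ (homObj B T').obj.F n q := hβ ▸ f_F sq.snd hw
  have hαβ : ∀ a b x, hf p b (α.1 a b x) = β.1 a b (hf i a x) := fun a b x => by
    have h := hf_congr sq.isPullback.w n w
    rw [hα, hβ]
    exact LinearMap.congr_fun (congrFun (congrFun (congrArg Subtype.val h) a) b) x
  choose h hhF hph using fun a b => exists_filtered_lift (B.obj.F_anti a) (B.obj.F_zero a)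
    (T.property b) (T'.property b) (hf p b) (fun q x hx => f_F p hx)
    (fun q y hy => hp q b y hy) q (β.1 a b) (fun k x hx => (hβF a b).2 k x hx)
  obtain ⟨v, hv, hv'⟩ := exists_homObj (B := B) (T := T) n q
    (fun a b => α.1 a b ∘ₗ r a + h a b - h a b ∘ₗ hf i a ∘ₗ r a) (fun a b _ k x hx =>
      sub_mem (add_mem ((hαF a b).2 k _ (hr a k x hx)) (hhF a b k x hx))
        (hhF a b k _ (f_F i (hr a k x hx))))
  refine ⟨v, hv, (pullbackHom_eq_iff sq v w).2 ⟨fun a b hab x => ?_, fun a b hab x => ?_⟩⟩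
  · rw [hv' a b hab, ← hα]
    change α.1 a b (r a (hf i a x)) + h a b (hf i a x) - h a b (hf i a (r a (hf i a x))) = _
    rw [hri, add_sub_cancel_right]
  · rw [hv' a b hab, ← hβ]
    change hf p b (α.1 a b (r a x) + h a b x - h a b (hf i a (r a x))) = _
    rw [map_sub, map_add, hph, hph, hαβ, add_sub_cancel_left]

/-- Surjectivity being known, only acyclicity of the kernel remains. The kernel consists of families
that vanish on the image of `i` and take values in `ker p`, and the hypothesis provides primitives
for its approximate cycles. -/
theorem pullbackHom_rlp_genCof (hi : (genCof R).rlp.llp i) (hp : strictSurjection R p)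
    (h : ∀ (n : ℤ) (q : ℕ) (z : (homObj B T).obj.X n), z ∈ (homObj B T).obj.F n q →
      (∀ m, m + 1 = n → (homObj B T).obj.d n m z ∈ (homObj B T).obj.F m (q + 1)) →
      (∀ a b, a + n = b → ∀ x, z.1 a b (hf i a x) = 0) →
      (∀ a b, a + n = b → ∀ x, hf p b (z.1 a b x) = 0) →
      ∃ α : LinFam B T, (∀ a b, a + (n + 1) = b → ∀ k x, x ∈ B.obj.F a k →
          α a b x ∈ T.obj.F b (k + q)) ∧
        (∀ a b, a + (n + 1) = b → ∀ x, α a b (hf i a x) = 0) ∧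
        (∀ a b, a + (n + 1) = b → ∀ x, hf p b (α a b x) = 0) ∧
        ∀ a b, a + n = b → ∀ k x, x ∈ B.obj.F a k →
          z.1 a b x - sgn R a • (T.obj.d (b + 1) b (α a (b + 1) x) -
            α (a - 1) b (B.obj.d a (a - 1) x)) ∈ T.obj.F b (k + (q + 1))) :
    (genCof R).rlp sq.π := by
  refine rlp_genCof_of_isAcyclic (pullbackHom_strictSurjection sq hi hp) ?_
  rintro q _ n l rfl hl ⟨z, hz⟩ hzF hdz
  obtain ⟨hz₁, hz₂⟩ := (pullbackHom_eq_zero_iff sq z).1 hz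
  obtain ⟨α, hα, hα₁, hα₂, hα₃⟩ := h n q z hzF (fun m hm => by
    obtain rfl : m = l := by omega
    exact hdz) hz₁ hz₂
  obtain ⟨v, hv, hv'⟩ := exists_homObj (B := B) (T := T) (n + 1) q α hα
  refine ⟨⟨v, (pullbackHom_eq_zero_iff sq v).2 ⟨fun a b hab x => ?_, fun a b hab x => ?_⟩⟩,
    hv, ?_⟩
  · rw [hv' a b hab, hα₁ a b hab]
  · rw [hv' a b hab, hα₂ a b hab]
  · refine mem_homObj_F.2 fun a b hab k x hx => ?_
    have h1 := hα₃ a b hab k x hx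
    have h2 := homObj_d_apply rfl v (j := b) (sub_add_cancel a 1) rfl x
    rw [hv' _ _ (by omega), hv' _ _ (by omega)] at h2
    rw [← h2] at h1
    exact h1

theorem pullbackHom_rlp_genCof_of_rlp (hi : (genCof R).rlp.llp i) (hp : (genCof R).rlp p) :
    (genCof R).rlp sq.π := by
  have hp' : strictSurjection R p := by
    rw [rlp_genCof] at hp
    exact hp.1
  obtain ⟨σ, hσ, hpσ⟩ := exists_filtered_section hp'
  obtain ⟨S, hS, hpS, -, hS'⟩ := exists_fiber_contraction hp σ hσ hpσ
  refine pullbackHom_rlp_genCof sq hi hp' fun n q z hz hdz hz₁ hz₂ => ?_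
  -- The primitive is the composite with the fiber contraction of `p`. The factor `(-1)^a`
  -- compensates the sign of the hom differential.
  refine ⟨fun a b => sgn R a • S (b - 1) b ∘ₗ z.1 a (b - 1), fun a b hab k x hx =>
    Submodule.smul_mem _ _ (hS _ _ _ _ (sub_add_cancel b 1) ((hz a (b - 1)).2 k x hx)),
    fun a b hab x => ?_, fun a b hab x => ?_, fun a b hab k x hx => ?_⟩
  · rw [LinearMap.smul_apply, LinearMap.comp_apply, hz₁ a (b - 1) (by omega), map_zero, smul_zero]
  · rw [LinearMap.smul_apply, map_smul]
    exact (congrArg _ (hpS _ _ _)).trans (smul_zero _)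
  · have h1 := hS' (b + 1) b (b - 1) rfl (by omega) _ (z.1 a b x) ((hz a b).2 k x hx)
      (hz₂ a b hab x)
    have h2 := hS (b - 1) b _ _ (by omega) (((hdz (n - 1) (by omega)) a (b - 1)).2 k x hx)
    have h3 := homObj_d_apply (sub_add_cancel n 1) z (j := b - 1) (sub_add_cancel a 1)
      (sub_add_cancel b 1).symm x
    change S (b - 1) b (((homObj B T).obj.d n (n - 1) z).1 a (b - 1) x) ∈ _ at h2
    rw [h3] at h2
    -- Since `z` is a cycle modulo higher weight, `S (d (z x))` may be replaced by `S (z (d x))` in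
    -- the contraction formula.
    have h4 := add_mem h1 (Submodule.smul_mem _ (sgn R a) h2)
    rw [map_smul, smul_smul, sgn_mul_self, one_smul, map_sub] at h4
    have h5 : sgn R a = - sgn R (a - 1) := by rw [← sgn_succ, sub_add_cancel]
    have h6 : ∀ y : T.obj.X b, sgn R a • sgn R a • y = y := fun y => by
      rw [smul_smul, sgn_mul_self, one_smul]
    have h7 : sgn R (a - 1) = - sgn R a := by rw [h5, neg_neg]
    obtain ⟨c, hc⟩ : ∃ c, c = b + 1 - 1 := ⟨_, rfl⟩
    have hcb : c = b := by omega
    change z.1 a b x - sgn R a • (T.obj.d (b + 1) b (sgn R a • S (b + 1 - 1) (b + 1)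
      (z.1 a (b + 1 - 1) x)) - sgn R (a - 1) • S (b - 1) b (z.1 (a - 1) (b - 1)
        (B.obj.d a (a - 1) x))) ∈ _
    rw [← hc, hcb, map_smul, h7, neg_smul, sub_neg_eq_add, smul_add, h6, h6]
    have h8 : ∀ y₁ y₂ y₃ y₄ : T.obj.X b, y₁ - (y₂ + y₃) = y₁ - y₂ - y₄ + (y₄ - y₃) := by
      intros
      abel
    exact (congrArg (· ∈ T.obj.F b (k + q + 1)) (h8 _ _ _ _)).mpr h4

theorem pullbackHom_rlp_genCof_of_llp (hi : (strictSurjection R).llp i)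
    (hp : strictSurjection R p) : (genCof R).rlp sq.π := by
  have hi' : (genCof R).rlp.llp i := MorphismProperty.antitone_llp (by
    rw [rlp_genCof]
    exact inf_le_left) i hi
  obtain ⟨r, hr, s, hs, hsi, hs'⟩ := exists_deformation_retract hi
  refine pullbackHom_rlp_genCof sq hi' hp fun n q z hz hdz hz₁ hz₂ => ?_
  -- Here the primitive is the composite with the deformation homotopy of `i`, which vanishes on the
  -- image of `i`.
  refine ⟨fun a b => sgn R a • z.1 (a + 1) b ∘ₗ s a (a + 1), fun a b hab k x hx =>
    Submodule.smul_mem _ _ ((hz (a + 1) b).2 k _ (hs _ _ _ _ hx)),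
    fun a b hab x => ?_, fun a b hab x => ?_, fun a b hab k x hx => ?_⟩
  · rw [LinearMap.smul_apply, LinearMap.comp_apply, hsi, map_zero, smul_zero]
  · rw [LinearMap.smul_apply, LinearMap.comp_apply, map_smul, hz₂ (a + 1) b (by omega), smul_zero]
  · have h1 := ((hdz (n - 1) (by omega)) (a + 1) b).2 k _ (hs a (a + 1) k x hx)
    have h2 := homObj_d_apply (sub_add_cancel n 1) z (j := b) (i := a + 1) rfl rfl
      (s a (a + 1) x)
    change ((homObj B T).obj.d n (n - 1) z).1 (a + 1) b (s a (a + 1) x) ∈ _ at h1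
    rw [h2] at h1
    -- As `z` kills the image of `i`, it kills `i (r x)`, so `z x = z (d (s x)) + z (s (d x))`. The
    -- cycle condition at `s x` then moves `d` out of `z`.
    have h3 := congrArg (z.1 a b) (hs' (a + 1) a (a - 1) rfl (by omega) x)
    rw [map_sub, hz₁ a b hab, sub_zero, map_add] at h3
    have h5 : sgn R (a + 1) = - sgn R a := sgn_succ a
    have h6 : ∀ y : T.obj.X b, sgn R a • sgn R a • y = y := fun y => by
      rw [smul_smul, sgn_mul_self, one_smul]
    have h7 : sgn R (a - 1) = - sgn R a := by rw [eq_neg_iff_add_eq_zero, add_comm,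
      ← eq_neg_iff_add_eq_zero, ← sgn_succ, sub_add_cancel]
    have h8 := Submodule.smul_mem _ (sgn R a) h1
    rw [h5, neg_smul, smul_neg, h6] at h8
    obtain ⟨c, hc⟩ : ∃ c, c = a - 1 + 1 := ⟨_, rfl⟩
    have hca : c = a := by omega
    change z.1 a b x - sgn R a • (T.obj.d (b + 1) b (sgn R a • z.1 (a + 1) (b + 1) (s a (a + 1) x))
      - sgn R (a - 1) • z.1 (a - 1 + 1) b (s (a - 1) (a - 1 + 1) (B.obj.d a (a - 1) x))) ∈ _
    rw [← hc, hca, map_smul, h7, neg_smul, sub_neg_eq_add, smul_add, h6, h6, h3]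
    convert h8 using 1
    abel

end PullbackHom

end CompleteGrDGMod

end GrDG

namespace GrDG

open FiltGrDGMod

namespace CompleteGrDGMod

/-! ### Filtered homotopy equivalences and tensoring -/

section FilteredHomotopy

variable {R : Type u} [CommRing R] {V W : CompleteGrDGMod R}

/-- A morphism with a filtered section which is a homotopy inverse up to terms raising the
filtration is a graded quasi-isomorphism. -/
theorem gradedQuasiIso_of_filtered_homotopy {f : V ⟶ W} (u : ∀ n, W.obj.X n →ₗ[R] V.obj.X n)
    (hu : ∀ n p x, x ∈ W.obj.F n p → u n x ∈ V.obj.F n p) (hfu : ∀ n x, hf f n (u n x) = x)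
    (hud : ∀ n m p x, m + 1 = n → x ∈ W.obj.F n p →
      V.obj.d n m (u n x) - u m (W.obj.d n m x) ∈ V.obj.F m (p + 1))
    (h : ∀ n, V.obj.X n →ₗ[R] V.obj.X (n + 1))
    (hh : ∀ n p x, x ∈ V.obj.F n p → h n x ∈ V.obj.F (n + 1) p)
    (hhd : ∀ l p x, x ∈ V.obj.F (l + 1) p →
      x - u (l + 1) (hf f (l + 1) x) - V.obj.d (l + 1 + 1) (l + 1) (h (l + 1) x) -
        h l (V.obj.d (l + 1) l x) ∈ V.obj.F (l + 1) (p + 1)) : gradedQuasiIso R f := by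
  rw [gradedQuasiIso_iff]
  rintro p _ _ l rfl rfl
  refine ⟨?_, fun w hw hdw => ⟨u _ w, hu _ _ _ hw, ?_, 0, zero_mem _, ?_⟩⟩
  · rintro v hv hdv ⟨a, ha, hfa⟩
    -- Modulo higher weight `v` is `u (f v) + d (h v)`, and `u (f v)` is `d (u a)` because `u`
    -- commutes with `d` up to weight one.
    refine ⟨u _ a + h _ v, add_mem (hu _ _ _ ha) (hh _ _ _ hv), ?_⟩
    have h1 := add_mem (add_mem (hhd l p v hv) (hh _ _ _ hdv)) (hu _ _ _ hfa)
    have h2 := sub_mem h1 (hud _ (l + 1) p a rfl ha)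
    convert h2 using 1
    simp only [map_add, map_sub]
    abel
  · have h1 := add_mem (hud (l + 1) l p w rfl hw) (hu _ _ _ hdw)
    rwa [sub_add_cancel] at h1
  · rw [hfu, sub_self, map_zero, sub_zero]
    exact zero_mem _

end FilteredHomotopy

section TensorMaps

variable {R : Type u} [CommRing R] {V V' X : CompleteGrDGMod R}

/-- The map `φ ⊗ X` for a filtered map `φ` of degree `c`. -/
def tensorLin (c : ℤ) (φ : ∀ i, V.obj.X i →ₗ[R] V'.obj.X (i + c))
    (hφ : ∀ i p x, x ∈ V.obj.F i p → φ i x ∈ V'.obj.F (i + c) p) (n : ℤ) :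
    (tensorObj' V X).obj.X n →ₗ[R] (tensorObj' V' X).obj.X (n + c) :=
  linDesc (fun i j h => tm V' X (i + c) j (n + c) (by omega) ∘ₗ φ i)
    (fun i j h p q v w hv hw => tm_mem _ le_rfl (hφ i p v hv) hw)

theorem tensorLin_tm (c : ℤ) (φ : ∀ i, V.obj.X i →ₗ[R] V'.obj.X (i + c))
    (hφ : ∀ i p x, x ∈ V.obj.F i p → φ i x ∈ V'.obj.F (i + c) p) {i j n : ℤ} (h : i + j = n)
    (v : V.obj.X i) (w : X.obj.X j) : tensorLin c φ hφ n (tm V X i j n h v w) =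
      tm V' X (i + c) j (n + c) (by omega) (φ i v) w :=
  linDesc_tm _ _ _ _ _ _ _

theorem tensorLin_mem (c : ℤ) (φ : ∀ i, V.obj.X i →ₗ[R] V'.obj.X (i + c))
    (hφ : ∀ i p x, x ∈ V.obj.F i p → φ i x ∈ V'.obj.F (i + c) p) {n : ℤ} {p : ℕ}
    {x : (tensorObj' V X).obj.X n} (hx : x ∈ (tensorObj' V X).obj.F n p) :
    tensorLin c φ hφ n x ∈ (tensorObj' V' X).obj.F (n + c) p :=
  linDesc_mem _ _ _ _ hx

/-- The map `φ ⊗ X` for a filtered map `φ` of degree zero. -/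
def tensorLin₀ (φ : ∀ i, V.obj.X i →ₗ[R] V'.obj.X i)
    (hφ : ∀ i p x, x ∈ V.obj.F i p → φ i x ∈ V'.obj.F i p) (n : ℤ) :
    (tensorObj' V X).obj.X n →ₗ[R] (tensorObj' V' X).obj.X n :=
  linDesc (fun i j h => tm V' X i j n h ∘ₗ φ i)
    (fun i j h p q v w hv hw => tm_mem _ le_rfl (hφ i p v hv) hw)

theorem tensorLin₀_tm (φ : ∀ i, V.obj.X i →ₗ[R] V'.obj.X i)
    (hφ : ∀ i p x, x ∈ V.obj.F i p → φ i x ∈ V'.obj.F i p) {i j n : ℤ} (h : i + j = n)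
    (v : V.obj.X i) (w : X.obj.X j) :
    tensorLin₀ φ hφ n (tm V X i j n h v w) = tm V' X i j n h (φ i v) w :=
  linDesc_tm _ _ _ _ _ _ _

theorem tensorLin₀_mem (φ : ∀ i, V.obj.X i →ₗ[R] V'.obj.X i)
    (hφ : ∀ i p x, x ∈ V.obj.F i p → φ i x ∈ V'.obj.F i p) {n : ℤ} {p : ℕ}
    {x : (tensorObj' V X).obj.X n} (hx : x ∈ (tensorObj' V X).obj.F n p) :
    tensorLin₀ φ hφ n x ∈ (tensorObj' V' X).obj.F n p :=
  linDesc_mem _ _ _ _ hx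

/-- Tensoring with an object preserves morphisms with a filtered homotopy inverse section. -/
theorem gradedQuasiIso_tensorMap_of_filtered_homotopy {f : V ⟶ V'} (X : CompleteGrDGMod R)
    (u : ∀ n, V'.obj.X n →ₗ[R] V.obj.X n)
    (hu : ∀ n p x, x ∈ V'.obj.F n p → u n x ∈ V.obj.F n p) (hfu : ∀ n x, hf f n (u n x) = x)
    (hud : ∀ n m p x, m + 1 = n → x ∈ V'.obj.F n p →
      V.obj.d n m (u n x) - u m (V'.obj.d n m x) ∈ V.obj.F m (p + 1))
    (h : ∀ n, V.obj.X n →ₗ[R] V.obj.X (n + 1))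
    (hh : ∀ n p x, x ∈ V.obj.F n p → h n x ∈ V.obj.F (n + 1) p)
    (hhd : ∀ l p x, x ∈ V.obj.F (l + 1) p →
      x - u (l + 1) (hf f (l + 1) x) - V.obj.d (l + 1 + 1) (l + 1) (h (l + 1) x) -
        h l (V.obj.d (l + 1) l x) ∈ V.obj.F (l + 1) (p + 1)) :
    gradedQuasiIso R (tensorMap f (𝟙 X)) := by
  refine gradedQuasiIso_of_filtered_homotopy (tensorLin₀ u hu)
    (fun n p x hx => tensorLin₀_mem u hu hx) (fun n x => ?_) ?_ (tensorLin 1 h hh)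
    (fun n p x hx => tensorLin_mem 1 h hh hx) ?_
  · refine LinearMap.congr_fun (f := hf (tensorMap f (𝟙 X)) n ∘ₗ tensorLin₀ u hu n)
      (g := LinearMap.id) (lin_ext (fun p x hx => f_F (tensorMap f (𝟙 X)) (tensorLin₀_mem u hu hx))
        (fun p x hx => hx) fun i j hij v w => ?_) x
    rw [LinearMap.comp_apply, tensorLin₀_tm, tensorMap_tm, hfu]
    rfl
  · rintro n m p x hm hx
    -- Gaining one unit of weight can be checked on pure tensors. This remains true after
    -- completion, since every element is a finite tensor modulo high weight.
    refine ctensor_shift (V := V'.obj) (W := X.obj) (n := n) (c := 1)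
      (f := (tensorObj' V X).obj.d n m ∘ₗ tensorLin₀ u hu n -
        tensorLin₀ u hu m ∘ₗ (tensorObj' V' X).obj.d n m) ((tensorObj' V X).obj.F_anti m)
      (fun p x hx => sub_mem (d_mem (tensorLin₀_mem u hu hx)) (tensorLin₀_mem u hu (d_mem hx)))
      ?_ hx
    intro i j hij p q v w hv hw
    change (tensorObj' V X).obj.d n m (tensorLin₀ u hu n (tm V' X i j n hij v w)) -
      tensorLin₀ u hu m ((tensorObj' V' X).obj.d n m (tm V' X i j n hij v w)) ∈ _
    rw [tensorLin₀_tm, d_tm hij (sub_add_cancel i 1) (sub_add_cancel j 1) hm,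
      d_tm hij (sub_add_cancel i 1) (sub_add_cancel j 1) hm, map_add, map_smul, tensorLin₀_tm,
      tensorLin₀_tm, add_sub_add_right_eq_sub, ← LinearMap.sub_apply, ← map_sub]
    exact tm_mem _ (by omega) (hud i (i - 1) p v (sub_add_cancel i 1) hv) hw
  · rintro n p x hx
    refine ctensor_shift (V := V.obj) (W := X.obj) (n := n + 1) (c := 1)
      (f := LinearMap.id - tensorLin₀ u hu (n + 1) ∘ₗ hf (tensorMap f (𝟙 X)) (n + 1) -
        (tensorObj' V X).obj.d (n + 1 + 1) (n + 1) ∘ₗ tensorLin 1 h hh (n + 1) -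
        tensorLin 1 h hh n ∘ₗ (tensorObj' V X).obj.d (n + 1) n)
      ((tensorObj' V X).obj.F_anti (n + 1))
      (fun p x hx => sub_mem (sub_mem (sub_mem hx (tensorLin₀_mem u hu (f_F _ hx)))
        (d_mem (tensorLin_mem 1 h hh hx))) (tensorLin_mem 1 h hh (d_mem hx))) ?_ hx
    intro i j hij p q v w hv hw
    obtain ⟨i, rfl⟩ : ∃ k, i = k + 1 := ⟨i - 1, by ring⟩
    change tm V X (i + 1) j (n + 1) hij v w - tensorLin₀ u hu (n + 1)
        (hf (tensorMap f (𝟙 X)) (n + 1) (tm V X (i + 1) j (n + 1) hij v w)) -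
      (tensorObj' V X).obj.d (n + 1 + 1) (n + 1)
        (tensorLin 1 h hh (n + 1) (tm V X (i + 1) j (n + 1) hij v w)) -
      tensorLin 1 h hh n ((tensorObj' V X).obj.d (n + 1) n
        (tm V X (i + 1) j (n + 1) hij v w)) ∈ _
    rw [tensorMap_tm, tensorLin₀_tm, tensorLin_tm,
      d_tm (i' := i + 1) (j' := j - 1) (by omega) rfl (by omega) rfl,
      d_tm (i' := i) (j' := j - 1) hij rfl (by omega) rfl, map_add, map_smul, tensorLin_tm,
      tensorLin_tm, hf_id]
    have h1 := tm_mem (V := V) (W := X) hij (p := p + q + 1) (by omega) (hhd i p v hv) hw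
    simp only [map_sub, LinearMap.sub_apply] at h1
    -- The terms `h v ⊗ d w` from the two composites carry opposite signs, because `h v` has one
    -- degree more than `v`, and they cancel.
    rw [sgn_succ (i + 1), neg_smul]
    convert h1 using 1
    abel

end TensorMaps

/-! ### The unit axiom -/

section UnitAxiom

variable {R : Type u} [Field R] {Q : CompleteGrDGMod R}

/-- A trivial fibration onto the unit has a filtered section and a fiber contraction, both
compatible with `d` up to weight one. This additive structure is preserved by tensoring with any
`X`, cofibrant or not. -/
theorem gradedQuasiIso_tensorMap_unit {π : Q ⟶ unit R} (h : (genCof R).rlp π)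
    (X : CompleteGrDGMod R) : gradedQuasiIso R (tensorMap π (𝟙 X)) := by
  -- The lifting problem with `z = 0`, `a = 1`, `b = 0` gives a preimage `e` of `1` whose
  -- differential has weight `1`.
  obtain ⟨e, -, b, hb, he, -, heb⟩ := (rlp_genCof_iff π).1 h 0 0 (-1) (-2) rfl rfl 0 (zero_mem _)
    (by rw [map_zero]; exact zero_mem _) (unitOne R) (mem_F_zero _ _) 0 (zero_mem _)
    (by rw [map_zero, unit_d, add_zero])
  have hde : ∀ m, Q.obj.d 0 m e ∈ Q.obj.F m 1 := fun m => by
    by_cases hm : m + 1 = 0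
    · obtain rfl : m = -1 := by omega
      rw [eq_neg_of_add_eq_zero_left heb.symm]
      exact neg_mem hb
    · rw [Q.obj.d_shape _ _ hm]
      exact zero_mem _
  let σ : ∀ n, (unit R).obj.X n →ₗ[R] Q.obj.X n := fun n =>
    (LinearMap.toSpanSingleton R _ (castX Q 0 n e)) ∘ₗ unitCoe n
  have hσ' : ∀ n r, σ n r = unitCoe n r • castX Q 0 n e := fun n r => rfl
  have hσ : ∀ n p r, r ∈ (unit R).obj.F n p → σ n r ∈ Q.obj.F n p := fun n p r hr => by
    rw [hσ']
    rcases eq_or_ne p 0 with rfl | hp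
    · exact mem_F_zero _ _
    · rw [unitCoe_F hr hp, zero_smul]
      exact zero_mem _
  have hπσ : ∀ n r, hf π n (σ n r) = r := fun n r => by
    rw [hσ']
    by_cases hn : n = 0
    · subst hn
      rw [castX_self, map_smul, he, smul_unitOne]
    · rw [unitCoe_eq_zero hn, zero_smul, map_zero]
      exact unitCoe_injective n (by rw [map_zero, unitCoe_eq_zero hn])
  have hdσ : ∀ n m p r, r ∈ (unit R).obj.F n p → Q.obj.d n m (σ n r) ∈ Q.obj.F m (p + 1) :=
    fun n m p r hr => by
      rw [hσ', map_smul]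
      by_cases hn : n = 0
      · subst hn
        rcases eq_or_ne p 0 with rfl | hp
        · rw [castX_self]
          exact Submodule.smul_mem _ _ (hde m)
        · rw [unitCoe_F hr hp, zero_smul]
          exact zero_mem _
      · rw [unitCoe_eq_zero hn, zero_smul]
        exact zero_mem _
  obtain ⟨S, hS, hπS, hSσ, hS'⟩ := exists_fiber_contraction h σ hσ hπσ
  refine gradedQuasiIso_tensorMap_of_filtered_homotopy X σ hσ hπσ
    (fun n m p r hm hr => ?_) (fun n => S n (n + 1)) (fun n p x hx => hS _ _ _ _ rfl hx)
    (fun l p x hx => ?_)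
  · rw [unit_d, map_zero, sub_zero]
    exact hdσ n m p r hr
  · have h1 := hS' _ (l + 1) l rfl rfl p (x - σ (l + 1) (hf π (l + 1) x))
      (sub_mem hx (hσ _ _ _ (f_F π hx))) (by rw [map_sub, hπσ, sub_self])
    have h2 := hS l (l + 1) _ _ rfl (hdσ (l + 1) l p _ (f_F π hx))
    have h3 := sub_mem h1 h2
    convert h3 using 1
    simp only [map_sub, hSσ, map_zero]
    abel

end UnitAxiom

/-! ### The pushout-product axiom and the main theorem -/

section Monoidal

variable (R : Type u) [Field R]

theorem isSymmetricMonoidalModelCategory :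
    IsSymmetricMonoidalModelCategory (CompleteGrDGMod R) where
  pushoutProduct_cofibration {A₁ X₁ A₂ X₂} i₁ i₂ sq h₁ h₂ := by
    intro T T' p hp
    let sq' := Functor.PullbackObjObj.ofHasPullback (homFunctor R) i₁ p
    -- Lifting the pushout-product against `p` is the same as lifting `i₂` against the pullback-hom
    -- of `i₁` and `p`.
    rw [(tensorHomAdjunction R).hasLiftingProperty_iff sq sq']
    exact h₂ _ (pullbackHom_rlp_genCof_of_rlp sq' h₁ hp)
  pushoutProduct_trivialCofibration {A₁ X₁ A₂ X₂} i₁ i₂ sq h₁ h₂ hw := by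
    rw [trivialCofibrations_eq, rlp_genTrivCof]
    intro T T' p hp
    let sq' := Functor.PullbackObjObj.ofHasPullback (homFunctor R) i₁ p
    rw [(tensorHomAdjunction R).hasLiftingProperty_iff sq sq']
    -- If `i₁` is trivial, the pullback-hom is a trivial fibration and `i₂` need only be a
    -- cofibration. If `i₂` is trivial, it suffices that the pullback-hom is a fibration.
    rcases hw with hw | hw
    · have h : trivialCofibrations (CompleteGrDGMod R) i₁ := ⟨h₁, hw⟩
      rw [trivialCofibrations_eq, rlp_genTrivCof] at h
      exact h₂ _ (pullbackHom_rlp_genCof_of_llp sq' h hp)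
    · have h : trivialCofibrations (CompleteGrDGMod R) i₂ := ⟨h₂, hw⟩
      rw [trivialCofibrations_eq, rlp_genTrivCof] at h
      exact h _ (pullbackHom_strictSurjection sq' h₁ hp)
  unit_left {Q} π _ hπ X _ := by
    rw [trivialFibrations_eq] at hπ
    exact gradedQuasiIso_tensorMap_unit hπ X
  unit_right {Q} π _ hπ X _ := by
    rw [trivialFibrations_eq] at hπ
    have h : weakEquivalences (CompleteGrDGMod R) (π ▷ X) := gradedQuasiIso_tensorMap_unit hπ X
    -- The right-hand version is conjugate to the left-hand one by the braiding.
    have e : X ◁ π = (β_ X Q).hom ≫ π ▷ X ≫ (β_ X (𝟙_ (CompleteGrDGMod R))).inv := by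
      rw [← BraidedCategory.braiding_naturality_right_assoc, Iso.hom_inv_id, Category.comp_id]
    rw [e]
    exact MorphismProperty.RespectsIso.precomp _ _ _ (MorphismProperty.RespectsIso.postcomp _ _ _ h)

end Monoidal

end CompleteGrDGMod

end GrDG

theorem mainTheorem8 (R : Type u) [Field R] [CharZero R] :
    HasLimits (GrDG.CompleteGrDGMod R) ∧ HasColimits (GrDG.CompleteGrDGMod R) ∧
    ∃ _ : ModelCategory (GrDG.CompleteGrDGMod R),
      weakEquivalences (GrDG.CompleteGrDGMod R) = GrDG.CompleteGrDGMod.gradedQuasiIso R ∧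
      fibrations (GrDG.CompleteGrDGMod R) = GrDG.CompleteGrDGMod.strictSurjection R ∧
      GrDG.HasFunctorialFactorizations (GrDG.CompleteGrDGMod R) ∧
      GrDG.IsCofibrantlyGeneratedBy (GrDG.CompleteGrDGMod R)
        (GrDG.CompleteGrDGMod.genCof R) (GrDG.CompleteGrDGMod.genTrivCof R) ∧
      GrDG.IsProper (GrDG.CompleteGrDGMod R) ∧
      GrDG.IsCombinatorial (GrDG.CompleteGrDGMod R) ∧
      GrDG.IsSymmetricMonoidalModelCategory (GrDG.CompleteGrDGMod R) :=
  ⟨inferInstance, inferInstance, GrDG.CompleteGrDGMod.modelCategory R, rfl, rfl,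
    GrDG.CompleteGrDGMod.hasFunctorialFactorizations R,
    GrDG.CompleteGrDGMod.isCofibrantlyGeneratedBy R, GrDG.CompleteGrDGMod.isProper R,
    GrDG.CompleteGrDGMod.isCombinatorial R,
    GrDG.CompleteGrDGMod.isSymmetricMonoidalModelCategory R⟩


end
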